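/- Let $(M,g,J,\Psi)$ be a smooth $6$-manifold with an $SU(3)$-structure: $g$ is a Riemannian metric, $J$ is a $g$-orthogonal almost complex structure, and $\Psi=\Psi^++\sqrt{-1}\,\Psi^-$ is a $(3,0)$-form such that near every point there is a $g$-orthonormal frame $e_1,\dots,e_6$ with $Je_1=e_2$, $Je_3=e_4$, $Je_5=e_6$ and $\Psi=-(e_1+\sqrt{-1}e_2)\wedge(e_3+\sqrt{-1}e_4)\wedge(e_5+\sqrt{-1}e_6)$ (vectors and $1$-forms being identified by $g$). Suppose that it is an almost Calabi–Yau space with torsion (ACYT), i.e. that there is a linear connection $\nabla$ with $\nabla g=\nabla J=\nabla\Psi^+=\nabla\Psi^-=0$ (so that its holonomy lies in $SU(3)$) whose torsion $T(X,Y,Z)=g(\nabla_XY-\nabla_YX-[X,Y],Z)$ is totally skew-symmetric; $\nabla$ is called the torsion connection. Let $F(X,Y)=g(X,JY)$ be the Kähler form, $\theta(X)=(\delta F)(JX)$ the Lee form, where $\delta$ is the codifferential of $g$, i.e. $(\delta F)(X)=-\sum_i(\nabla^g_{e_i}F)(e_i,X)$ with $\nabla^g$ the Levi-Civita connection and $e_i$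 an orthonormal basis, and $N(X,Y)=[JX,JY]-[X,Y]-J[JX,Y]-J[X,JY]$ the Nijenhuis tensor, $N(X,Y,Z)=g(N(X,Y),Z)$. Let $R(X,Y)Z=[\nabla_X,\nabla_Y]Z-\nabla_{[X,Y]}Z$ be the curvature and $Ric(X,Y)=\sum_i g(R(e_i,X)Y,e_i)$ the Ricci tensor of $\nabla$. The following conditions are equivalent: (a) the torsion is closed, $dT=0$; (b) $d\theta$ belongs to $su(3)\cong\Lambda^2_8$, i.e. it is $J$-invariant and trace-free, $d\theta(X,Y)=d\theta(JX,JY)$ and $\sum_{i,j}d\theta(e_i,e_j)F(e_i,e_j)=0$, and $Ric=-\nabla\theta$, i.e. $Ric(X,Y)=-(\nabla_X\theta)(Y)$ for all $X,Y$; (c) the Nijenhuis tensor is parallel with respect to the torsion connection, $\nabla N=0$, and $Ric=-\nabla\theta$. -/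

import Mathlib

open Bundle FiberBundle VectorField
open scoped Manifold ContDiff Bundle

namespace ACYT

noncomputable section

set_option linter.unusedSectionVars false

section RiemannianManifold

variable {E : Type*} [NormedAddCommGroup E] [NormedSpace ℝ E] [FiniteDimensional ℝ E]
  {M : Type*} [TopologicalSpace M] [ChartedSpace E M] [IsManifold 𝓘(ℝ, E) ∞ M]
  [RiemannianBundle (fun x : M ↦ TangentSpace 𝓘(ℝ, E) x)]

/-- Tangent spaces are finite dimensional. -/
instance finiteDimensional_tangentSpace (x : M) :
    FiniteDimensional ℝ (TangentSpace 𝓘(ℝ, E) x) :=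
  VectorBundle.finiteDimensional ℝ E (TangentSpace 𝓘(ℝ, E)) x

/-! ### The Levi-Civita connection -/

/-- The Koszul formula for `2 g(∇_V W, U)` at `x`, where `∇` is the Levi-Civita connection of the
Riemannian metric `g = inner ℝ`. -/
def koszul (W V U : Π x : M, TangentSpace 𝓘(ℝ, E) x) (x : M) : ℝ :=
  mvfderiv 𝓘(ℝ, E) (fun y ↦ inner ℝ (W y) (U y)) x (V x)
    + mvfderiv 𝓘(ℝ, E) (fun y ↦ inner ℝ (V y) (U y)) x (W x)
    - mvfderiv 𝓘(ℝ, E) (fun y ↦ inner ℝ (V y) (W y)) x (U x)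
    + inner ℝ (mlieBracket 𝓘(ℝ, E) V W x) (U x)
    - inner ℝ (mlieBracket 𝓘(ℝ, E) V U x) (W x)
    - inner ℝ (mlieBracket 𝓘(ℝ, E) W U x) (V x)

variable [IsContMDiffRiemannianBundle 𝓘(ℝ, E) ∞ E (fun x : M ↦ TangentSpace 𝓘(ℝ, E) x)]
  {W W' V U : Π x : M, TangentSpace 𝓘(ℝ, E) x} {x : M}

lemma mdifferentiableAt_inner (hV : MDiffAt (T% V) x) (hW : MDiffAt (T% W) x) :
    MDiffAt (fun y ↦ inner ℝ (V y) (W y)) x :=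
  MDifferentiableAt.inner_bundle (E := fun x : M ↦ TangentSpace 𝓘(ℝ, E) x)
    (F := E) (b := fun y ↦ y) hV hW

lemma tensorialAt_koszul_left (hW : MDiffAt (T% W) x) (hU : MDiffAt (T% U) x) :
    TensorialAt 𝓘(ℝ, E) E (fun V : Π x : M, TangentSpace 𝓘(ℝ, E) x ↦ koszul W V U x) x where
  smul {f V} hf hV := by
    simp [koszul, mvfderiv_fun_mul hf (mdifferentiableAt_inner hV hW),
      mvfderiv_fun_mul hf (mdifferentiableAt_inner hV hU), mlieBracket_smul_left hf hV,
      inner_add_left, inner_smul_left, inner_smul_right]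
    ring
  add {V V'} hV hV' := by
    simp [koszul, mvfderiv_fun_add (mdifferentiableAt_inner hV hW) (mdifferentiableAt_inner hV' hW),
      mvfderiv_fun_add (mdifferentiableAt_inner hV hU) (mdifferentiableAt_inner hV' hU),
      mlieBracket_add_left hV hV', inner_add_left, inner_add_right]
    ring

lemma tensorialAt_koszul_right (hW : MDiffAt (T% W) x) (hV : MDiffAt (T% V) x) :
    TensorialAt 𝓘(ℝ, E) E (fun U : Π x : M, TangentSpace 𝓘(ℝ, E) x ↦ koszul W V U x) x where
  smul {f U} hf hU := by
    simp [koszul, mvfderiv_fun_mul hf (mdifferentiableAt_inner hW hU),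
      mvfderiv_fun_mul hf (mdifferentiableAt_inner hV hU), mlieBracket_smul_right hf hU,
      inner_add_left, inner_smul_left, inner_smul_right]
    linear_combination (mvfderiv 𝓘(ℝ, E) f x (W x)) * real_inner_comm (U x) (V x)
      + (mvfderiv 𝓘(ℝ, E) f x (V x)) * real_inner_comm (U x) (W x)
  add {U U'} hU hU' := by
    simp [koszul, mvfderiv_fun_add (mdifferentiableAt_inner hW hU) (mdifferentiableAt_inner hW hU'),
      mvfderiv_fun_add (mdifferentiableAt_inner hV hU) (mdifferentiableAt_inner hV hU'),
      mlieBracket_add_right hU hU', inner_add_left, inner_add_right]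
    ring

lemma koszul_add (hW : MDiffAt (T% W) x) (hW' : MDiffAt (T% W') x) (hV : MDiffAt (T% V) x)
    (hU : MDiffAt (T% U) x) :
    koszul (W + W') V U x = koszul W V U x + koszul W' V U x := by
  simp [koszul, mvfderiv_fun_add (mdifferentiableAt_inner hW hU) (mdifferentiableAt_inner hW' hU),
    mvfderiv_fun_add (mdifferentiableAt_inner hV hW) (mdifferentiableAt_inner hV hW'),
    mlieBracket_add_right hW hW', mlieBracket_add_left hW hW', inner_add_left, inner_add_right]
  ring

lemma koszul_smul {f : M → ℝ} (hf : MDiffAt f x) (hW : MDiffAt (T% W) x)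
    (hV : MDiffAt (T% V) x) (hU : MDiffAt (T% U) x) :
    koszul (f • W) V U x =
      f x * koszul W V U x + 2 * (mvfderiv 𝓘(ℝ, E) f x (V x) * inner ℝ (W x) (U x)) := by
  simp [koszul, mvfderiv_fun_mul hf (mdifferentiableAt_inner hW hU),
    mvfderiv_fun_mul hf (mdifferentiableAt_inner hV hW), mlieBracket_smul_right hf hW,
    mlieBracket_smul_left hf hW, inner_add_left, inner_smul_left, inner_smul_right]
  linear_combination (mvfderiv 𝓘(ℝ, E) f x (U x)) * real_inner_comm (V x) (W x)

open scoped Classical in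
/-- The bilinear form `(v, u) ↦ 2 g(∇_v W, u)` on the tangent space at `x`, for a vector field `W`
that is differentiable at `x`. -/
def koszulForm (W : Π x : M, TangentSpace 𝓘(ℝ, E) x) (x : M) :
    TangentSpace 𝓘(ℝ, E) x →L[ℝ] TangentSpace 𝓘(ℝ, E) x →L[ℝ] ℝ :=
  if hW : MDiffAt (T% W) x then
    TensorialAt.mkHom₂ (koszul W · · x) x
      (fun _ hU ↦ tensorialAt_koszul_left hW hU) (fun _ hV ↦ tensorialAt_koszul_right hW hV)
  else 0

lemma koszulForm_eq (hW : MDiffAt (T% W) x) (v u : TangentSpace 𝓘(ℝ, E) x) :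
    koszulForm W x v u = koszul W (extend E v) (extend E u) x := by
  rw [koszulForm, dif_pos hW, TensorialAt.mkHom₂_apply_eq_extend]

lemma koszulForm_apply (hW : MDiffAt (T% W) x) (hV : MDiffAt (T% V) x) (hU : MDiffAt (T% U) x) :
    koszulForm W x (V x) (U x) = koszul W V U x := by
  rw [koszulForm, dif_pos hW, TensorialAt.mkHom₂_apply _ _ hV hU]

/-- The vector `∇_v W = ½ ∑ᵢ (2 g(∇_v W, eᵢ)) eᵢ` determined by the Koszul formula. -/
def leviCivitaFun (W : Π x : M, TangentSpace 𝓘(ℝ, E) x) (x : M) :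
    TangentSpace 𝓘(ℝ, E) x →L[ℝ] TangentSpace 𝓘(ℝ, E) x :=
  (1 / 2 : ℝ) • ∑ i, ((koszulForm W x).flip
    (stdOrthonormalBasis ℝ (TangentSpace 𝓘(ℝ, E) x) i)).smulRight
    (stdOrthonormalBasis ℝ (TangentSpace 𝓘(ℝ, E) x) i)

lemma inner_leviCivitaFun (v u : TangentSpace 𝓘(ℝ, E) x) :
    inner ℝ (leviCivitaFun W x v) u = (1 / 2) * koszulForm W x v u := by
  set b := stdOrthonormalBasis ℝ (TangentSpace 𝓘(ℝ, E) x) with hb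
  have h : koszulForm W x v u = ∑ i, koszulForm W x v (b i) * inner ℝ (b i) u := by
    conv_lhs => rw [← b.sum_repr' u]
    simp [mul_comm]
  rw [h]
  simp [leviCivitaFun, ← hb, sum_inner, inner_smul_left]

variable (E M) in
/-- The Levi-Civita connection of a Riemannian manifold. -/
def leviCivita : CovariantDerivative 𝓘(ℝ, E) E (fun x : M ↦ TangentSpace 𝓘(ℝ, E) x) where
  toFun := leviCivitaFun
  isCovariantDerivativeOnUniv :=
    { add := by
        intro W W' x hW hW' _
        ext1 v
        refine ext_inner_right ℝ fun u ↦ ?_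
        have hs : MDiffAt (T% (W + W')) x := mdifferentiableAt_add_section hW hW'
        simp only [add_apply, inner_add_left, inner_leviCivitaFun,
          koszulForm_eq hW, koszulForm_eq hW', koszulForm_eq hs]
        rw [koszul_add hW hW' (mdifferentiableAt_extend ..) (mdifferentiableAt_extend ..)]
        ring
      leibniz := by
        intro W f x hW hf _
        ext1 v
        refine ext_inner_right ℝ fun u ↦ ?_
        have hs : MDiffAt (T% (f • W)) x := hf.smul_section hW
        simp only [add_apply, smul_apply,
          ContinuousLinearMap.smulRight_apply, inner_add_left, inner_smul_left,
          inner_leviCivitaFun, koszulForm_eq hW, koszulForm_eq hs]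
        rw [koszul_smul hf hW (mdifferentiableAt_extend ..) (mdifferentiableAt_extend ..)]
        simp
        ring }

/-- The connection `D` is metric, `D g = 0`: `v (g(X, Y)) = g(D_v X, Y) + g(X, D_v Y)`. -/
def IsMetric (D : CovariantDerivative 𝓘(ℝ, E) E (fun x : M ↦ TangentSpace 𝓘(ℝ, E) x)) : Prop :=
  ∀ (x : M) (X Y : Π x : M, TangentSpace 𝓘(ℝ, E) x),
    MDiffAt (T% X) x → MDiffAt (T% Y) x → ∀ v : TangentSpace 𝓘(ℝ, E) x,
      mvfderiv 𝓘(ℝ, E) (fun y ↦ inner ℝ (X y) (Y y)) x v =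
        inner ℝ (D X x v) (Y x) + inner ℝ (X x) (D Y x v)

lemma isMetric_leviCivita : IsMetric (leviCivita E M) := by
  intro x X Y hX hY v
  have hv : MDiffAt (T% (extend E v)) x := mdifferentiableAt_extend ..
  have h1 := inner_leviCivitaFun (W := X) v (Y x)
  have h2 := inner_leviCivitaFun (W := Y) v (X x)
  have h3 := koszulForm_apply hX hv hY
  have h4 := koszulForm_apply hY hv hX
  rw [extend_apply_self] at h3 h4
  rw [h3] at h1
  rw [h4] at h2
  change _ = inner ℝ (leviCivitaFun X x v) (Y x) + inner ℝ (X x) (leviCivitaFun Y x v)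
  rw [real_inner_comm (leviCivitaFun Y x v) (X x), h1, h2]
  have h5 : (fun y ↦ inner ℝ (Y y) (X y)) = fun y ↦ inner ℝ (X y) (Y y) :=
    funext fun y ↦ real_inner_comm _ _
  simp only [koszul, extend_apply_self, h5]
  rw [mlieBracket_swap_apply (V := Y) (W := X), inner_neg_left]
  ring

lemma torsion_leviCivita : (leviCivita E M).torsion = 0 := by
  rw [CovariantDerivative.torsion_eq_zero_iff]
  intro X Y x hX hY
  refine ext_inner_right ℝ fun u ↦ ?_
  have hu : MDiffAt (T% (extend E u)) x := mdifferentiableAt_extend ..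
  have h1 := inner_leviCivitaFun (W := Y) (X x) u
  have h2 := inner_leviCivitaFun (W := X) (Y x) u
  have h3 := koszulForm_apply hY hX hu
  have h4 := koszulForm_apply hX hY hu
  rw [extend_apply_self] at h3 h4
  rw [h3] at h1
  rw [h4] at h2
  change inner ℝ (leviCivitaFun Y x (X x) - leviCivitaFun X x (Y x)) u = _
  rw [inner_sub_left, h1, h2]
  have h5 : (fun y ↦ inner ℝ (Y y) (X y)) = fun y ↦ inner ℝ (X y) (Y y) :=
    funext fun y ↦ real_inner_comm _ _
  simp only [koszul, extend_apply_self, h5]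
  rw [mlieBracket_swap_apply (V := Y) (W := X), inner_neg_left]
  ring

/-! ### Tensor calculus

A covariant `k`-tensor field with values in `G` is given by its values
`S x w` on `w : Fin k → TangentSpace 𝓘(ℝ, E) x`.  To differentiate at `x`, tangent vectors at `x`
are extended by Mathlib's `FiberBundle.extend` to vector fields that are smooth near `x`; for a
smooth (multilinear) tensor field the results do not depend on the extension. -/

/-- `(D_v S)(w₁, …, w_k) = v (S(W₁, …, W_k)) - ∑ᵢ S(w₁, …, D_v Wᵢ, …, w_k)`, where `Wᵢ` extends
`wᵢ`. -/
def covDeriv {G : Type*} [NormedAddCommGroup G] [NormedSpace ℝ G] {k : ℕ}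
    (D : CovariantDerivative 𝓘(ℝ, E) E (fun x : M ↦ TangentSpace 𝓘(ℝ, E) x))
    (S : Π x : M, (Fin k → TangentSpace 𝓘(ℝ, E) x) → G) (x : M)
    (v : TangentSpace 𝓘(ℝ, E) x) (w : Fin k → TangentSpace 𝓘(ℝ, E) x) : G :=
  mvfderiv 𝓘(ℝ, E) (fun y ↦ S y (fun i ↦ extend E (w i) y)) x v
    - ∑ i, S x (Function.update w i (D (extend E (w i)) x v))

/-- The exterior derivative of an `(n + 1)`-form `S`, by the invariant formula
`dS(W₀, …) = ∑ᵢ (-1)ⁱ Wᵢ (S(…, Ŵᵢ, …)) + ∑_{i < j} (-1)^{i + j} S([Wᵢ, Wⱼ], …, Ŵᵢ, …, Ŵⱼ, …)`.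
In the second sum the pair `i < j` is written `(i.castSucc, j.succ)` with `i ≤ j`, whence the
sign. -/
def extD {n : ℕ} (S : Π x : M, (Fin (n + 1) → TangentSpace 𝓘(ℝ, E) x) → ℝ) (x : M)
    (w : Fin (n + 2) → TangentSpace 𝓘(ℝ, E) x) : ℝ :=
  (∑ i : Fin (n + 2), (-1 : ℝ) ^ (i : ℕ) *
      mvfderiv 𝓘(ℝ, E) (fun y ↦ S y (i.removeNth fun k ↦ extend E (w k) y)) x (w i))
    - ∑ i : Fin (n + 1), ∑ j ≥ i, (-1 : ℝ) ^ (i + j : ℕ) *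
        S x (Matrix.vecCons
          (mlieBracket 𝓘(ℝ, E) (extend E (w i.castSucc)) (extend E (w j.succ)) x)
          (j.removeNth (i.castSucc.removeNth w)))

/-- The codifferential of a 2-form, `(δS)(u) = -∑ᵢ (∇^g_{eᵢ} S)(eᵢ, u)` for an orthonormal basis
`eᵢ`, with `∇^g` the Levi-Civita connection. -/
def codiff₂ (S : Π x : M, (Fin 2 → TangentSpace 𝓘(ℝ, E) x) → ℝ) (x : M)
    (u : TangentSpace 𝓘(ℝ, E) x) : ℝ :=
  -∑ i, covDeriv (leviCivita E M) S x (stdOrthonormalBasis ℝ (TangentSpace 𝓘(ℝ, E) x) i)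
    ![stdOrthonormalBasis ℝ (TangentSpace 𝓘(ℝ, E) x) i, u]

/-- The curvature `R(X, Y)Z = [D_X, D_Y]Z - D_{[X, Y]}Z`. -/
def curvature (D : CovariantDerivative 𝓘(ℝ, E) E (fun x : M ↦ TangentSpace 𝓘(ℝ, E) x)) (x : M)
    (u v w : TangentSpace 𝓘(ℝ, E) x) : TangentSpace 𝓘(ℝ, E) x :=
  D (fun y ↦ D (extend E w) y (extend E v y)) x u
    - D (fun y ↦ D (extend E w) y (extend E u y)) x v
    - D (extend E w) x (mlieBracket 𝓘(ℝ, E) (extend E u) (extend E v) x)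

/-- The Ricci tensor `Ric(u, v) = ∑ᵢ g(R(eᵢ, u)v, eᵢ)`. -/
def ricci (D : CovariantDerivative 𝓘(ℝ, E) E (fun x : M ↦ TangentSpace 𝓘(ℝ, E) x)) (x : M)
    (u v : TangentSpace 𝓘(ℝ, E) x) : ℝ :=
  ∑ i, inner ℝ (curvature D x (stdOrthonormalBasis ℝ (TangentSpace 𝓘(ℝ, E) x) i) u v)
    (stdOrthonormalBasis ℝ (TangentSpace 𝓘(ℝ, E) x) i)

/-- The torsion as a `(0,3)`-tensor, `T(X, Y, Z) = g(T(X, Y), Z)`, where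
`T(X, Y) = D_X Y - D_Y X - [X, Y]`. -/
def torsionForm (D : CovariantDerivative 𝓘(ℝ, E) E (fun x : M ↦ TangentSpace 𝓘(ℝ, E) x)) (x : M)
    (w : Fin 3 → TangentSpace 𝓘(ℝ, E) x) : ℝ :=
  inner ℝ (D.torsion x (w 0) (w 1)) (w 2)

/-! ### Almost Hermitian structures -/

/-- `J` is a smooth almost complex structure that is orthogonal for `g`. -/
structure IsAlmostHermitian
    (J : Π x : M, TangentSpace 𝓘(ℝ, E) x →L[ℝ] TangentSpace 𝓘(ℝ, E) x) : Prop where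
  smooth : ContMDiff 𝓘(ℝ, E) (𝓘(ℝ, E).prod 𝓘(ℝ, E →L[ℝ] E)) ∞
    (fun x ↦ TotalSpace.mk' (E →L[ℝ] E)
      (E := fun x : M ↦ TangentSpace 𝓘(ℝ, E) x →L[ℝ] TangentSpace 𝓘(ℝ, E) x) x (J x))
  sq_eq_neg : ∀ (x : M) (v : TangentSpace 𝓘(ℝ, E) x), J x (J x v) = -v
  inner_map_map : ∀ (x : M) (v w : TangentSpace 𝓘(ℝ, E) x), inner ℝ (J x v) (J x w) = inner ℝ v w

variable (J : Π x : M, TangentSpace 𝓘(ℝ, E) x →L[ℝ] TangentSpace 𝓘(ℝ, E) x)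

/-- The Kähler form `F(X, Y) = g(X, JY)`. -/
def kahlerForm (x : M) (w : Fin 2 → TangentSpace 𝓘(ℝ, E) x) : ℝ :=
  inner ℝ (w 0) (J x (w 1))

/-- The Lee form `θ(X) = δF(JX)`. -/
def leeForm (x : M) (w : Fin 1 → TangentSpace 𝓘(ℝ, E) x) : ℝ :=
  codiff₂ (kahlerForm J) x (J x (w 0))

/-- The Nijenhuis tensor `N(X, Y) = [JX, JY] - [X, Y] - J[JX, Y] - J[X, JY]`. -/
def nijenhuis (x : M) (u v : TangentSpace 𝓘(ℝ, E) x) : TangentSpace 𝓘(ℝ, E) x :=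
  mlieBracket 𝓘(ℝ, E) (fun y ↦ J y (extend E u y)) (fun y ↦ J y (extend E v y)) x
    - mlieBracket 𝓘(ℝ, E) (extend E u) (extend E v) x
    - J x (mlieBracket 𝓘(ℝ, E) (fun y ↦ J y (extend E u y)) (extend E v) x)
    - J x (mlieBracket 𝓘(ℝ, E) (extend E u) (fun y ↦ J y (extend E v y)) x)

/-- The Nijenhuis tensor as a `(0,3)`-tensor, `N(X, Y, Z) = g(N(X, Y), Z)`. -/
def nijenhuisForm (x : M) (w : Fin 3 → TangentSpace 𝓘(ℝ, E) x) : ℝ :=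
  inner ℝ (nijenhuis J x (w 0) (w 1)) (w 2)

/-- The 2-form `φ` lies in `su(3) ≅ Λ²₈`: it is `J`-invariant and trace-free, `φ ⌟ F = 0`. -/
def IsInLambda28 (φ : Π x : M, (Fin 2 → TangentSpace 𝓘(ℝ, E) x) → ℝ) : Prop :=
  ∀ x : M,
    (∀ u v : TangentSpace 𝓘(ℝ, E) x, φ x ![u, v] = φ x ![J x u, J x v]) ∧
    ∑ i, ∑ j,
      φ x ![stdOrthonormalBasis ℝ (TangentSpace 𝓘(ℝ, E) x) i,
        stdOrthonormalBasis ℝ (TangentSpace 𝓘(ℝ, E) x) j] *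
      kahlerForm J x ![stdOrthonormalBasis ℝ (TangentSpace 𝓘(ℝ, E) x) i,
        stdOrthonormalBasis ℝ (TangentSpace 𝓘(ℝ, E) x) j] = 0

/-! ### `SU(3)`-structures and almost Calabi-Yau structures with torsion -/

/-- `(g, J, Ψ)` is an `SU(3)`-structure: around every point there is a frame `e₀, …, e₅`,
orthonormal for `g`, with `J e₀ = e₁`, `J e₂ = e₃`, `J e₄ = e₅` and
`Ψ = -(e⁰ + i e¹) ∧ (e² + i e³) ∧ (e⁴ + i e⁵)`.  Since `J` and `Ψ` are smooth it is enough to ask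
for such a basis of each tangent space. -/
structure IsSU3Structure
    (Ψ : Π x : M, (TangentSpace 𝓘(ℝ, E) x) [⋀^Fin 3]→ₗ[ℝ] ℂ) : Prop
    extends IsAlmostHermitian J where
  smooth_form : ∀ (x : M) (X : Fin 3 → Π x : M, TangentSpace 𝓘(ℝ, E) x),
    (∀ i, CMDiffAt ∞ (T% (X i)) x) →
      ContMDiffAt 𝓘(ℝ, E) 𝓘(ℝ, ℂ) ∞ (fun y ↦ Ψ y (fun i ↦ X i y)) x
  exists_adapted : ∀ x : M, ∃ e : OrthonormalBasis (Fin 6) ℝ (TangentSpace 𝓘(ℝ, E) x),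
    J x (e 0) = e 1 ∧ J x (e 2) = e 3 ∧ J x (e 4) = e 5 ∧
    ∀ w : Fin 3 → TangentSpace 𝓘(ℝ, E) x,
      Ψ x w = -Matrix.det (Matrix.of fun a b : Fin 3 ↦
        ((inner ℝ (![e 0, e 2, e 4] a) (w b) : ℝ) : ℂ)
          + Complex.I * ((inner ℝ (![e 1, e 3, e 5] a) (w b) : ℝ) : ℂ))

/-- `(M, g, J, Ψ)` is an almost Calabi-Yau space with torsion, with torsion connection `D`: the
smooth connection `D` has totally skew-symmetric torsion and preserves the `SU(3)`-structure,
`D g = D J = D Ψ = 0`. -/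
structure IsACYT (Ψ : Π x : M, (TangentSpace 𝓘(ℝ, E) x) [⋀^Fin 3]→ₗ[ℝ] ℂ)
    (D : CovariantDerivative 𝓘(ℝ, E) E (fun x : M ↦ TangentSpace 𝓘(ℝ, E) x)) : Prop
    extends IsSU3Structure J Ψ where
  smooth_connection : D.ContMDiffCovariantDerivative ∞
  metric : IsMetric D
  parallel_J : ∀ (x : M) (X : Π x : M, TangentSpace 𝓘(ℝ, E) x), MDiffAt (T% X) x →
    ∀ v : TangentSpace 𝓘(ℝ, E) x, D (fun y ↦ J y (X y)) x v = J x (D X x v)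
  parallel_form : ∀ (x : M) (v : TangentSpace 𝓘(ℝ, E) x) (w : Fin 3 → TangentSpace 𝓘(ℝ, E) x),
    covDeriv D (fun y u ↦ Ψ y u) x v w = 0
  skew_torsion : ∀ (x : M) (u v w : TangentSpace 𝓘(ℝ, E) x),
    torsionForm D x ![u, v, w] = -torsionForm D x ![u, w, v]

end RiemannianManifold

end

end ACYT

/-!
Let `D = ∇` be the torsion connection, `R` its curvature and `Q` the 4-form built quadratically
from `T` (`ACYT.torsionSq`). All of the equivalence follows from three facts.

* The first Bianchi identity for a metric connection with skew-symmetric torsion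
  (`ACYT.bianchi`), combined with the expression of `dT` through `∇T` and `Q`
  (`ACYT.extD_torsionForm`), gives
  `R(v, a, b, c) + R(v, b, c, a) + R(v, c, a, b) = (∇_v T)(a, b, c) - ½ dT(a, b, c, v)`
  (`ACYT.curvatureForm_cyclic`).
* As `g`, `J` and `Ψ` are parallel, `R(u, v)` is skew-symmetric, commutes with `J` and has no
  complex trace, `∑ᵢ R(u, v, eᵢ, J eᵢ) = 0` (`ACYT.sum_inner_curvature_J`).
* `θ` is the contraction of `T` with `F`, so that `∇θ` is the contraction of `∇T`
  (`ACYT.covDeriv_leeForm`).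

Contracting the cyclic identity with `F` yields
`Ric(X, JY) + (∇_X θ)(JY) = -¼ ∑ᵢ dT(X, Y, eᵢ, J eᵢ)` (`ACYT.ricci_add_covDeriv_leeForm`). In
dimension six a 4-form is determined by its contraction with `F`
(`ACYT.four_form_components_eq_zero`), whence `dT = 0` if and only if `Ric = -∇θ`. This proves that
(b) and (c) imply (a), and half of the converse. It remains to see that `dT = 0` implies the other
conditions of (b) and (c).

* `∇N = 0`: if `dT = 0`, the cyclic identity expresses `∇T` through `R`, and in the expression of
  `∇N` through `∇T` all terms cancel because `R(u, v)` commutes with `J`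
  (`ACYT.covDeriv_nijenhuisForm_eq_zero`).
* `dθ` is trace-free: by `Ric = -∇θ` the 2-form `dθ` is the skew-symmetrization of `-Ric` plus
  `θ(T(·, ·))`. The trace of the first with `F` is a multiple of `∑ᵢₖ R(eₖ, eᵢ, J eᵢ, eₖ)`, which is
  skew-symmetric in `i` and `k`; that of the second is a multiple of `g(t, Jt) = 0`, where `t` is
  the vector with `θ = -g(t, J ·)` (`ACYT.extD_leeForm_trace`).
* `dθ` is `J`-invariant: the Ricci contraction of the cyclic identity is
  `Ric(X, Y) - Ric(Y, X) = ∑ᵢ (∇_{eᵢ} T)(X, Y, eᵢ)`, and contracting the Bianchi identity with `F`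
  gives a similar formula for `Ric(Y, JX) - Ric(X, JY)`, which involves `Q`. These are compared by
  contracting `∇N = 0`; the remaining terms, quadratic in `T`, cancel by a pointwise identity for
  3-forms on `ℝ⁶`, which expresses the part of type `(2,0) + (0,2)` of the contraction of `Q` with
  `F` through `θ ∘ T` (`ACYT.torsionSqContraction_add`, `ACYT.extD_leeForm_J`).
-/

namespace ACYT

open Filter Topology

set_option linter.unusedSectionVars false

/-! ### Smooth local vector fields -/

section SmoothFields

variable {E : Type*} [NormedAddCommGroup E] [NormedSpace ℝ E] [FiniteDimensional ℝ E]
  {M : Type*} [TopologicalSpace M] [ChartedSpace E M] [IsManifold 𝓘(ℝ, E) ∞ M]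
  {U V W : Π x : M, TangentSpace 𝓘(ℝ, E) x} {x : M}

/-- The vector field `W` is smooth on a neighbourhood of `x`. -/
def SmoothNear (W : Π x : M, TangentSpace 𝓘(ℝ, E) x) (x : M) : Prop :=
  ∀ᶠ y in 𝓝 x, CMDiffAt ∞ (T% W) y

lemma SmoothNear.contMDiffAt (h : SmoothNear W x) : CMDiffAt ∞ (T% W) x := h.self_of_nhds

lemma SmoothNear.mdiffAt (h : SmoothNear W x) : MDiffAt (T% W) x :=
  h.contMDiffAt.mdifferentiableAt (by simp)

lemma SmoothNear.eventually (h : SmoothNear W x) : ∀ᶠ y in 𝓝 x, SmoothNear W y :=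
  eventually_eventually_nhds.2 h

lemma SmoothNear.eventually_mdiffAt (h : SmoothNear W x) : ∀ᶠ y in 𝓝 x, MDiffAt (T% W) y :=
  h.eventually.mono fun _ hy ↦ hy.mdiffAt

lemma SmoothNear.congr (h : SmoothNear W x) (hV : ∀ᶠ y in 𝓝 x, V y = W y) : SmoothNear V x := by
  filter_upwards [h, eventually_eventually_nhds.2 hV] with y hy hy'
  exact hy.congr_of_eventuallyEq (hy'.mono fun z hz ↦ by simp [hz])

lemma smoothNear_extend (v : TangentSpace 𝓘(ℝ, E) x) : SmoothNear (extend E v) x := by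
  obtain ⟨s, hs, hsm⟩ := exists_contMDiffOn_extend (k := ∞) 𝓘(ℝ, E) E v
  filter_upwards [eventually_mem_nhds_iff.2 hs] with y hy
  exact hsm.contMDiffAt hy

lemma SmoothNear.add (hV : SmoothNear V x) (hW : SmoothNear W x) :
    SmoothNear (fun y ↦ V y + W y) x := by
  filter_upwards [hV, hW] with y h1 h2
  exact h1.add_section h2

lemma SmoothNear.sub (hV : SmoothNear V x) (hW : SmoothNear W x) :
    SmoothNear (fun y ↦ V y - W y) x := by
  filter_upwards [hV, hW] with y h1 h2
  exact h1.sub_section h2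

lemma SmoothNear.bracket (hV : SmoothNear V x) (hW : SmoothNear W x) :
    SmoothNear (mlieBracket 𝓘(ℝ, E) V W) x := by
  filter_upwards [hV, hW] with y h1 h2
  have : IsManifold 𝓘(ℝ, E) (((⊤ : ℕ∞) : ℕ∞ω) + 1) M := by
    simpa using ‹IsManifold 𝓘(ℝ, E) ∞ M›
  have : IsManifold 𝓘(ℝ, E) (minSmoothness ℝ 2) M := by
    simpa using (inferInstance : IsManifold 𝓘(ℝ, E) 2 M)
  have : IsManifold 𝓘(ℝ, E) (minSmoothness ℝ 3) M := by
    simpa using (inferInstance : IsManifold 𝓘(ℝ, E) 3 M)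
  exact ContMDiffAt.mlieBracket_vectorField (n := ⊤) (m := ⊤) h1 h2 (by simp)

/-- A smooth field of endomorphisms maps smooth fields to smooth fields. -/
lemma SmoothNear.clm_apply {L : Π x : M, TangentSpace 𝓘(ℝ, E) x →L[ℝ] TangentSpace 𝓘(ℝ, E) x}
    (hL : ContMDiff 𝓘(ℝ, E) (𝓘(ℝ, E).prod 𝓘(ℝ, E →L[ℝ] E)) ∞
      (fun x ↦ TotalSpace.mk' (E →L[ℝ] E)
        (E := fun x : M ↦ TangentSpace 𝓘(ℝ, E) x →L[ℝ] TangentSpace 𝓘(ℝ, E) x) x (L x)))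
    (hW : SmoothNear W x) : SmoothNear (fun y ↦ L y (W y)) x := by
  filter_upwards [hW] with y hy
  exact ContMDiffAt.clm_bundle_apply (hL y) hy

variable [T2Space M]

/-- A local smooth field agrees near the point with a global one; hence `D_V W` is smooth near `x`
when `V` and `W` are, although the smoothness of a connection refers to global fields. -/
lemma SmoothNear.connection
    {D : CovariantDerivative 𝓘(ℝ, E) E (fun x : M ↦ TangentSpace 𝓘(ℝ, E) x)}
    (hD : D.ContMDiffCovariantDerivative ∞) (hV : SmoothNear V x) (hW : SmoothNear W x) :
    SmoothNear (fun y ↦ D W y (V y)) x := by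
  obtain ⟨u, hu, huo, hxu⟩ := mem_nhds_iff.1 hW
  obtain ⟨ψ, hψ, -⟩ :=
    (SmoothBumpFunction.nhds_basis_support (I := 𝓘(ℝ, E)) (huo.mem_nhds hxu)).mem_iff.1
      (huo.mem_nhds hxu)
  have hglob : CMDiff ∞ (T% ((ψ : M → ℝ) • W)) :=
    ContMDiffOn.smul_section_of_tsupport ψ.contMDiff.contMDiffOn huo hψ
      (fun y hy ↦ (hu hy : CMDiffAt ∞ (T% W) y).contMDiffWithinAt)
  have hDg := hD.contMDiff.contMDiff (σ := (ψ : M → ℝ) • W)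
    (by simpa using hglob.contMDiffOn)
  have hev : ∀ᶠ y in 𝓝 x, ((ψ : M → ℝ) • W) y = W y := by
    filter_upwards [ψ.eventuallyEq_one] with y hy
    simp [hy]
  filter_upwards [hV, eventually_eventually_nhds.2 hev, hW.eventually] with y hVy hey hWy
  have h1 := ContMDiffAt.clm_bundle_apply ((contMDiffOn_univ.1 hDg) y) hVy
  refine h1.congr_of_eventuallyEq ?_
  filter_upwards [eventually_eventually_nhds.2 hey, hWy.eventually_mdiffAt] with z hz hWz
  have := D.isCovariantDerivativeOn.congr_of_eventuallyEq
    ((hglob z).mdifferentiableAt (by simp)) hWz univ_mem hz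
  simp only [TotalSpace.mk']
  rw [this]

end SmoothFields

/-! ### Derivatives of functions along brackets -/

section Bracket

variable {E : Type*} [NormedAddCommGroup E] [NormedSpace ℝ E] [FiniteDimensional ℝ E]
  {M : Type*} [TopologicalSpace M] [ChartedSpace E M] [IsManifold 𝓘(ℝ, E) ∞ M]
  {U V W : Π x : M, TangentSpace 𝓘(ℝ, E) x} {x : M}

/-- The Jacobi identity for vector fields that are smooth near a point. -/
lemma SmoothNear.jacobi (hU : SmoothNear U x) (hV : SmoothNear V x) (hW : SmoothNear W x) :
    mlieBracket 𝓘(ℝ, E) U (mlieBracket 𝓘(ℝ, E) V W) x =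
      mlieBracket 𝓘(ℝ, E) (mlieBracket 𝓘(ℝ, E) U V) W x
        + mlieBracket 𝓘(ℝ, E) V (mlieBracket 𝓘(ℝ, E) U W) x := by
  have h2 : minSmoothness ℝ 2 ≤ (∞ : ℕ∞ω) := by simpa using ENat.LEInfty.out
  have : IsManifold 𝓘(ℝ, E) (minSmoothness ℝ 3) M := by
    simpa using (inferInstance : IsManifold 𝓘(ℝ, E) 3 M)
  exact leibniz_identity_mlieBracket_apply (hU.contMDiffAt.of_le h2) (hV.contMDiffAt.of_le h2)
    (hW.contMDiffAt.of_le h2)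

/-- `[U, V] f = U (V f) - V (U f)`.  This is the coefficient of a nonvanishing field `W` in the
Jacobi identity for `U`, `V` and `f W`. -/
lemma SmoothNear.mvfderiv_mlieBracket {f : M → ℝ} (hU : SmoothNear U x) (hV : SmoothNear V x)
    (hf : ∀ᶠ y in 𝓝 x, CMDiffAt ∞ f y)
    (hUf : MDiffAt (fun y ↦ mvfderiv 𝓘(ℝ, E) f y (U y)) x)
    (hVf : MDiffAt (fun y ↦ mvfderiv 𝓘(ℝ, E) f y (V y)) x) :
    mvfderiv 𝓘(ℝ, E) f x (mlieBracket 𝓘(ℝ, E) U V x) =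
      mvfderiv 𝓘(ℝ, E) (fun y ↦ mvfderiv 𝓘(ℝ, E) f y (V y)) x (U x)
        - mvfderiv 𝓘(ℝ, E) (fun y ↦ mvfderiv 𝓘(ℝ, E) f y (U y)) x (V x) := by
  rcases subsingleton_or_nontrivial (TangentSpace 𝓘(ℝ, E) x) with hsub | hnon
  · rw [Subsingleton.elim (mlieBracket 𝓘(ℝ, E) U V x) 0, Subsingleton.elim (U x) 0,
      Subsingleton.elim (V x) 0]
    simp
  obtain ⟨w, hw⟩ := exists_ne (0 : TangentSpace 𝓘(ℝ, E) x)
  set W := extend E w with hWdef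
  have hW : SmoothNear W x := smoothNear_extend w
  have hfW : SmoothNear (f • W) x := by
    filter_upwards [hf, hW] with y h1 h2
    exact h1.smul_section h2
  have hfx : MDiffAt f x := hf.self_of_nhds.mdifferentiableAt (by simp)
  have key {Z Z' : Π x : M, TangentSpace 𝓘(ℝ, E) x}
      (hZ : SmoothNear Z x) (hZf : MDiffAt (fun y ↦ mvfderiv 𝓘(ℝ, E) f y (Z y)) x) :
      mlieBracket 𝓘(ℝ, E) Z' (mlieBracket 𝓘(ℝ, E) Z (f • W)) x =
        mvfderiv 𝓘(ℝ, E) (fun y ↦ mvfderiv 𝓘(ℝ, E) f y (Z y)) x (Z' x) • W x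
        + mvfderiv 𝓘(ℝ, E) f x (Z x) • mlieBracket 𝓘(ℝ, E) Z' W x
        + (mvfderiv 𝓘(ℝ, E) f x (Z' x) • mlieBracket 𝓘(ℝ, E) Z W x
        + f x • mlieBracket 𝓘(ℝ, E) Z' (mlieBracket 𝓘(ℝ, E) Z W) x) := by
    have hev : mlieBracket 𝓘(ℝ, E) Z (f • W) =ᶠ[𝓝 x]
        ((fun y ↦ mvfderiv 𝓘(ℝ, E) f y (Z y)) • W) + (f • mlieBracket 𝓘(ℝ, E) Z W) := by
      filter_upwards [hf, hW.eventually_mdiffAt] with y h1 h2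
      rw [mlieBracket_smul_right (h1.mdifferentiableAt (by simp)) h2]
      rfl
    have hb := (hZ.bracket hW).mdiffAt
    rw [(EventuallyEq.refl _ _).mlieBracket_vectorField_eq hev,
      mlieBracket_add_right (hZf.smul_section hW.mdiffAt) (hfx.smul_section hb),
      mlieBracket_smul_right hZf hW.mdiffAt, mlieBracket_smul_right hfx hb]
  have h1 := hU.jacobi hV hfW
  rw [key hV hVf, key hU hUf, mlieBracket_smul_right hfx hW.mdiffAt, hU.jacobi hV hW] at h1
  have hWx : W x = w := by simp [W]
  rw [hWx] at h1
  have h2 : (mvfderiv 𝓘(ℝ, E) (fun y ↦ mvfderiv 𝓘(ℝ, E) f y (V y)) x (U x)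
      - mvfderiv 𝓘(ℝ, E) (fun y ↦ mvfderiv 𝓘(ℝ, E) f y (U y)) x (V x)
      - mvfderiv 𝓘(ℝ, E) f x (mlieBracket 𝓘(ℝ, E) U V x)) • w = 0 := by
    rw [← sub_eq_zero.2 h1]
    module
  rcases smul_eq_zero.1 h2 with h | h
  · linarith
  · exact absurd h hw

end Bracket

/-! ### Tensoriality of the covariant derivative of a tensor field -/

section Tensoriality

variable {E : Type*} [NormedAddCommGroup E] [NormedSpace ℝ E] [FiniteDimensional ℝ E]
  {M : Type*} [TopologicalSpace M] [ChartedSpace E M] [IsManifold 𝓘(ℝ, E) ∞ M]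
  {G : Type*} [NormedAddCommGroup G] [NormedSpace ℝ G] {k : ℕ}
  {S : Π x : M, MultilinearMap ℝ (fun _ : Fin k ↦ TangentSpace 𝓘(ℝ, E) x) G}
  {W : Fin k → Π x : M, TangentSpace 𝓘(ℝ, E) x} {x : M}

lemma update_field_apply (W : Fin k → Π x : M, TangentSpace 𝓘(ℝ, E) x) (i : Fin k)
    (σ : Π x : M, TangentSpace 𝓘(ℝ, E) x) (y : M) :
    (fun j ↦ Function.update W i σ j y) = Function.update (fun j ↦ W j y) i (σ y) := by
  ext j
  by_cases h : j = i
  · subst h; simp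
  · simp [h]

/-- A tensor field that is differentiable on smooth fields is differentiable on differentiable
fields: expand the fields in a local frame. -/
lemma mdiffAt_multilinear_apply
    (hS : ∀ X : Fin k → Π x : M, TangentSpace 𝓘(ℝ, E) x, (∀ i, SmoothNear (X i) x) →
      MDiffAt (fun y ↦ S y (fun i ↦ X i y)) x)
    (hW : ∀ i, MDiffAt (T% (W i)) x) : MDiffAt (fun y ↦ S y (fun i ↦ W i y)) x := by
  classical
  let t := trivializationAt E (TangentSpace 𝓘(ℝ, E) : M → Type _) x
  have x_mem : x ∈ t.baseSet := FiberBundle.mem_baseSet_trivializationAt E _ x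
  let b := Module.finBasis ℝ E
  let s := t.localFrame b
  let c := t.localFrameCoeff 𝓘(ℝ, E) b
  have hs (j) : SmoothNear (s j) x := by
    filter_upwards [t.open_baseSet.mem_nhds x_mem] with y hy
    exact contMDiffAt_localFrame_of_mem ∞ t b j hy
  have hc (i j) : MDiffAt (fun y ↦ c j y (W i y)) x :=
    mdifferentiableAt_localFrameCoeff b x_mem (hW i) j
  have hev : ∀ᶠ y in 𝓝 x, S y (fun i ↦ W i y) =
      ∑ f : Fin k → Fin (Module.finrank ℝ E),
        (∏ i, c (f i) y (W i y)) • S y (fun i ↦ s (f i) y) := by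
    filter_upwards [t.open_baseSet.mem_nhds x_mem] with y hy
    have h1 : (fun i ↦ W i y) = fun i ↦ ∑ j, c j y (W i y) • s j y := by
      ext1 i
      exact t.eq_sum_localFrameCoeff_smul hy
    rw [h1, MultilinearMap.map_sum]
    refine Finset.sum_congr rfl fun f _ ↦ ?_
    exact (S y).map_smul_univ _ _
  refine MDifferentiableAt.congr_of_eventuallyEq ?_ hev
  have hprod (f : Fin k → Fin (Module.finrank ℝ E)) :
      MDiffAt (fun y ↦ ∏ i, c (f i) y (W i y)) x := by
    have := MDifferentiableAt.prod (I := 𝓘(ℝ, E)) (t := Finset.univ) (z := x)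
      (f := fun i y ↦ c (f i) y (W i y)) fun i _ ↦ hc i (f i)
    simpa only [Finset.prod_fn] using this
  have := MDifferentiableAt.sum (I := 𝓘(ℝ, E)) (t := Finset.univ) (z := x)
    (f := fun (f : Fin k → Fin (Module.finrank ℝ E)) y ↦
      (∏ i, c (f i) y (W i y)) • S y (fun i ↦ s (f i) y))
    fun f _ ↦ (hprod f).smul (hS _ fun i ↦ hs (f i))
  simpa only [Finset.sum_fn] using this

variable (D : CovariantDerivative 𝓘(ℝ, E) E (fun x : M ↦ TangentSpace 𝓘(ℝ, E) x))
  (S W x) (v : TangentSpace 𝓘(ℝ, E) x)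

/-- `v (S(W₁, …, W_k)) - ∑ᵢ S(W₁, …, D_v Wᵢ, …, W_k)` at `x`, for vector fields `Wᵢ`. -/
noncomputable def covDerivField : G :=
  mvfderiv 𝓘(ℝ, E) (fun y ↦ S y (fun i ↦ W i y)) x v
    - ∑ i, S x (Function.update (fun i ↦ W i x) i (D (W i) x v))

variable {S W x}

lemma covDerivField_update (i : Fin k) (σ : Π x : M, TangentSpace 𝓘(ℝ, E) x) :
    covDerivField S (Function.update W i σ) x D v =
      mvfderiv 𝓘(ℝ, E) (fun y ↦ S y (Function.update (fun j ↦ W j y) i (σ y))) x v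
        - S x (Function.update (fun j ↦ W j x) i (D σ x v))
        - ∑ j ∈ Finset.univ.erase i, S x (Function.update
            (Function.update (fun j ↦ W j x) j (D (W j) x v)) i (σ x)) := by
  simp only [covDerivField, update_field_apply]
  rw [← Finset.add_sum_erase _ _ (Finset.mem_univ i), sub_sub]
  congr 2
  · simp
  · refine Finset.sum_congr rfl fun j hj ↦ ?_
    have hji : j ≠ i := (Finset.mem_erase.1 hj).1
    rw [Function.update_of_ne hji, Function.update_comm hji.symm]

lemma tensorialAt_covDerivField
    (hS : ∀ X : Fin k → Π x : M, TangentSpace 𝓘(ℝ, E) x, (∀ i, SmoothNear (X i) x) →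
      MDiffAt (fun y ↦ S y (fun i ↦ X i y)) x)
    (hW : ∀ i, MDiffAt (T% (W i)) x) (i : Fin k) :
    TensorialAt 𝓘(ℝ, E) E (fun σ ↦ covDerivField S (Function.update W i σ) x D v) x := by
  have hd {σ : Π x : M, TangentSpace 𝓘(ℝ, E) x} (hσ : MDiffAt (T% σ) x) :
      MDiffAt (fun y ↦ S y (Function.update (fun j ↦ W j y) i (σ y))) x := by
    simp only [← update_field_apply]
    refine mdiffAt_multilinear_apply hS fun j ↦ ?_
    by_cases h : j = i
    · subst h; simpa using hσ
    · simpa [h] using hW j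
  constructor
  · intro f σ hf hσ
    simp only [covDerivField_update]
    have h1 : (fun y ↦ S y (Function.update (fun j ↦ W j y) i ((f • σ) y))) =
        f • fun y ↦ S y (Function.update (fun j ↦ W j y) i (σ y)) := by
      ext1 y
      simp
    rw [h1, mvfderiv_smul hf (hd hσ), D.isCovariantDerivativeOnUniv.leibniz hσ hf]
    simp only [add_apply, smul_apply, ContinuousLinearMap.smulRight_apply,
      MultilinearMap.map_update_add, MultilinearMap.map_update_smul, Pi.smul_apply', smul_sub,
      Finset.smul_sum]
    abel
  · intro σ σ' hσ hσ'
    simp only [covDerivField_update]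
    have h1 : (fun y ↦ S y (Function.update (fun j ↦ W j y) i ((σ + σ') y))) =
        (fun y ↦ S y (Function.update (fun j ↦ W j y) i (σ y)))
          + fun y ↦ S y (Function.update (fun j ↦ W j y) i (σ' y)) := by
      ext1 y
      simp
    rw [h1, mvfderiv_add (hd hσ) (hd hσ'), D.isCovariantDerivativeOnUniv.add hσ hσ']
    simp only [add_apply, MultilinearMap.map_update_add, Pi.add_apply, Finset.sum_add_distrib]
    abel

lemma covDerivField_congr
    (hS : ∀ X : Fin k → Π x : M, TangentSpace 𝓘(ℝ, E) x, (∀ i, SmoothNear (X i) x) →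
      MDiffAt (fun y ↦ S y (fun i ↦ X i y)) x)
    {W' : Fin k → Π x : M, TangentSpace 𝓘(ℝ, E) x}
    (hW : ∀ i, MDiffAt (T% (W i)) x) (hW' : ∀ i, MDiffAt (T% (W' i)) x)
    (h : ∀ i, W i x = W' i x) : covDerivField S W x D v = covDerivField S W' x D v := by
  classical
  have key (A : Finset (Fin k)) :
      covDerivField S (A.piecewise W' W) x D v = covDerivField S W x D v := by
    induction A using Finset.induction_on with
    | empty => simp
    | insert i A hi ih =>
      rw [← ih, Finset.piecewise_insert]
      have hm : ∀ j, MDiffAt (T% (A.piecewise W' W j)) x := by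
        intro j
        by_cases hj : j ∈ A
        · simpa [hj] using hW' j
        · simpa [hj] using hW j
      have := (tensorialAt_covDerivField D v hS hm i).pointwise (hW' i) (hW i) (h i).symm
      rw [this]
      congr 1
      have : W i = A.piecewise W' W i := by simp [hi]
      rw [this, Function.update_eq_self]
  rw [← key Finset.univ, Finset.piecewise_univ]

/-- The covariant derivative of a tensor field may be computed with arbitrary differentiable
extensions of the arguments. -/
lemma covDeriv_apply
    (hS : ∀ X : Fin k → Π x : M, TangentSpace 𝓘(ℝ, E) x, (∀ i, SmoothNear (X i) x) →
      MDiffAt (fun y ↦ S y (fun i ↦ X i y)) x)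
    (hW : ∀ i, MDiffAt (T% (W i)) x) :
    covDeriv D (fun y ↦ S y) x v (fun i ↦ W i x) = covDerivField S W x D v := by
  rw [← covDerivField_congr D v hS (W := fun i ↦ extend E (W i x))
    (fun i ↦ mdifferentiableAt_extend ..) hW (fun i ↦ by simp)]
  simp [covDeriv, covDerivField]

end Tensoriality

section Connection

variable {E : Type*} [NormedAddCommGroup E] [NormedSpace ℝ E] [FiniteDimensional ℝ E]
  {M : Type*} [TopologicalSpace M] [ChartedSpace E M] [IsManifold 𝓘(ℝ, E) ∞ M]
  {D : CovariantDerivative 𝓘(ℝ, E) E (fun x : M ↦ TangentSpace 𝓘(ℝ, E) x)}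
  {U V W Z : Π x : M, TangentSpace 𝓘(ℝ, E) x} {x : M}

lemma mvfderiv_congr {G : Type*} [NormedAddCommGroup G] [NormedSpace ℝ G] {f g : M → G}
    (h : ∀ᶠ y in 𝓝 x, f y = g y) : mvfderiv 𝓘(ℝ, E) f x = mvfderiv 𝓘(ℝ, E) g x := by
  have h' : f =ᶠ[𝓝 x] g := h
  simp only [mvfderiv, h'.mfderiv_eq]
  rw [h.self_of_nhds]

lemma connection_congr (hV : MDiffAt (T% V) x) (hW : MDiffAt (T% W) x)
    (h : ∀ᶠ y in 𝓝 x, V y = W y) : D V x = D W x :=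
  D.isCovariantDerivativeOn.congr_of_eventuallyEq hV hW univ_mem h

/-! ### The curvature on vector fields -/

variable (D U V W x) in
/-- The curvature `R(U, V)W` at `x`, for vector fields `U`, `V`, `W`. -/
noncomputable def curvatureField : TangentSpace 𝓘(ℝ, E) x :=
  D (fun y ↦ D W y (V y)) x (U x) - D (fun y ↦ D W y (U y)) x (V x)
    - D W x (mlieBracket 𝓘(ℝ, E) U V x)

lemma curvature_eq [RiemannianBundle (fun x : M ↦ TangentSpace 𝓘(ℝ, E) x)]
    (u v w : TangentSpace 𝓘(ℝ, E) x) :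
    curvature D x u v w = curvatureField D (extend E u) (extend E v) (extend E w) x := by
  simp [curvature, curvatureField]

lemma curvatureField_swap (U V W : Π x : M, TangentSpace 𝓘(ℝ, E) x) :
    curvatureField D U V W x = -curvatureField D V U W x := by
  simp only [curvatureField]
  rw [mlieBracket_swap_apply, map_neg]
  abel

variable [T2Space M]

lemma SmoothNear.torsion (hD : D.ContMDiffCovariantDerivative ∞) (hV : SmoothNear V x)
    (hW : SmoothNear W x) : SmoothNear (fun y ↦ D.torsion y (V y) (W y)) x := by
  refine (((hV.connection hD hW).sub (hW.connection hD hV)).sub (hV.bracket hW)).congr ?_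
  filter_upwards [hV.eventually_mdiffAt, hW.eventually_mdiffAt] with y h1 h2
  exact D.torsion_apply h1 h2

/-- The first Bianchi identity for a connection with torsion, on vector fields. -/
lemma bianchi_field (hD : D.ContMDiffCovariantDerivative ∞) (hU : SmoothNear U x)
    (hV : SmoothNear V x) (hW : SmoothNear W x) :
    curvatureField D U V W x + curvatureField D V W U x + curvatureField D W U V x =
      (D (fun y ↦ D.torsion y (V y) (W y)) x (U x)
        + D.torsion x (U x) (mlieBracket 𝓘(ℝ, E) V W x))
      + (D (fun y ↦ D.torsion y (W y) (U y)) x (V x)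
        + D.torsion x (V x) (mlieBracket 𝓘(ℝ, E) W U x))
      + (D (fun y ↦ D.torsion y (U y) (V y)) x (W x)
        + D.torsion x (W x) (mlieBracket 𝓘(ℝ, E) U V x)) := by
  -- Replace `D_B C` by `D_C B + T(B, C) + [B, C]`, and then `D_A [B, C]` likewise.
  have key {A B C : Π x : M, TangentSpace 𝓘(ℝ, E) x} (hA : SmoothNear A x)
      (hB : SmoothNear B x) (hC : SmoothNear C x) :
      D (fun y ↦ D C y (B y)) x (A x) = D (fun y ↦ D B y (C y)) x (A x)
        + D (fun y ↦ D.torsion y (B y) (C y)) x (A x)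
        + (D.torsion x (A x) (mlieBracket 𝓘(ℝ, E) B C x) + D A x (mlieBracket 𝓘(ℝ, E) B C x)
          + mlieBracket 𝓘(ℝ, E) A (mlieBracket 𝓘(ℝ, E) B C) x) := by
    have hCB := hC.connection hD hB
    have hT := hB.torsion hD hC
    have hbr := hB.bracket hC
    have h1 : D (fun y ↦ D C y (B y)) x = D ((fun y ↦ D B y (C y))
        + (fun y ↦ D.torsion y (B y) (C y)) + mlieBracket 𝓘(ℝ, E) B C) x := by
      refine connection_congr (hB.connection hD hC).mdiffAt
        (mdifferentiableAt_add_section (mdifferentiableAt_add_section hCB.mdiffAt hT.mdiffAt)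
          hbr.mdiffAt) ?_
      filter_upwards [hB.eventually_mdiffAt, hC.eventually_mdiffAt] with y h2 h3
      simp only [Pi.add_apply]
      rw [D.torsion_apply h2 h3]
      abel
    rw [h1, D.isCovariantDerivativeOnUniv.add
      (mdifferentiableAt_add_section hCB.mdiffAt hT.mdiffAt) hbr.mdiffAt,
      D.isCovariantDerivativeOnUniv.add hCB.mdiffAt hT.mdiffAt,
      D.torsion_apply hA.mdiffAt hbr.mdiffAt]
    simp only [add_apply]
    abel
  have hj := hU.jacobi hV hW
  have h2 : mlieBracket 𝓘(ℝ, E) (mlieBracket 𝓘(ℝ, E) U V) W x =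
      - mlieBracket 𝓘(ℝ, E) W (mlieBracket 𝓘(ℝ, E) U V) x := mlieBracket_swap_apply
  have h3 : mlieBracket 𝓘(ℝ, E) V (mlieBracket 𝓘(ℝ, E) U W) x =
      - mlieBracket 𝓘(ℝ, E) V (mlieBracket 𝓘(ℝ, E) W U) x := by
    rw [mlieBracket_swap (V := U) (W := W)]
    have := mlieBracket_const_smul_right (I := 𝓘(ℝ, E)) (V := V) (c := (-1 : ℝ))
      (hW.bracket hU).mdiffAt
    simpa using this
  rw [h2, h3] at hj
  simp only [curvatureField]
  rw [key hU hV hW, key hV hW hU, key hW hU hV, hj]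
  abel

end Connection

section Metric

variable {E : Type*} [NormedAddCommGroup E] [NormedSpace ℝ E] [FiniteDimensional ℝ E]
  {M : Type*} [TopologicalSpace M] [T2Space M] [ChartedSpace E M] [IsManifold 𝓘(ℝ, E) ∞ M]
  [RiemannianBundle (fun x : M ↦ TangentSpace 𝓘(ℝ, E) x)]
  [IsContMDiffRiemannianBundle 𝓘(ℝ, E) ∞ E (fun x : M ↦ TangentSpace 𝓘(ℝ, E) x)]
  {D : CovariantDerivative 𝓘(ℝ, E) E (fun x : M ↦ TangentSpace 𝓘(ℝ, E) x)}
  {U V W Z : Π x : M, TangentSpace 𝓘(ℝ, E) x} {x : M}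

lemma SmoothNear.inner (hV : SmoothNear V x) (hW : SmoothNear W x) :
    ∀ᶠ y in 𝓝 x, CMDiffAt ∞ (fun y ↦ inner ℝ (V y) (W y)) y := by
  filter_upwards [hV, hW] with y h1 h2
  exact ContMDiffAt.inner_bundle (E := fun x : M ↦ TangentSpace 𝓘(ℝ, E) x)
    (F := E) (b := fun y ↦ y) h1 h2

/-- The curvature of a metric connection is skew-symmetric. -/
lemma inner_curvatureField_add (hD : D.ContMDiffCovariantDerivative ∞) (hg : IsMetric D)
    (hU : SmoothNear U x) (hV : SmoothNear V x) (hW : SmoothNear W x) (hZ : SmoothNear Z x) :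
    inner ℝ (curvatureField D U V W x) (Z x) + inner ℝ (W x) (curvatureField D U V Z x) = 0 := by
  have h1 {A : Π x : M, TangentSpace 𝓘(ℝ, E) x} :
      ∀ᶠ y in 𝓝 x, mvfderiv 𝓘(ℝ, E) (fun z ↦ inner ℝ (W z) (Z z)) y (A y) =
        inner ℝ (D W y (A y)) (Z y) + inner ℝ (W y) (D Z y (A y)) := by
    filter_upwards [hW.eventually_mdiffAt, hZ.eventually_mdiffAt] with y h1 h2
    exact hg y W Z h1 h2 (A y)
  have hd {A : Π x : M, TangentSpace 𝓘(ℝ, E) x} (hA : SmoothNear A x) :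
      MDiffAt (fun y ↦ inner ℝ (D W y (A y)) (Z y)) x ∧
        MDiffAt (fun y ↦ inner ℝ (W y) (D Z y (A y))) x :=
    ⟨mdifferentiableAt_inner (hA.connection hD hW).mdiffAt hZ.mdiffAt,
      mdifferentiableAt_inner hW.mdiffAt (hA.connection hD hZ).mdiffAt⟩
  have h2 {A : Π x : M, TangentSpace 𝓘(ℝ, E) x} (hA : SmoothNear A x) :
      MDiffAt (fun y ↦ mvfderiv 𝓘(ℝ, E) (fun z ↦ inner ℝ (W z) (Z z)) y (A y)) x :=
    ((hd hA).1.add (hd hA).2).congr_of_eventuallyEq h1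
  have h3 {A B : Π x : M, TangentSpace 𝓘(ℝ, E) x} (hA : SmoothNear A x) :
      mvfderiv 𝓘(ℝ, E) (fun y ↦ mvfderiv 𝓘(ℝ, E) (fun z ↦ inner ℝ (W z) (Z z)) y (A y)) x (B x) =
        inner ℝ (D (fun y ↦ D W y (A y)) x (B x)) (Z x)
          + inner ℝ (D W x (A x)) (D Z x (B x)) + (inner ℝ (D W x (B x)) (D Z x (A x))
          + inner ℝ (W x) (D (fun y ↦ D Z y (A y)) x (B x))) := by
    rw [mvfderiv_congr h1, mvfderiv_fun_add (hd hA).1 (hd hA).2, add_apply,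
      hg x _ _ (hA.connection hD hW).mdiffAt hZ.mdiffAt,
      hg x _ _ hW.mdiffAt (hA.connection hD hZ).mdiffAt]
  have h4 := hU.mvfderiv_mlieBracket hV (hW.inner hZ) (h2 hU) (h2 hV)
  rw [h3 hV, h3 hU, hg x _ _ hW.mdiffAt hZ.mdiffAt] at h4
  simp only [curvatureField, inner_sub_left, inner_sub_right]
  linarith

/-- The curvature of a connection that preserves `J` commutes with `J`. -/
lemma curvatureField_J {J : Π x : M, TangentSpace 𝓘(ℝ, E) x →L[ℝ] TangentSpace 𝓘(ℝ, E) x}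
    (hJ : IsAlmostHermitian J) (hD : D.ContMDiffCovariantDerivative ∞)
    (hDJ : ∀ (x : M) (X : Π x : M, TangentSpace 𝓘(ℝ, E) x), MDiffAt (T% X) x →
      ∀ v : TangentSpace 𝓘(ℝ, E) x, D (fun y ↦ J y (X y)) x v = J x (D X x v))
    (hU : SmoothNear U x) (hV : SmoothNear V x) (hW : SmoothNear W x) :
    curvatureField D U V (fun y ↦ J y (W y)) x = J x (curvatureField D U V W x) := by
  have hJW : SmoothNear (fun y ↦ J y (W y)) x := hW.clm_apply hJ.smooth
  have h1 {A B : Π x : M, TangentSpace 𝓘(ℝ, E) x} (hA : SmoothNear A x) :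
      D (fun y ↦ D (fun z ↦ J z (W z)) y (A y)) x (B x) =
        J x (D (fun y ↦ D W y (A y)) x (B x)) := by
    rw [← hDJ x _ (hA.connection hD hW).mdiffAt]
    congr 1
    refine connection_congr (hA.connection hD hJW).mdiffAt
      ((hA.connection hD hW).clm_apply hJ.smooth).mdiffAt ?_
    filter_upwards [hW.eventually_mdiffAt] with y hy
    exact hDJ y W hy (A y)
  simp only [curvatureField, map_sub]
  rw [h1 hV, h1 hU, hDJ x _ hW.mdiffAt]

end Metric

/-! ### Exterior derivatives of forms of low degree -/

section ExteriorDerivative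

variable {E : Type*} [NormedAddCommGroup E] [NormedSpace ℝ E]
  {M : Type*} [TopologicalSpace M] [ChartedSpace E M] [IsManifold 𝓘(ℝ, E) ∞ M] {x : M}

lemma removeNth_four {α : Type*} (a b c d : α) :
    (0 : Fin 4).removeNth ![a, b, c, d] = ![b, c, d] ∧
    (1 : Fin 4).removeNth ![a, b, c, d] = ![a, c, d] ∧
    (2 : Fin 4).removeNth ![a, b, c, d] = ![a, b, d] ∧
    (3 : Fin 4).removeNth ![a, b, c, d] = ![a, b, c] := by
  refine ⟨?_, ?_, ?_, ?_⟩ <;> (ext i; fin_cases i <;> rfl)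

lemma removeNth_three {α : Type*} (a b c : α) :
    (0 : Fin 3).removeNth ![a, b, c] = ![b, c] ∧
    (1 : Fin 3).removeNth ![a, b, c] = ![a, c] ∧
    (2 : Fin 3).removeNth ![a, b, c] = ![a, b] := by
  refine ⟨?_, ?_, ?_⟩ <;> (ext i; fin_cases i <;> rfl)

lemma sum_fin_three_le (f : Fin 3 → Fin 3 → ℝ) :
    ∑ i : Fin 3, ∑ j ≥ i, f i j = f 0 0 + f 0 1 + f 0 2 + f 1 1 + f 1 2 + f 2 2 := by
  have h0 : Finset.Ici (0 : Fin 3) = {0, 1, 2} := by decide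
  have h1 : Finset.Ici (1 : Fin 3) = {1, 2} := by decide
  have h2 : Finset.Ici (2 : Fin 3) = {2} := by decide
  rw [Fin.sum_univ_three, h0, h1, h2, Finset.sum_insert (by decide), Finset.sum_pair (by decide),
    Finset.sum_pair (by decide), Finset.sum_singleton]
  ring

/-- The exterior derivative of a 3-form, written out. -/
lemma extD_three (S : Π x : M, (Fin 3 → TangentSpace 𝓘(ℝ, E) x) → ℝ)
    (a b c d : TangentSpace 𝓘(ℝ, E) x) :
    extD S x ![a, b, c, d] =
      mvfderiv 𝓘(ℝ, E) (fun y ↦ S y ![extend E b y, extend E c y, extend E d y]) x a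
      - mvfderiv 𝓘(ℝ, E) (fun y ↦ S y ![extend E a y, extend E c y, extend E d y]) x b
      + mvfderiv 𝓘(ℝ, E) (fun y ↦ S y ![extend E a y, extend E b y, extend E d y]) x c
      - mvfderiv 𝓘(ℝ, E) (fun y ↦ S y ![extend E a y, extend E b y, extend E c y]) x d
      - S x ![mlieBracket 𝓘(ℝ, E) (extend E a) (extend E b) x, c, d]
      + S x ![mlieBracket 𝓘(ℝ, E) (extend E a) (extend E c) x, b, d]
      - S x ![mlieBracket 𝓘(ℝ, E) (extend E a) (extend E d) x, b, c]
      - S x ![mlieBracket 𝓘(ℝ, E) (extend E b) (extend E c) x, a, d]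
      + S x ![mlieBracket 𝓘(ℝ, E) (extend E b) (extend E d) x, a, c]
      - S x ![mlieBracket 𝓘(ℝ, E) (extend E c) (extend E d) x, a, b] := by
  have hw (y : M) : (fun k ↦ extend E ((![a, b, c, d] : Fin 4 → TangentSpace 𝓘(ℝ, E) x) k) y)
      = ![extend E a y, extend E b y, extend E c y, extend E d y] := by
    ext k; fin_cases k <;> rfl
  obtain ⟨h0, h1, h2, h3⟩ := removeNth_four a b c d
  have g0 (y : M) := (removeNth_four (extend E a y) (extend E b y) (extend E c y) (extend E d y)).1
  have g1 (y : M) :=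
    (removeNth_four (extend E a y) (extend E b y) (extend E c y) (extend E d y)).2.1
  have g2 (y : M) :=
    (removeNth_four (extend E a y) (extend E b y) (extend E c y) (extend E d y)).2.2.1
  have g3 (y : M) :=
    (removeNth_four (extend E a y) (extend E b y) (extend E c y) (extend E d y)).2.2.2
  have c0 : (0 : Fin 3).castSucc = 0 := rfl
  have c1 : (1 : Fin 3).castSucc = 1 := rfl
  have c2 : (2 : Fin 3).castSucc = 2 := rfl
  have s0 : (0 : Fin 3).succ = 1 := rfl
  have s1 : (1 : Fin 3).succ = 2 := rfl
  have s2 : (2 : Fin 3).succ = 3 := rfl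
  unfold extD
  rw [Fin.sum_univ_four, sum_fin_three_le]
  simp_rw [hw, g0, g1, g2, g3]
  rw [c0, c1, c2, s0, s1, s2, h0, h1, h2, (removeNth_three _ _ _).1, (removeNth_three _ _ _).2.1,
    (removeNth_three _ _ _).2.2, (removeNth_three _ _ _).2.1, (removeNth_three _ _ _).2.2,
    (removeNth_three _ _ _).2.2]
  change (-1 : ℝ) ^ 0 * mvfderiv 𝓘(ℝ, E) _ x a + (-1 : ℝ) ^ 1 * mvfderiv 𝓘(ℝ, E) _ x b
    + (-1 : ℝ) ^ 2 * mvfderiv 𝓘(ℝ, E) _ x c + (-1 : ℝ) ^ 3 * mvfderiv 𝓘(ℝ, E) _ x d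
    - ((-1 : ℝ) ^ 0 * S x ![mlieBracket 𝓘(ℝ, E) (extend E a) (extend E b) x, c, d]
      + (-1 : ℝ) ^ 1 * S x ![mlieBracket 𝓘(ℝ, E) (extend E a) (extend E c) x, b, d]
      + (-1 : ℝ) ^ 2 * S x ![mlieBracket 𝓘(ℝ, E) (extend E a) (extend E d) x, b, c]
      + (-1 : ℝ) ^ 2 * S x ![mlieBracket 𝓘(ℝ, E) (extend E b) (extend E c) x, a, d]
      + (-1 : ℝ) ^ 3 * S x ![mlieBracket 𝓘(ℝ, E) (extend E b) (extend E d) x, a, c]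
      + (-1 : ℝ) ^ 4 * S x ![mlieBracket 𝓘(ℝ, E) (extend E c) (extend E d) x, a, b]) = _
  ring

/-- The exterior derivative of a 1-form, written out. -/
lemma extD_one (S : Π x : M, (Fin 1 → TangentSpace 𝓘(ℝ, E) x) → ℝ)
    (a b : TangentSpace 𝓘(ℝ, E) x) :
    extD S x ![a, b] = mvfderiv 𝓘(ℝ, E) (fun y ↦ S y ![extend E b y]) x a
      - mvfderiv 𝓘(ℝ, E) (fun y ↦ S y ![extend E a y]) x b
      - S x ![mlieBracket 𝓘(ℝ, E) (extend E a) (extend E b) x] := by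
  have g0 (y : M) : ((0 : Fin 2).removeNth fun k ↦
      extend E ((![a, b] : Fin 2 → TangentSpace 𝓘(ℝ, E) x) k) y) = ![extend E b y] := by
    ext k; fin_cases k; rfl
  have g1 (y : M) : ((1 : Fin 2).removeNth fun k ↦
      extend E ((![a, b] : Fin 2 → TangentSpace 𝓘(ℝ, E) x) k) y) = ![extend E a y] := by
    ext k; fin_cases k; rfl
  have hI : Finset.Ici (0 : Fin 1) = {0} := by decide
  unfold extD
  rw [Fin.sum_univ_two, Fin.sum_univ_one, hI, Finset.sum_singleton]
  simp_rw [g0, g1]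
  have h2 : Matrix.vecCons (mlieBracket 𝓘(ℝ, E) (extend E a) (extend E b) x)
      ((0 : Fin 1).removeNth ((0 : Fin 1).castSucc.removeNth
        (![a, b] : Fin 2 → TangentSpace 𝓘(ℝ, E) x))) =
      ![mlieBracket 𝓘(ℝ, E) (extend E a) (extend E b) x] := by
    ext k; fin_cases k; rfl
  change (-1 : ℝ) ^ 0 * mvfderiv 𝓘(ℝ, E) _ x a + (-1 : ℝ) ^ 1 * mvfderiv 𝓘(ℝ, E) _ x b
    - (-1 : ℝ) ^ 0 * S x (Matrix.vecCons (mlieBracket 𝓘(ℝ, E) (extend E a) (extend E b) x)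
      ((0 : Fin 1).removeNth ((0 : Fin 1).castSucc.removeNth
        (![a, b] : Fin 2 → TangentSpace 𝓘(ℝ, E) x)))) = _
  rw [h2]
  ring

end ExteriorDerivative

section SkewTorsion

variable {E : Type*} [NormedAddCommGroup E] [NormedSpace ℝ E] [FiniteDimensional ℝ E]
  {M : Type*} [TopologicalSpace M] [T2Space M] [ChartedSpace E M] [IsManifold 𝓘(ℝ, E) ∞ M]
  [RiemannianBundle (fun x : M ↦ TangentSpace 𝓘(ℝ, E) x)]
  [IsContMDiffRiemannianBundle 𝓘(ℝ, E) ∞ E (fun x : M ↦ TangentSpace 𝓘(ℝ, E) x)]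
  {D : CovariantDerivative 𝓘(ℝ, E) E (fun x : M ↦ TangentSpace 𝓘(ℝ, E) x)}
  {A B C U V W Z : Π x : M, TangentSpace 𝓘(ℝ, E) x} {x : M}

/-! ### The covariant derivative of the torsion -/

variable (D x) in
/-- The torsion form as a multilinear map. -/
noncomputable def torsionMultilinear :
    MultilinearMap ℝ (fun _ : Fin 3 ↦ TangentSpace 𝓘(ℝ, E) x) ℝ :=
  MultilinearMap.mk' (torsionForm D x)
    (by
      intro m i a b
      have h01 : (0 : Fin 3) ≠ 1 := by decide
      have h02 : (0 : Fin 3) ≠ 2 := by decide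
      have h12 : (1 : Fin 3) ≠ 2 := by decide
      obtain rfl | rfl | rfl : i = 0 ∨ i = 1 ∨ i = 2 := by fin_cases i <;> tauto
      all_goals
        simp only [torsionForm, Function.update_self, Function.update_of_ne h01,
          Function.update_of_ne h02, Function.update_of_ne h12, Function.update_of_ne h01.symm,
          Function.update_of_ne h02.symm, Function.update_of_ne h12.symm, map_add, add_apply,
          inner_add_left, inner_add_right])
    (by
      intro m i a b
      have h01 : (0 : Fin 3) ≠ 1 := by decide
      have h02 : (0 : Fin 3) ≠ 2 := by decide
      have h12 : (1 : Fin 3) ≠ 2 := by decide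
      obtain rfl | rfl | rfl : i = 0 ∨ i = 1 ∨ i = 2 := by fin_cases i <;> tauto
      all_goals
        simp only [torsionForm, Function.update_self, Function.update_of_ne h01,
          Function.update_of_ne h02, Function.update_of_ne h12, Function.update_of_ne h01.symm,
          Function.update_of_ne h02.symm, Function.update_of_ne h12.symm, map_smul, smul_apply,
          real_inner_smul_left, real_inner_smul_right, smul_eq_mul])

lemma torsionMultilinear_apply (w : Fin 3 → TangentSpace 𝓘(ℝ, E) x) :
    torsionMultilinear D x w = torsionForm D x w := rfl

lemma mdiffAt_torsionMultilinear (hD : D.ContMDiffCovariantDerivative ∞)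
    (X : Fin 3 → Π x : M, TangentSpace 𝓘(ℝ, E) x) (hX : ∀ i, SmoothNear (X i) x) :
    MDiffAt (fun y ↦ torsionMultilinear D y (fun i ↦ X i y)) x :=
  mdifferentiableAt_inner ((hX 0).torsion hD (hX 1)).mdiffAt (hX 2).mdiffAt

variable (D x) in
/-- `(∇_v T)(a, b, c)` for the torsion form `T`. -/
noncomputable def nablaT (v a b c : TangentSpace 𝓘(ℝ, E) x) : ℝ :=
  covDeriv D (torsionForm D) x v ![a, b, c]

/-- `v (T(A, B, C)) = (∇_v T)(A, B, C) + T(D_v A, B, C) + T(A, D_v B, C) + T(A, B, D_v C)`. -/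
lemma mvfderiv_torsion (hD : D.ContMDiffCovariantDerivative ∞) (hA : MDiffAt (T% A) x)
    (hB : MDiffAt (T% B) x) (hC : MDiffAt (T% C) x) (v : TangentSpace 𝓘(ℝ, E) x) :
    mvfderiv 𝓘(ℝ, E) (fun y ↦ inner ℝ (D.torsion y (A y) (B y)) (C y)) x v =
      nablaT D x v (A x) (B x) (C x) + inner ℝ (D.torsion x (D A x v) (B x)) (C x)
        + inner ℝ (D.torsion x (A x) (D B x v)) (C x)
        + inner ℝ (D.torsion x (A x) (B x)) (D C x v) := by
  have hW : ∀ i, MDiffAt (T% ((![A, B, C] : Fin 3 → Π x : M, TangentSpace 𝓘(ℝ, E) x) i)) x := by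
    intro i; fin_cases i
    exacts [hA, hB, hC]
  have h := covDeriv_apply D v (mdiffAt_torsionMultilinear hD) hW
  have h1 : (fun i ↦ (![A, B, C] : Fin 3 → Π x : M, TangentSpace 𝓘(ℝ, E) x) i x)
      = ![A x, B x, C x] := by
    ext i; fin_cases i <;> rfl
  rw [h1] at h
  change nablaT D x v (A x) (B x) (C x) = _ at h
  have h01 : (0 : Fin 3) ≠ 1 := by decide
  have h02 : (0 : Fin 3) ≠ 2 := by decide
  have h12 : (1 : Fin 3) ≠ 2 := by decide
  rw [h, covDerivField, Fin.sum_univ_three]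
  simp only [torsionMultilinear_apply, torsionForm, Function.update_self,
    Function.update_of_ne h01, Function.update_of_ne h02, Function.update_of_ne h12,
    Function.update_of_ne h01.symm, Function.update_of_ne h02.symm, Function.update_of_ne h12.symm]
  simp only [Matrix.cons_val]
  ring

lemma nablaT_swap₁₂ (hD : D.ContMDiffCovariantDerivative ∞) (v a b c : TangentSpace 𝓘(ℝ, E) x) :
    nablaT D x v a b c = -nablaT D x v b a c := by
  have ha : MDiffAt (T% (extend E a)) x := mdifferentiableAt_extend ..
  have hb : MDiffAt (T% (extend E b)) x := mdifferentiableAt_extend ..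
  have hc : MDiffAt (T% (extend E c)) x := mdifferentiableAt_extend ..
  have h1 := mvfderiv_torsion hD ha hb hc v
  have h2 := mvfderiv_torsion hD hb ha hc v
  have h3 : (fun y ↦ inner ℝ (D.torsion y (extend E a y) (extend E b y)) (extend E c y)) =
      -fun y ↦ inner ℝ (D.torsion y (extend E b y) (extend E a y)) (extend E c y) := by
    ext1 y
    rw [Pi.neg_apply, D.torsion_antisymm, inner_neg_left]
  rw [h3, mvfderiv_neg, neg_apply, h2] at h1
  simp only [extend_apply_self] at h1
  rw [D.torsion_antisymm _ a, D.torsion_antisymm b (D (extend E a) x v),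
    D.torsion_antisymm b a] at h1
  simp only [inner_neg_left] at h1
  linarith

lemma inner_torsion_swap₂₃ (hT : ∀ (x : M) (u v w : TangentSpace 𝓘(ℝ, E) x),
      torsionForm D x ![u, v, w] = -torsionForm D x ![u, w, v])
    (u v w : TangentSpace 𝓘(ℝ, E) x) :
    inner ℝ (D.torsion x u v) w = -inner ℝ (D.torsion x u w) v := by
  simpa [torsionForm] using hT x u v w

lemma nablaT_swap₂₃ (hD : D.ContMDiffCovariantDerivative ∞)
    (hT : ∀ (x : M) (u v w : TangentSpace 𝓘(ℝ, E) x),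
      torsionForm D x ![u, v, w] = -torsionForm D x ![u, w, v])
    (v a b c : TangentSpace 𝓘(ℝ, E) x) :
    nablaT D x v a b c = -nablaT D x v a c b := by
  have ha : MDiffAt (T% (extend E a)) x := mdifferentiableAt_extend ..
  have hb : MDiffAt (T% (extend E b)) x := mdifferentiableAt_extend ..
  have hc : MDiffAt (T% (extend E c)) x := mdifferentiableAt_extend ..
  have h1 := mvfderiv_torsion hD ha hb hc v
  have h2 := mvfderiv_torsion hD ha hc hb v
  have h3 : (fun y ↦ inner ℝ (D.torsion y (extend E a y) (extend E b y)) (extend E c y)) =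
      -fun y ↦ inner ℝ (D.torsion y (extend E a y) (extend E c y)) (extend E b y) := by
    ext1 y
    exact inner_torsion_swap₂₃ hT _ _ _
  rw [h3, mvfderiv_neg, neg_apply, h2] at h1
  simp only [extend_apply_self] at h1
  rw [inner_torsion_swap₂₃ hT _ c b, inner_torsion_swap₂₃ hT _ c (D (extend E b) x v),
    inner_torsion_swap₂₃ hT _ (D (extend E c) x v) b] at h1
  linarith

lemma nablaT_add₃ (hD : D.ContMDiffCovariantDerivative ∞) (v a b c c' : TangentSpace 𝓘(ℝ, E) x) :
    nablaT D x v a b (c + c') = nablaT D x v a b c + nablaT D x v a b c' := by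
  have ha : MDiffAt (T% (extend E a)) x := mdifferentiableAt_extend ..
  have hb : MDiffAt (T% (extend E b)) x := mdifferentiableAt_extend ..
  have hc : MDiffAt (T% (extend E c)) x := mdifferentiableAt_extend ..
  have hc' : MDiffAt (T% (extend E c')) x := mdifferentiableAt_extend ..
  have h1 := mvfderiv_torsion hD ha hb hc v
  have h2 := mvfderiv_torsion hD ha hb hc' v
  have h3 := mvfderiv_torsion hD ha hb (mdifferentiableAt_add_section hc hc') v
  have hd {c : TangentSpace 𝓘(ℝ, E) x} : MDiffAt (fun y ↦
      inner ℝ (D.torsion y (extend E a y) (extend E b y)) (extend E c y)) x :=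
    mdifferentiableAt_inner ((smoothNear_extend a).torsion hD (smoothNear_extend b)).mdiffAt
      (mdifferentiableAt_extend ..)
  simp only [Pi.add_apply, inner_add_right] at h3
  rw [mvfderiv_fun_add hd hd, add_apply, h1, h2, D.isCovariantDerivativeOnUniv.add hc hc'] at h3
  simp only [extend_apply_self, add_apply, inner_add_right] at h3
  linarith

lemma nablaT_smul₃ (hD : D.ContMDiffCovariantDerivative ∞) (r : ℝ)
    (v a b c : TangentSpace 𝓘(ℝ, E) x) :
    nablaT D x v a b (r • c) = r * nablaT D x v a b c := by
  have ha : MDiffAt (T% (extend E a)) x := mdifferentiableAt_extend ..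
  have hb : MDiffAt (T% (extend E b)) x := mdifferentiableAt_extend ..
  have hc : MDiffAt (T% (extend E c)) x := mdifferentiableAt_extend ..
  have h1 := mvfderiv_torsion hD ha hb hc v
  have hr : MDiffAt (fun _ : M ↦ r) x := mdifferentiableAt_const
  have h3 := mvfderiv_torsion hD ha hb (hr.smul_section hc) v
  have hd : MDiffAt (fun y ↦
      inner ℝ (D.torsion y (extend E a y) (extend E b y)) (extend E c y)) x :=
    mdifferentiableAt_inner ((smoothNear_extend a).torsion hD (smoothNear_extend b)).mdiffAt
      (mdifferentiableAt_extend ..)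
  have h5 : D ((fun _ : M ↦ r) • extend E c) x = r • D (extend E c) x := by
    rw [D.isCovariantDerivativeOnUniv.leibniz hc hr, mvfderiv_const]
    ext u
    simp
  simp only [Pi.smul_apply', inner_smul_right] at h3
  rw [mvfderiv_fun_mul hr hd, mvfderiv_const] at h3
  rw [h5] at h3
  simp only [extend_apply_self] at h1
  simp only [extend_apply_self, smul_apply, smul_zero, add_zero,
    smul_eq_mul, inner_smul_right] at h3
  linear_combination r * h1 - h3

lemma nablaT_add₀ (v v' a b c : TangentSpace 𝓘(ℝ, E) x) :
    nablaT D x (v + v') a b c = nablaT D x v a b c + nablaT D x v' a b c := by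
  simp only [nablaT, covDeriv, ← torsionMultilinear_apply, map_add, MultilinearMap.map_update_add,
    Finset.sum_add_distrib]
  ring

lemma nablaT_smul₀ (r : ℝ) (v a b c : TangentSpace 𝓘(ℝ, E) x) :
    nablaT D x (r • v) a b c = r * nablaT D x v a b c := by
  simp only [nablaT, covDeriv, ← torsionMultilinear_apply, map_smul, smul_eq_mul,
    MultilinearMap.map_update_smul, ← Finset.mul_sum]
  ring

/-- `Q(a, b, c, d)`, the sum of `g(T(T(a, b), c), d)` over the cyclic permutations of `a, b, c`. For
skew-symmetric torsion this is the 4-form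
`g(T(a, b), T(c, d)) + g(T(b, c), T(a, d)) + g(T(c, a), T(b, d))`. -/
noncomputable def torsionSq (D : CovariantDerivative 𝓘(ℝ, E) E (fun x : M ↦ TangentSpace 𝓘(ℝ, E) x))
    (x : M) (a b c d : TangentSpace 𝓘(ℝ, E) x) : ℝ :=
  inner ℝ (D.torsion x (D.torsion x a b) c) d + inner ℝ (D.torsion x (D.torsion x b c) a) d
    + inner ℝ (D.torsion x (D.torsion x c a) b) d

/-- The first Bianchi identity for a metric connection. -/
lemma bianchi (hD : D.ContMDiffCovariantDerivative ∞) (hg : IsMetric D)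
    (a b c d : TangentSpace 𝓘(ℝ, E) x) :
    inner ℝ (curvature D x a b c) d + inner ℝ (curvature D x b c a) d
      + inner ℝ (curvature D x c a b) d =
      nablaT D x a b c d + nablaT D x b c a d + nablaT D x c a b d + torsionSq D x a b c d := by
  have hs (u : TangentSpace 𝓘(ℝ, E) x) : SmoothNear (extend E u) x := smoothNear_extend u
  have h1 (u v w : TangentSpace 𝓘(ℝ, E) x) :
      inner ℝ (D (fun y ↦ D.torsion y (extend E v y) (extend E w y)) x u) d =
        nablaT D x u v w d + inner ℝ (D.torsion x (D (extend E v) x u) w) d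
          + inner ℝ (D.torsion x v (D (extend E w) x u)) d := by
    have h2 := mvfderiv_torsion hD (hs v).mdiffAt (hs w).mdiffAt (hs d).mdiffAt u
    rw [hg x _ _ ((hs v).torsion hD (hs w)).mdiffAt (hs d).mdiffAt] at h2
    simp only [extend_apply_self] at h2
    linarith
  have h2 (u v : TangentSpace 𝓘(ℝ, E) x) : mlieBracket 𝓘(ℝ, E) (extend E u) (extend E v) x =
      D (extend E v) x u - D (extend E u) x v - D.torsion x u v := by
    have := D.torsion_apply (hs u).mdiffAt (hs v).mdiffAt
    simp only [extend_apply_self] at this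
    rw [this]
    abel
  have h3 := congrArg (fun z ↦ inner ℝ z d) (bianchi_field hD (hs a) (hs b) (hs c))
  simp only [inner_add_left, extend_apply_self] at h3
  rw [h1, h1, h1, h2, h2, h2] at h3
  simp only [curvature_eq, torsionSq]
  rw [h3, D.torsion_antisymm (D.torsion x a b) c, D.torsion_antisymm (D.torsion x b c) a,
    D.torsion_antisymm (D.torsion x c a) b, D.torsion_antisymm (D (extend E b) x a) c,
    D.torsion_antisymm (D (extend E c) x b) a, D.torsion_antisymm (D (extend E a) x c) b]
  simp only [map_sub, inner_sub_left, inner_neg_left]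
  ring

lemma torsion_torsion_symm (hT : ∀ (x : M) (u v w : TangentSpace 𝓘(ℝ, E) x),
      torsionForm D x ![u, v, w] = -torsionForm D x ![u, w, v])
    (a b c d : TangentSpace 𝓘(ℝ, E) x) :
    inner ℝ (D.torsion x (D.torsion x a b) c) d = inner ℝ (D.torsion x (D.torsion x c d) a) b := by
  have h (p q r : TangentSpace 𝓘(ℝ, E) x) :
      inner ℝ (D.torsion x p q) r = inner ℝ (D.torsion x q r) p := by
    rw [inner_torsion_swap₂₃ hT q r p, D.torsion_antisymm, inner_neg_left]
  rw [h _ c d, h _ a b, real_inner_comm]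

/-- The exterior derivative of the torsion form in terms of its covariant derivative. -/
lemma extD_torsionForm (hD : D.ContMDiffCovariantDerivative ∞)
    (hT : ∀ (x : M) (u v w : TangentSpace 𝓘(ℝ, E) x),
      torsionForm D x ![u, v, w] = -torsionForm D x ![u, w, v])
    (a b c d : TangentSpace 𝓘(ℝ, E) x) :
    extD (torsionForm D) x ![a, b, c, d] =
      nablaT D x a b c d + nablaT D x b c a d + nablaT D x c a b d - nablaT D x d a b c
        + 2 * torsionSq D x a b c d := by
  have hs (u : TangentSpace 𝓘(ℝ, E) x) : SmoothNear (extend E u) x := smoothNear_extend u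
  have h1 (u v w z : TangentSpace 𝓘(ℝ, E) x) :=
    mvfderiv_torsion hD (hs v).mdiffAt (hs w).mdiffAt (hs z).mdiffAt u
  have h2 (u v : TangentSpace 𝓘(ℝ, E) x) : mlieBracket 𝓘(ℝ, E) (extend E u) (extend E v) x =
      D (extend E v) x u - D (extend E u) x v - D.torsion x u v := by
    have := D.torsion_apply (hs u).mdiffAt (hs v).mdiffAt
    simp only [extend_apply_self] at this
    rw [this]
    abel
  have h3 (u v w : TangentSpace 𝓘(ℝ, E) x) : torsionForm D x ![u, v, w] =
    inner ℝ (D.torsion x u v) w := rfl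
  have h4 (u v w z : TangentSpace 𝓘(ℝ, E) x) :
      mvfderiv 𝓘(ℝ, E) (fun y ↦ torsionForm D y ![extend E v y, extend E w y, extend E z y]) x u =
        nablaT D x u v w z + inner ℝ (D.torsion x (D (extend E v) x u) w) z
          - inner ℝ (D.torsion x (D (extend E w) x u) v) z
          + inner ℝ (D.torsion x (D (extend E z) x u) v) w := by
    have := h1 u v w z
    simp only [extend_apply_self] at this
    rw [D.torsion_antisymm v (D (extend E w) x u), inner_neg_left,
      inner_torsion_swap₂₃ hT v w (D (extend E z) x u),
      D.torsion_antisymm v (D (extend E z) x u), inner_neg_left, neg_neg] at this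
    change mvfderiv 𝓘(ℝ, E)
      (fun y ↦ inner ℝ (D.torsion y (extend E v y) (extend E w y)) (extend E z y)) x u = _
    linear_combination this
  rw [extD_three]
  simp only [h3, h4, h2, map_sub, sub_apply, inner_sub_left, torsionSq]
  rw [nablaT_swap₁₂ hD b c a d, torsion_torsion_symm hT c d a b, torsion_torsion_symm hT a d b c,
    torsion_torsion_symm hT b d a c, D.torsion_antisymm a c]
  simp only [map_neg, neg_apply, inner_neg_left]
  ring

end SkewTorsion

section CurvatureTensor

variable {E : Type*} [NormedAddCommGroup E] [NormedSpace ℝ E] [FiniteDimensional ℝ E]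
  {M : Type*} [TopologicalSpace M] [T2Space M] [ChartedSpace E M] [IsManifold 𝓘(ℝ, E) ∞ M]
  [RiemannianBundle (fun x : M ↦ TangentSpace 𝓘(ℝ, E) x)]
  [IsContMDiffRiemannianBundle 𝓘(ℝ, E) ∞ E (fun x : M ↦ TangentSpace 𝓘(ℝ, E) x)]
  {J : Π x : M, TangentSpace 𝓘(ℝ, E) x →L[ℝ] TangentSpace 𝓘(ℝ, E) x}
  {Ψ : Π x : M, (TangentSpace 𝓘(ℝ, E) x) [⋀^Fin 3]→ₗ[ℝ] ℂ}
  {D : CovariantDerivative 𝓘(ℝ, E) E (fun x : M ↦ TangentSpace 𝓘(ℝ, E) x)}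
  {A B C U V W Z : Π x : M, TangentSpace 𝓘(ℝ, E) x} {x : M}

/-! ### Symmetries of the curvature -/

lemma eventually_extend_add (v w : TangentSpace 𝓘(ℝ, E) x) :
    ∀ᶠ y in 𝓝 x, extend E (v + w) y = (extend E v + extend E w) y := by
  let t := trivializationAt E (TangentSpace 𝓘(ℝ, E) : M → Type _) x
  have hx : x ∈ t.baseSet := FiberBundle.mem_baseSet_trivializationAt E _ x
  filter_upwards [t.open_baseSet.mem_nhds hx] with y hy
  have h1 : (t ⟨x, v + w⟩).2 = (t ⟨x, v⟩).2 + (t ⟨x, w⟩).2 := (t.linear ℝ hx).map_add v w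
  change t.symm y (t ⟨x, v + w⟩).2 = t.symm y (t ⟨x, v⟩).2 + t.symm y (t ⟨x, w⟩).2
  rw [h1]
  have h2 := (t.symmₗ ℝ y).map_add (t ⟨x, v⟩).2 (t ⟨x, w⟩).2
  rwa [t.coe_symmₗ hy] at h2

lemma eventually_extend_smul (r : ℝ) (v : TangentSpace 𝓘(ℝ, E) x) :
    ∀ᶠ y in 𝓝 x, extend E (r • v) y = (r • extend E v) y := by
  let t := trivializationAt E (TangentSpace 𝓘(ℝ, E) : M → Type _) x
  have hx : x ∈ t.baseSet := FiberBundle.mem_baseSet_trivializationAt E _ x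
  filter_upwards [t.open_baseSet.mem_nhds hx] with y hy
  have h1 : (t ⟨x, r • v⟩).2 = r • (t ⟨x, v⟩).2 := (t.linear ℝ hx).map_smul r v
  change t.symm y (t ⟨x, r • v⟩).2 = r • t.symm y (t ⟨x, v⟩).2
  rw [h1]
  have h2 := (t.symmₗ ℝ y).map_smul r (t ⟨x, v⟩).2
  rwa [t.coe_symmₗ hy] at h2

lemma curvatureField_congr_left (hD : D.ContMDiffCovariantDerivative ∞) (hU : SmoothNear U x)
    (hZ : SmoothNear Z x) (hW : SmoothNear W x) (h : ∀ᶠ y in 𝓝 x, U y = Z y) :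
    curvatureField D U V W x = curvatureField D Z V W x := by
  have h1 : D (fun y ↦ D W y (U y)) x = D (fun y ↦ D W y (Z y)) x :=
    connection_congr (hU.connection hD hW).mdiffAt (hZ.connection hD hW).mdiffAt
      (h.mono fun y hy ↦ by rw [hy])
  have h2 : mlieBracket 𝓘(ℝ, E) U V x = mlieBracket 𝓘(ℝ, E) Z V x :=
    EventuallyEq.mlieBracket_vectorField_eq h (EventuallyEq.refl _ _)
  rw [curvatureField, h1, h2, h.self_of_nhds]
  rfl

lemma curvature_add₁ (hD : D.ContMDiffCovariantDerivative ∞) (u u' v w : TangentSpace 𝓘(ℝ, E) x) :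
    curvature D x (u + u') v w = curvature D x u v w + curvature D x u' v w := by
  have hs (u : TangentSpace 𝓘(ℝ, E) x) : SmoothNear (extend E u) x := smoothNear_extend u
  rw [curvature_eq, curvature_eq, curvature_eq,
    curvatureField_congr_left hD (hs _) ((hs u).add (hs u')) (hs w) (eventually_extend_add u u')]
  change curvatureField D (extend E u + extend E u') _ _ x = _
  have h1 : (fun y ↦ D (extend E w) y ((extend E u + extend E u') y)) =
      (fun y ↦ D (extend E w) y (extend E u y)) + fun y ↦ D (extend E w) y (extend E u' y) := by
    ext1 y
    simp
  simp only [curvatureField, h1]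
  rw [mlieBracket_add_left (hs u).mdiffAt (hs u').mdiffAt, D.isCovariantDerivativeOnUniv.add
    ((hs u).connection hD (hs w)).mdiffAt ((hs u').connection hD (hs w)).mdiffAt]
  simp only [map_add, add_apply, Pi.add_apply]
  abel

lemma curvature_smul₁ (hD : D.ContMDiffCovariantDerivative ∞) (r : ℝ)
    (u v w : TangentSpace 𝓘(ℝ, E) x) :
    curvature D x (r • u) v w = r • curvature D x u v w := by
  have hs (u : TangentSpace 𝓘(ℝ, E) x) : SmoothNear (extend E u) x := smoothNear_extend u
  have hr : MDiffAt (fun _ : M ↦ r) x := mdifferentiableAt_const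
  have hru : SmoothNear (r • extend E u) x :=
    (hs (r • u)).congr ((eventually_extend_smul r u).mono fun y hy ↦ hy.symm)
  rw [curvature_eq, curvature_eq,
    curvatureField_congr_left hD (hs _) hru (hs w) (eventually_extend_smul r u)]
  have h1 : (fun y ↦ D (extend E w) y ((r • extend E u) y)) =
      (fun _ : M ↦ r) • fun y ↦ D (extend E w) y (extend E u y) := by
    ext1 y
    simp
  simp only [curvatureField, h1]
  rw [mlieBracket_const_smul_left (hs u).mdiffAt, D.isCovariantDerivativeOnUniv.leibniz
    ((hs u).connection hD (hs w)).mdiffAt hr, mvfderiv_const]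
  simp only [map_smul, add_apply, smul_apply, ContinuousLinearMap.smulRight_apply, zero_apply,
    zero_smul, add_zero, Pi.smul_apply]
  module

lemma curvature_swap (u v w : TangentSpace 𝓘(ℝ, E) x) :
    curvature D x u v w = -curvature D x v u w := by
  rw [curvature_eq, curvature_eq, curvatureField_swap]

lemma inner_curvature_swap (hD : D.ContMDiffCovariantDerivative ∞) (hg : IsMetric D)
    (u v w z : TangentSpace 𝓘(ℝ, E) x) :
    inner ℝ (curvature D x u v w) z = -inner ℝ (curvature D x u v z) w := by
  have := inner_curvatureField_add hD hg (smoothNear_extend u) (smoothNear_extend v)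
    (smoothNear_extend w) (smoothNear_extend z)
  simp only [extend_apply_self, ← curvature_eq] at this
  rw [real_inner_comm _ w] at this
  linarith

lemma IsAlmostHermitian.inner_map_left (hJ : IsAlmostHermitian J) (v w : TangentSpace 𝓘(ℝ, E) x) :
    inner ℝ (J x v) w = -inner ℝ v (J x w) := by
  rw [← hJ.inner_map_map x (J x v) w, hJ.sq_eq_neg, inner_neg_left]

lemma inner_curvature_J (hJ : IsAlmostHermitian J) (hD : D.ContMDiffCovariantDerivative ∞)
    (hg : IsMetric D)
    (hDJ : ∀ (x : M) (X : Π x : M, TangentSpace 𝓘(ℝ, E) x), MDiffAt (T% X) x →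
      ∀ v : TangentSpace 𝓘(ℝ, E) x, D (fun y ↦ J y (X y)) x v = J x (D X x v))
    (u v w z : TangentSpace 𝓘(ℝ, E) x) :
    inner ℝ (curvature D x u v (J x w)) z = -inner ℝ (curvature D x u v w) (J x z) := by
  have h1 := inner_curvature_swap hD hg u v (J x w) z
  have h2 := inner_curvatureField_add hD hg (smoothNear_extend u) (smoothNear_extend v)
    ((smoothNear_extend w).clm_apply hJ.smooth) (smoothNear_extend z)
  rw [curvatureField_J hJ hD hDJ (smoothNear_extend u) (smoothNear_extend v)
    (smoothNear_extend w)] at h2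
  simp only [extend_apply_self, ← curvature_eq] at h2
  rw [real_inner_comm _ (J x w), hJ.inner_map_left (curvature D x u v w) z] at h2
  linarith

/-! ### The curvature acts trivially on a parallel 3-form -/

/-- If `DS = 0` then `R(u, v) · S = 0`. This is `[U, V] f = U (V f) - V (U f)` for
`f = S(A, B, C)`, each derivative of `f` being expanded by `DS = 0`. -/
lemma parallel_curvature_action
    {S : Π x : M, MultilinearMap ℝ (fun _ : Fin 3 ↦ TangentSpace 𝓘(ℝ, E) x) ℝ}
    (hD : D.ContMDiffCovariantDerivative ∞)
    (hS : ∀ (x : M) (X : Fin 3 → Π x : M, TangentSpace 𝓘(ℝ, E) x), (∀ i, SmoothNear (X i) x) →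
      ∀ᶠ y in 𝓝 x, CMDiffAt ∞ (fun y ↦ S y (fun i ↦ X i y)) y)
    (hp : ∀ (x : M) (v : TangentSpace 𝓘(ℝ, E) x) (w : Fin 3 → TangentSpace 𝓘(ℝ, E) x),
      covDeriv D (fun y ↦ S y) x v w = 0) (u v a b c : TangentSpace 𝓘(ℝ, E) x) :
    S x ![curvature D x u v a, b, c] + S x ![a, curvature D x u v b, c]
      + S x ![a, b, curvature D x u v c] = 0 := by
  have hd (x : M) (X : Fin 3 → Π x : M, TangentSpace 𝓘(ℝ, E) x) (hX : ∀ i, SmoothNear (X i) x) :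
      MDiffAt (fun y ↦ S y (fun i ↦ X i y)) x :=
    (hS x X hX).self_of_nhds.mdifferentiableAt (by simp)
  have vec (A B C : Π x : M, TangentSpace 𝓘(ℝ, E) x) (y : M) :
      (fun i ↦ (![A, B, C] : Fin 3 → Π x : M, TangentSpace 𝓘(ℝ, E) x) i y) = ![A y, B y, C y] := by
    ext i; fin_cases i <;> rfl
  have hsm {A B C : Π x : M, TangentSpace 𝓘(ℝ, E) x} (hA : SmoothNear A x) (hB : SmoothNear B x)
      (hC : SmoothNear C x) : ∀ᶠ y in 𝓝 x, CMDiffAt ∞ (fun y ↦ S y ![A y, B y, C y]) y := by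
    have := hS x ![A, B, C] (by intro i; fin_cases i <;> assumption)
    simpa only [vec] using this
  have der {y : M} {A B C : Π x : M, TangentSpace 𝓘(ℝ, E) x} (hA : MDiffAt (T% A) y)
      (hB : MDiffAt (T% B) y) (hC : MDiffAt (T% C) y) (z : TangentSpace 𝓘(ℝ, E) y) :
      mvfderiv 𝓘(ℝ, E) (fun y ↦ S y ![A y, B y, C y]) y z =
        S y ![D A y z, B y, C y] + S y ![A y, D B y z, C y] + S y ![A y, B y, D C y z] := by
    have hW : ∀ i, MDiffAt (T% ((![A, B, C] : Fin 3 → Π x : M, TangentSpace 𝓘(ℝ, E) x) i)) y := by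
      intro i; fin_cases i <;> assumption
    have h := covDeriv_apply D z (hd y) hW
    rw [hp, covDerivField, Fin.sum_univ_three] at h
    simp only [vec] at h
    have e0 (p : TangentSpace 𝓘(ℝ, E) y) :
        Function.update ![A y, B y, C y] 0 p = ![p, B y, C y] := by
      ext i; fin_cases i <;> rfl
    have e1 (p : TangentSpace 𝓘(ℝ, E) y) :
        Function.update ![A y, B y, C y] 1 p = ![A y, p, C y] := by
      ext i; fin_cases i <;> rfl
    have e2 (p : TangentSpace 𝓘(ℝ, E) y) :
        Function.update ![A y, B y, C y] 2 p = ![A y, B y, p] := by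
      ext i; fin_cases i <;> rfl
    rw [e0, e1, e2] at h
    simp only [Matrix.cons_val] at h
    linarith
  have hs (u : TangentSpace 𝓘(ℝ, E) x) : SmoothNear (extend E u) x := smoothNear_extend u
  have hu := hs u
  have hv := hs v
  have ha := hs a
  have hb := hs b
  have hc := hs c
  have h1 {A : Π x : M, TangentSpace 𝓘(ℝ, E) x} :
      ∀ᶠ y in 𝓝 x, mvfderiv 𝓘(ℝ, E)
          (fun z ↦ S z ![extend E a z, extend E b z, extend E c z]) y (A y) =
        S y ![D (extend E a) y (A y), extend E b y, extend E c y]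
          + S y ![extend E a y, D (extend E b) y (A y), extend E c y]
          + S y ![extend E a y, extend E b y, D (extend E c) y (A y)] := by
    filter_upwards [ha.eventually_mdiffAt, hb.eventually_mdiffAt, hc.eventually_mdiffAt]
      with y h1 h2 h3
    exact der h1 h2 h3 (A y)
  have hd' {A B C : Π x : M, TangentSpace 𝓘(ℝ, E) x} (hA : SmoothNear A x) (hB : SmoothNear B x)
      (hC : SmoothNear C x) : MDiffAt (fun y ↦ S y ![A y, B y, C y]) x :=
    (hsm hA hB hC).self_of_nhds.mdifferentiableAt (by simp)
  have hd3 {A : Π x : M, TangentSpace 𝓘(ℝ, E) x} (hA : SmoothNear A x) :=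
    And.intro (hd' (hA.connection hD ha) hb hc)
      (And.intro (hd' ha (hA.connection hD hb) hc) (hd' ha hb (hA.connection hD hc)))
  have h2 {A : Π x : M, TangentSpace 𝓘(ℝ, E) x} (hA : SmoothNear A x) :
      MDiffAt (fun y ↦ mvfderiv 𝓘(ℝ, E)
          (fun z ↦ S z ![extend E a z, extend E b z, extend E c z]) y (A y)) x :=
    (((hd3 hA).1.add (hd3 hA).2.1).add (hd3 hA).2.2).congr_of_eventuallyEq h1
  have h3 {A : Π x : M, TangentSpace 𝓘(ℝ, E) x} (hA : SmoothNear A x) :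
      mvfderiv 𝓘(ℝ, E) (fun y ↦ S y ![D (extend E a) y (A y), extend E b y, extend E c y]
          + S y ![extend E a y, D (extend E b) y (A y), extend E c y]
          + S y ![extend E a y, extend E b y, D (extend E c) y (A y)]) x =
        mvfderiv 𝓘(ℝ, E) (fun y ↦ S y ![D (extend E a) y (A y), extend E b y, extend E c y]) x
          + mvfderiv 𝓘(ℝ, E) (fun y ↦ S y ![extend E a y, D (extend E b) y (A y), extend E c y]) x
          + mvfderiv 𝓘(ℝ, E)
              (fun y ↦ S y ![extend E a y, extend E b y, D (extend E c) y (A y)]) x := by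
    rw [← mvfderiv_add (hd3 hA).1 (hd3 hA).2.1,
      ← mvfderiv_add ((hd3 hA).1.add (hd3 hA).2.1) (hd3 hA).2.2]
    rfl
  have h4 := hu.mvfderiv_mlieBracket hv (hsm ha hb hc) (h2 hu) (h2 hv)
  rw [der ha.mdiffAt hb.mdiffAt hc.mdiffAt, mvfderiv_congr h1, mvfderiv_congr h1,
    h3 hu, h3 hv] at h4
  simp only [add_apply] at h4
  rw [der (hu.connection hD ha).mdiffAt hb.mdiffAt hc.mdiffAt,
    der ha.mdiffAt (hu.connection hD hb).mdiffAt hc.mdiffAt,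
    der ha.mdiffAt hb.mdiffAt (hu.connection hD hc).mdiffAt,
    der (hv.connection hD ha).mdiffAt hb.mdiffAt hc.mdiffAt,
    der ha.mdiffAt (hv.connection hD hb).mdiffAt hc.mdiffAt,
    der ha.mdiffAt hb.mdiffAt (hv.connection hD hc).mdiffAt] at h4
  have s0 (p q r s : TangentSpace 𝓘(ℝ, E) x) :
      S x ![p - q, r, s] = S x ![p, r, s] - S x ![q, r, s] := by
    have := (S x).map_update_sub ![p, r, s] 0 p q
    have e (p' : TangentSpace 𝓘(ℝ, E) x) : Function.update ![p, r, s] 0 p' = ![p', r, s] := by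
      ext i; fin_cases i <;> rfl
    rwa [e, e, e] at this
  have s1 (p q r s : TangentSpace 𝓘(ℝ, E) x) :
      S x ![r, p - q, s] = S x ![r, p, s] - S x ![r, q, s] := by
    have := (S x).map_update_sub ![r, p, s] 1 p q
    have e (p' : TangentSpace 𝓘(ℝ, E) x) : Function.update ![r, p, s] 1 p' = ![r, p', s] := by
      ext i; fin_cases i <;> rfl
    rwa [e, e, e] at this
  have s2 (p q r s : TangentSpace 𝓘(ℝ, E) x) :
      S x ![r, s, p - q] = S x ![r, s, p] - S x ![r, s, q] := by
    have := (S x).map_update_sub ![r, s, p] 2 p q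
    have e (p' : TangentSpace 𝓘(ℝ, E) x) : Function.update ![r, s, p] 2 p' = ![r, s, p'] := by
      ext i; fin_cases i <;> rfl
    rwa [e, e, e] at this
  simp only [extend_apply_self] at h4
  simp only [curvature, s0, s1, s2]
  linarith

/-- The curvature takes values in `su(3)`: the endomorphisms `R(u, v)` have no complex trace. This
is the action of `R(u, v)` on `Im Ψ`, evaluated on `e₀, e₂, e₄`. -/
lemma sum_inner_curvature_J (h : IsACYT J Ψ D)
    {e : OrthonormalBasis (Fin 6) ℝ (TangentSpace 𝓘(ℝ, E) x)}
    (he : ∀ w : Fin 3 → TangentSpace 𝓘(ℝ, E) x,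
      Ψ x w = -Matrix.det (Matrix.of fun a b : Fin 3 ↦
        ((inner ℝ (![e 0, e 2, e 4] a) (w b) : ℝ) : ℂ)
          + Complex.I * ((inner ℝ (![e 1, e 3, e 5] a) (w b) : ℝ) : ℂ)))
    (u v : TangentSpace 𝓘(ℝ, E) x) :
    inner ℝ (curvature D x u v (e 0)) (e 1) + inner ℝ (curvature D x u v (e 2)) (e 3)
      + inner ℝ (curvature D x u v (e 4)) (e 5) = 0 := by
  let S (x : M) : MultilinearMap ℝ (fun _ : Fin 3 ↦ TangentSpace 𝓘(ℝ, E) x) ℝ :=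
    Complex.imLm.compMultilinearMap (Ψ x).toMultilinearMap
  have hS (x : M) (w : Fin 3 → TangentSpace 𝓘(ℝ, E) x) : S x w = (Ψ x w).im := rfl
  have hsm (x : M) (X : Fin 3 → Π x : M, TangentSpace 𝓘(ℝ, E) x) (hX : ∀ i, SmoothNear (X i) x) :
      ∀ᶠ y in 𝓝 x, ContMDiffAt 𝓘(ℝ, E) 𝓘(ℝ, ℂ) ∞ (fun y ↦ Ψ y (fun i ↦ X i y)) y := by
    filter_upwards [eventually_all.2 hX] with y hy
    exact h.smooth_form y X hy
  have him {f : M → ℂ} {x : M} (hf : MDifferentiableAt 𝓘(ℝ, E) 𝓘(ℝ, ℂ) f x)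
      (v : TangentSpace 𝓘(ℝ, E) x) :
      mvfderiv 𝓘(ℝ, E) (fun y ↦ (f y).im) x v = (mvfderiv 𝓘(ℝ, E) f x v).im := by
    have h1 := mfderiv_comp_apply (I := 𝓘(ℝ, E)) (I' := 𝓘(ℝ, ℂ)) (g := Complex.imCLM) x
      Complex.imCLM.mdifferentiableAt hf v
    rw [ContinuousLinearMap.mfderiv_eq] at h1
    exact h1
  have h1 := parallel_curvature_action (S := S) h.smooth_connection
    (fun x X hX ↦ (hsm x X hX).mono fun y hy ↦ Complex.imCLM.contMDiff.contMDiffAt.comp y hy)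
    (fun x v w ↦ by
      have h2 := congrArg Complex.im (h.parallel_form x v w)
      simp only [covDeriv, hS] at h2 ⊢
      rw [him ((hsm x _ fun i ↦ smoothNear_extend (w i)).self_of_nhds.mdifferentiableAt (by simp))]
      simpa using h2) u v (e 0) (e 2) (e 4)
  simp only [hS, he, Matrix.det_fin_three] at h1
  have ho (i j : Fin 6) : inner ℝ (e i) (e j) = if i = j then (1 : ℝ) else 0 :=
    e.inner_eq_ite i j
  simp only [Matrix.of_apply, Matrix.cons_val, ho] at h1
  have h2 : -inner ℝ (e 1) (curvature D x u v (e 0)) + -inner ℝ (e 3) (curvature D x u v (e 2))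
      + -inner ℝ (e 5) (curvature D x u v (e 4)) = 0 := by simpa using h1
  rw [real_inner_comm (e 1), real_inner_comm (e 3), real_inner_comm (e 5)]
  linarith

end CurvatureTensor

/-! ### The derivative of a trace -/

section Trace

variable {E : Type*} [NormedAddCommGroup E] [NormedSpace ℝ E] [FiniteDimensional ℝ E]
  {M : Type*} [TopologicalSpace M] [ChartedSpace E M] [IsManifold 𝓘(ℝ, E) ∞ M]
  {D : CovariantDerivative 𝓘(ℝ, E) E (fun x : M ↦ TangentSpace 𝓘(ℝ, E) x)} {x : M}

lemma connection_sum (D : CovariantDerivative 𝓘(ℝ, E) E (fun x : M ↦ TangentSpace 𝓘(ℝ, E) x))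
    {ι : Type*} (A : Finset ι) {X : ι → Π x : M, TangentSpace 𝓘(ℝ, E) x}
    (hX : ∀ i, MDiffAt (T% (X i)) x) :
    D (fun y ↦ ∑ i ∈ A, X i y) x = ∑ i ∈ A, D (X i) x := by
  classical
  induction A using Finset.induction_on with
  | empty =>
    have h0 : MDiffAt (T% (0 : Π x : M, TangentSpace 𝓘(ℝ, E) x)) x := by
      simpa using! MDifferentiableAt.sum_section (s := ∅) (t := X) (x₀ := x) (by simp)
    have h := D.isCovariantDerivativeOnUniv.add h0 h0
    rw [add_zero, left_eq_add] at h
    simp only [Finset.sum_empty]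
    exact h
  | insert i A hi ih =>
    have h := D.isCovariantDerivativeOnUniv.add (hX i)
      (MDifferentiableAt.sum_section (s := A) fun j _ ↦ hX j)
    rw [ih] at h
    rw [Finset.sum_insert hi, ← h]
    congr 1
    ext1 y
    simp [Finset.sum_insert hi]

lemma mvfderiv_sum_apply {ι : Type} [Fintype ι] {f : ι → M → ℝ} (hf : ∀ i, MDiffAt (f i) x)
    (v : TangentSpace 𝓘(ℝ, E) x) :
    mvfderiv 𝓘(ℝ, E) (fun y ↦ ∑ i, f i y) x v = ∑ i, mvfderiv 𝓘(ℝ, E) (f i) x v := by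
  classical
  have h (A : Finset ι) : mvfderiv 𝓘(ℝ, E) (fun y ↦ ∑ i ∈ A, f i y) x
      = ∑ i ∈ A, mvfderiv 𝓘(ℝ, E) (f i) x := by
    induction A using Finset.induction_on with
    | empty => simp [mvfderiv_const]
    | insert i A hi ih =>
      simp only [Finset.sum_insert hi]
      rw [← ih, ← mvfderiv_fun_add (hf i)]
      have := MDifferentiableAt.sum (I := 𝓘(ℝ, E)) (t := A) (f := f) (z := x) fun j _ ↦ hf j
      simpa only [Finset.sum_fn] using this
  rw [h, sum_apply]

/-- The trace commutes with covariant derivatives: if `K = D_v L` then `v (tr L) = tr K`. -/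
lemma mvfderiv_trace {L : Π x : M, TangentSpace 𝓘(ℝ, E) x →ₗ[ℝ] TangentSpace 𝓘(ℝ, E) x}
    {K : TangentSpace 𝓘(ℝ, E) x →ₗ[ℝ] TangentSpace 𝓘(ℝ, E) x} {v : TangentSpace 𝓘(ℝ, E) x}
    (hL : ∀ X : Π x : M, TangentSpace 𝓘(ℝ, E) x, SmoothNear X x →
      SmoothNear (fun y ↦ L y (X y)) x)
    (hK : ∀ X : Π x : M, TangentSpace 𝓘(ℝ, E) x, SmoothNear X x →
      D (fun y ↦ L y (X y)) x v = K (X x) + L x (D X x v)) :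
    MDiffAt (fun y ↦ LinearMap.trace ℝ _ (L y)) x ∧
      mvfderiv 𝓘(ℝ, E) (fun y ↦ LinearMap.trace ℝ _ (L y)) x v = LinearMap.trace ℝ _ K := by
  classical
  let t := trivializationAt E (TangentSpace 𝓘(ℝ, E) : M → Type _) x
  have x_mem : x ∈ t.baseSet := FiberBundle.mem_baseSet_trivializationAt E _ x
  let b := Module.finBasis ℝ E
  let s := t.localFrame b
  let c := t.localFrameCoeff 𝓘(ℝ, E) b
  have hs (j) : SmoothNear (s j) x := by
    filter_upwards [t.open_baseSet.mem_nhds x_mem] with y hy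
    exact contMDiffAt_localFrame_of_mem ∞ t b j hy
  have hc {X : Π x : M, TangentSpace 𝓘(ℝ, E) x} (hX : MDiffAt (T% X) x) (j) :
      MDiffAt (fun y ↦ c j y (X y)) x := mdifferentiableAt_localFrameCoeff b x_mem hX j
  have hsum {y : M} (hy : y ∈ t.baseSet) (z : TangentSpace 𝓘(ℝ, E) y) :
      z = ∑ j, c j y z • s j y := by
    have := t.eq_sum_localFrameCoeff_smul (I := 𝓘(ℝ, E)) (b := b) (s := extend E z) hy
    simpa using this
  have hrepr {y : M} (hy : y ∈ t.baseSet) (i) (z : TangentSpace 𝓘(ℝ, E) y) :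
      c i y z = (t.basisAt b hy).repr z i := by
    have := t.localFrameCoeff_apply_of_mem_baseSet (I := 𝓘(ℝ, E)) b hy (extend E z) i
    simpa using this
  have hsb {y : M} (hy : y ∈ t.baseSet) (i) : s i y = t.basisAt b hy i :=
    t.localFrame_apply_of_mem_baseSet b hy
  have hcs {y : M} (hy : y ∈ t.baseSet) (i j) : c i y (s j y) = if j = i then 1 else 0 := by
    rw [hrepr hy, hsb hy, Module.Basis.repr_self,
      Finsupp.single_apply]
  have htr {y : M} (hy : y ∈ t.baseSet)
      (A : TangentSpace 𝓘(ℝ, E) y →ₗ[ℝ] TangentSpace 𝓘(ℝ, E) y) :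
      LinearMap.trace ℝ _ A = ∑ i, c i y (A (s i y)) := by
    rw [LinearMap.trace_eq_matrix_trace ℝ (t.basisAt b hy), Matrix.trace]
    refine Finset.sum_congr rfl fun i _ ↦ ?_
    rw [Matrix.diag_apply, LinearMap.toMatrix_apply, hrepr hy, hsb hy]
  -- The derivative of the coframe: differentiate `X = ∑ⱼ cʲ(X) sⱼ`.
  have hder {X : Π x : M, TangentSpace 𝓘(ℝ, E) x} (hX : SmoothNear X x) (i) :
      mvfderiv 𝓘(ℝ, E) (fun y ↦ c i y (X y)) x v =
        c i x (D X x v) - ∑ j, c j x (X x) * c i x (D (s j) x v) := by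
    have h1 : ∀ᶠ y in 𝓝 x, X y = ∑ j, ((fun y ↦ c j y (X y)) • s j) y := by
      filter_upwards [t.open_baseSet.mem_nhds x_mem] with y hy
      exact hsum hy (X y)
    have hm (j) : MDiffAt (T% ((fun y ↦ c j y (X y)) • s j)) x :=
      (hc hX.mdiffAt j).smul_section (hs j).mdiffAt
    rw [connection_congr hX.mdiffAt (.sum_section fun j _ ↦ hm j) h1,
      connection_sum D Finset.univ hm]
    simp only [sum_apply, D.isCovariantDerivativeOnUniv.leibniz (hs _).mdiffAt (hc hX.mdiffAt _),
      add_apply, smul_apply, ContinuousLinearMap.smulRight_apply, Finset.sum_add_distrib, map_add,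
      map_sum, map_smul, hcs x_mem, smul_eq_mul, mul_ite, mul_one, mul_zero]
    simp
  have hev : ∀ᶠ y in 𝓝 x, LinearMap.trace ℝ _ (L y) = ∑ i, c i y (L y (s i y)) := by
    filter_upwards [t.open_baseSet.mem_nhds x_mem] with y hy
    exact htr hy (L y)
  have h1 (i) : c i x (L x (D (s i) x v)) = ∑ j, c j x (D (s i) x v) * c i x (L x (s j x)) := by
    conv_lhs => rw [hsum x_mem (D (s i) x v)]
    simp
  have hd (i) : MDiffAt (fun y ↦ c i y (L y (s i y))) x := hc (hL _ (hs i)).mdiffAt i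
  have hd' : MDiffAt (fun y ↦ ∑ i, c i y (L y (s i y))) x := by
    have := MDifferentiableAt.sum (I := 𝓘(ℝ, E)) (t := Finset.univ)
      (f := fun i y ↦ c i y (L y (s i y))) (z := x) fun j _ ↦ hd j
    simpa only [Finset.sum_fn] using this
  refine ⟨hd'.congr_of_eventuallyEq hev, ?_⟩
  rw [mvfderiv_congr hev, mvfderiv_sum_apply hd, htr x_mem]
  simp only [hder (hL _ (hs _)), hK _ (hs _), map_add, h1, Finset.sum_sub_distrib,
    Finset.sum_add_distrib]
  rw [Finset.sum_comm (f := fun i j ↦ c j x (L x (s i x)) * c i x (D (s j) x v))]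
  simp only [mul_comm (c _ x (D (s _) x v))]
  ring

end Trace

section LeviCivita

variable {E : Type*} [NormedAddCommGroup E] [NormedSpace ℝ E] [FiniteDimensional ℝ E]
  {M : Type*} [TopologicalSpace M] [T2Space M] [ChartedSpace E M] [IsManifold 𝓘(ℝ, E) ∞ M]
  [RiemannianBundle (fun x : M ↦ TangentSpace 𝓘(ℝ, E) x)]
  [IsContMDiffRiemannianBundle 𝓘(ℝ, E) ∞ E (fun x : M ↦ TangentSpace 𝓘(ℝ, E) x)]
  {J : Π x : M, TangentSpace 𝓘(ℝ, E) x →L[ℝ] TangentSpace 𝓘(ℝ, E) x}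
  {D : CovariantDerivative 𝓘(ℝ, E) E (fun x : M ↦ TangentSpace 𝓘(ℝ, E) x)}
  {U V W : Π x : M, TangentSpace 𝓘(ℝ, E) x} {x : M}

/-! ### The Lee form -/

/-- A metric connection with skew-symmetric torsion `T` differs from the Levi-Civita connection by
`T / 2`. -/
lemma leviCivita_apply (hg : IsMetric D) (hT : ∀ (x : M) (u v w : TangentSpace 𝓘(ℝ, E) x),
      torsionForm D x ![u, v, w] = -torsionForm D x ![u, w, v])
    (hW : MDiffAt (T% W) x) (v : TangentSpace 𝓘(ℝ, E) x) :
    leviCivita E M W x v = D W x v - (1 / 2 : ℝ) • D.torsion x v (W x) := by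
  refine ext_inner_right ℝ fun u ↦ ?_
  have hv : MDiffAt (T% (extend E v)) x := mdifferentiableAt_extend ..
  have hu : MDiffAt (T% (extend E u)) x := mdifferentiableAt_extend ..
  change inner ℝ (leviCivitaFun W x v) u = _
  rw [inner_leviCivitaFun, koszulForm_eq hW, koszul, hg x _ _ hW hu, hg x _ _ hv hu,
    hg x _ _ hv hW]
  have h2 {A B : Π x : M, TangentSpace 𝓘(ℝ, E) x} (hA : MDiffAt (T% A) x)
      (hB : MDiffAt (T% B) x) : mlieBracket 𝓘(ℝ, E) A B x =
        D B x (A x) - D A x (B x) - D.torsion x (A x) (B x) := by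
    rw [D.torsion_apply hA hB]
    abel
  rw [h2 hv hW, h2 hv hu, h2 hW hu]
  simp only [extend_apply_self, inner_sub_left, real_inner_smul_left]
  rw [inner_torsion_swap₂₃ hT v u (W x), D.torsion_antisymm (W x) u, inner_neg_left,
    inner_torsion_swap₂₃ hT u (W x) v, D.torsion_antisymm u v, inner_neg_left,
    inner_torsion_swap₂₃ hT v u (W x), real_inner_comm _ (W x),
    real_inner_comm _ v, real_inner_comm _ v]
  ring

lemma covDeriv_leviCivita_kahlerForm (hJ : IsAlmostHermitian J) (hg : IsMetric D)
    (hDJ : ∀ (x : M) (X : Π x : M, TangentSpace 𝓘(ℝ, E) x), MDiffAt (T% X) x →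
      ∀ v : TangentSpace 𝓘(ℝ, E) x, D (fun y ↦ J y (X y)) x v = J x (D X x v))
    (hT : ∀ (x : M) (u v w : TangentSpace 𝓘(ℝ, E) x),
      torsionForm D x ![u, v, w] = -torsionForm D x ![u, w, v])
    (u a c : TangentSpace 𝓘(ℝ, E) x) :
    covDeriv (leviCivita E M) (kahlerForm J) x u ![a, c] =
      (1 / 2) * (inner ℝ (D.torsion x u a) (J x c) + inner ℝ a (J x (D.torsion x u c))) := by
  have ha : MDiffAt (T% (extend E a)) x := mdifferentiableAt_extend ..
  have hc : MDiffAt (T% (extend E c)) x := mdifferentiableAt_extend ..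
  have hJc : MDiffAt (T% fun y ↦ J y (extend E c y)) x :=
    ((smoothNear_extend c).clm_apply hJ.smooth).mdiffAt
  have h01 : (0 : Fin 2) ≠ 1 := by decide
  rw [covDeriv, Fin.sum_univ_two]
  simp only [kahlerForm, Function.update_self, Function.update_of_ne h01,
    Function.update_of_ne h01.symm, Matrix.cons_val]
  rw [hg x _ _ ha hJc, hDJ x _ hc, leviCivita_apply hg hT ha, leviCivita_apply hg hT hc]
  simp only [extend_apply_self, inner_sub_left, inner_sub_right, map_sub, map_smul,
    real_inner_smul_left, real_inner_smul_right]
  ring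

variable (D J x) in
/-- The endomorphism `z ↦ T(Jz, Jw)`, whose trace is `-2 θ(w)`. -/
noncomputable def leeEndo (w : TangentSpace 𝓘(ℝ, E) x) :
    TangentSpace 𝓘(ℝ, E) x →ₗ[ℝ] TangentSpace 𝓘(ℝ, E) x :=
  ((D.torsion x).flip (J x w)).toLinearMap ∘ₗ (J x).toLinearMap

lemma leeEndo_apply (w z : TangentSpace 𝓘(ℝ, E) x) :
    leeEndo J D x w z = D.torsion x (J x z) (J x w) := rfl

lemma leeForm_eq_trace (hJ : IsAlmostHermitian J) (hg : IsMetric D)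
    (hDJ : ∀ (x : M) (X : Π x : M, TangentSpace 𝓘(ℝ, E) x), MDiffAt (T% X) x →
      ∀ v : TangentSpace 𝓘(ℝ, E) x, D (fun y ↦ J y (X y)) x v = J x (D X x v))
    (hT : ∀ (x : M) (u v w : TangentSpace 𝓘(ℝ, E) x),
      torsionForm D x ![u, v, w] = -torsionForm D x ![u, w, v])
    (w : TangentSpace 𝓘(ℝ, E) x) :
    leeForm J x ![w] = -(1 / 2) * LinearMap.trace ℝ _ (leeEndo J D x w) := by
  rw [LinearMap.trace_eq_sum_inner _ (stdOrthonormalBasis ℝ (TangentSpace 𝓘(ℝ, E) x)),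
    leeForm, codiff₂, Finset.mul_sum, ← Finset.sum_neg_distrib]
  refine Finset.sum_congr rfl fun i _ ↦ ?_
  set b := stdOrthonormalBasis ℝ (TangentSpace 𝓘(ℝ, E) x) i
  rw [covDeriv_leviCivita_kahlerForm hJ hg hDJ hT, leeEndo_apply]
  have h1 : D.torsion x b b = 0 := D.torsion_self b
  have h2 := hJ.inner_map_left b (D.torsion x b (J x w))
  have h3 := inner_torsion_swap₂₃ hT (J x w) (J x b) b
  rw [Matrix.cons_val_zero, h1, inner_zero_left, zero_add, ← neg_eq_iff_eq_neg.2 h2,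
    real_inner_comm _ b, D.torsion_antisymm (J x b), inner_neg_left, h3,
    D.torsion_antisymm (J x w), inner_neg_left, real_inner_comm _ (J x b)]
  ring

end LeviCivita

section TorsionConnection

variable {E : Type*} [NormedAddCommGroup E] [NormedSpace ℝ E] [FiniteDimensional ℝ E]
  {M : Type*} [TopologicalSpace M] [T2Space M] [ChartedSpace E M] [IsManifold 𝓘(ℝ, E) ∞ M]
  [RiemannianBundle (fun x : M ↦ TangentSpace 𝓘(ℝ, E) x)]
  [IsContMDiffRiemannianBundle 𝓘(ℝ, E) ∞ E (fun x : M ↦ TangentSpace 𝓘(ℝ, E) x)]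
  {J : Π x : M, TangentSpace 𝓘(ℝ, E) x →L[ℝ] TangentSpace 𝓘(ℝ, E) x}
  {Ψ : Π x : M, (TangentSpace 𝓘(ℝ, E) x) [⋀^Fin 3]→ₗ[ℝ] ℂ}
  {D : CovariantDerivative 𝓘(ℝ, E) E (fun x : M ↦ TangentSpace 𝓘(ℝ, E) x)}
  {U V W : Π x : M, TangentSpace 𝓘(ℝ, E) x} {x : M}

/-! ### Derivatives of the Lee form and of the Nijenhuis tensor -/

lemma nablaT_rotate (hD : D.ContMDiffCovariantDerivative ∞)
    (hT : ∀ (x : M) (u v w : TangentSpace 𝓘(ℝ, E) x),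
      torsionForm D x ![u, v, w] = -torsionForm D x ![u, w, v])
    (v a b c : TangentSpace 𝓘(ℝ, E) x) : nablaT D x v a b c = nablaT D x v b c a := by
  rw [nablaT_swap₁₂ hD, nablaT_swap₂₃ hD hT, neg_neg]

variable (x) in
/-- The 1-form `c ↦ (∇_v T)(a, b, c)`. -/
noncomputable def nablaTLinear (hD : D.ContMDiffCovariantDerivative ∞)
    (v a b : TangentSpace 𝓘(ℝ, E) x) : TangentSpace 𝓘(ℝ, E) x →ₗ[ℝ] ℝ where
  toFun := nablaT D x v a b
  map_add' := nablaT_add₃ hD v a b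
  map_smul' r := nablaT_smul₃ hD r v a b

lemma inner_connection_torsion (hD : D.ContMDiffCovariantDerivative ∞) (hg : IsMetric D)
    (hU : SmoothNear U x) (hV : SmoothNear V x) (v w : TangentSpace 𝓘(ℝ, E) x) :
    inner ℝ (D (fun y ↦ D.torsion y (U y) (V y)) x v) w =
      nablaT D x v (U x) (V x) w + inner ℝ (D.torsion x (D U x v) (V x)) w
        + inner ℝ (D.torsion x (U x) (D V x v)) w := by
  have hw : SmoothNear (extend E w) x := smoothNear_extend w
  have h := mvfderiv_torsion hD hU.mdiffAt hV.mdiffAt hw.mdiffAt v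
  rw [hg x _ _ (hU.torsion hD hV).mdiffAt hw.mdiffAt] at h
  simp only [extend_apply_self] at h
  linarith

/-- `v (θ(V)) = -½ ∑ᵢ (∇_v T)(J eᵢ, J V, eᵢ) + θ(D_v V)`, by differentiating the trace that defines
the Lee form. -/
lemma mvfderiv_leeForm (h : IsACYT J Ψ D) (hV : SmoothNear V x) (v : TangentSpace 𝓘(ℝ, E) x)
    {ι : Type*} [Fintype ι] (e : OrthonormalBasis ι ℝ (TangentSpace 𝓘(ℝ, E) x)) :
    mvfderiv 𝓘(ℝ, E) (fun y ↦ leeForm J y ![V y]) x v =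
      -(1 / 2) * ∑ i, nablaT D x v (J x (e i)) (J x (V x)) (e i) + leeForm J x ![D V x v] := by
  have hJ := h.toIsAlmostHermitian
  have hD := h.smooth_connection
  have hT := h.skew_torsion
  have hJV := hV.clm_apply hJ.smooth
  have hL (X : Π x : M, TangentSpace 𝓘(ℝ, E) x) (hX : SmoothNear X x) :
      SmoothNear (fun y ↦ leeEndo J D y (V y) (X y)) x :=
    (hX.clm_apply hJ.smooth).torsion hD hJV
  -- `K` is the covariant derivative of the endomorphism whose trace is `-2 θ(V)`.
  let K : TangentSpace 𝓘(ℝ, E) x →ₗ[ℝ] TangentSpace 𝓘(ℝ, E) x :=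
    (∑ j, ((nablaTLinear x hD v (J x (V x)) (e j)) ∘ₗ (J x).toLinearMap).smulRight (e j))
      + leeEndo J D x (D V x v)
  have hKw (z w : TangentSpace 𝓘(ℝ, E) x) : inner ℝ (K z) w =
      nablaT D x v (J x z) (J x (V x)) w + inner ℝ (leeEndo J D x (D V x v) z) w := by
    have h1 : K z = (∑ j, nablaT D x v (J x (V x)) (e j) (J x z) • e j)
        + leeEndo J D x (D V x v) z := by
      simp [K, nablaTLinear]
    have h2 : nablaT D x v (J x z) (J x (V x)) w =
        ∑ j, inner ℝ (e j) w * nablaT D x v (J x z) (J x (V x)) (e j) := by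
      have := map_sum (nablaTLinear x hD v (J x z) (J x (V x)))
        (fun j ↦ inner ℝ (e j) w • e j) Finset.univ
      rw [e.sum_repr'] at this
      simpa [nablaTLinear, nablaT_smul₃ hD] using this
    rw [h1, inner_add_left, sum_inner, h2]
    congr 1
    refine Finset.sum_congr rfl fun j _ ↦ ?_
    rw [real_inner_smul_left, nablaT_rotate hD hT v (J x z), mul_comm]
  have hK (X : Π x : M, TangentSpace 𝓘(ℝ, E) x) (hX : SmoothNear X x) :
      D (fun y ↦ leeEndo J D y (V y) (X y)) x v =
        K (X x) + leeEndo J D x (V x) (D X x v) := by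
    refine ext_inner_right ℝ fun w ↦ ?_
    have := inner_connection_torsion hD h.metric (hX.clm_apply hJ.smooth) hJV v w
    rw [h.parallel_J x X hX.mdiffAt, h.parallel_J x V hV.mdiffAt] at this
    rw [inner_add_left, hKw]
    simp only [leeEndo_apply]
    rw [this]
    ring
  obtain ⟨hd, htr⟩ := mvfderiv_trace hL hK
  rw [LinearMap.trace_eq_sum_inner K e] at htr
  have h3 (y : M) : leeForm J y ![V y] =
      -(1 / 2) * LinearMap.trace ℝ _ (leeEndo J D y (V y)) :=
    leeForm_eq_trace hJ h.metric h.parallel_J hT (V y)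
  simp only [h3]
  rw [mvfderiv_fun_mul mdifferentiableAt_const hd, mvfderiv_const]
  simp only [smul_apply, smul_zero, add_zero, smul_eq_mul, htr]
  rw [leeForm_eq_trace hJ h.metric h.parallel_J hT,
    LinearMap.trace_eq_sum_inner (leeEndo J D x (D V x v)) e, ← mul_add, ← Finset.sum_add_distrib]
  congr 1
  refine Finset.sum_congr rfl fun i _ ↦ ?_
  rw [real_inner_comm, hKw, real_inner_comm (e i)]

lemma covDeriv_leeForm (h : IsACYT J Ψ D) (u w : TangentSpace 𝓘(ℝ, E) x)
    {ι : Type*} [Fintype ι] (e : OrthonormalBasis ι ℝ (TangentSpace 𝓘(ℝ, E) x)) :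
    covDeriv D (leeForm J) x u ![w] =
      -(1 / 2) * ∑ i, nablaT D x u (J x (e i)) (J x w) (e i) := by
  have h1 := mvfderiv_leeForm h (smoothNear_extend w) u e
  have h2 (y : M) : (fun i ↦ extend E ((![w] : Fin 1 → TangentSpace 𝓘(ℝ, E) x) i) y) =
      ![extend E w y] := by
    ext i; fin_cases i; rfl
  have h3 (z : TangentSpace 𝓘(ℝ, E) x) : Function.update ![w] 0 z = ![z] := by
    ext i; fin_cases i; rfl
  simp only [covDeriv, h2, h1, Fin.sum_univ_one, h3, extend_apply_self, Matrix.cons_val_zero]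
  ring

lemma leeForm_sub (h : IsACYT J Ψ D) (a b : TangentSpace 𝓘(ℝ, E) x) :
    leeForm J x ![a - b] = leeForm J x ![a] - leeForm J x ![b] := by
  have hl (w : TangentSpace 𝓘(ℝ, E) x) :=
    leeForm_eq_trace h.toIsAlmostHermitian h.metric h.parallel_J h.skew_torsion w
  have : leeEndo J D x (a - b) = leeEndo J D x a - leeEndo J D x b := by
    ext z
    simp [leeEndo_apply]
  rw [hl, hl, hl, this, map_sub]
  ring

lemma extD_leeForm (h : IsACYT J Ψ D) (a b : TangentSpace 𝓘(ℝ, E) x) :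
    extD (leeForm J) x ![a, b] = covDeriv D (leeForm J) x a ![b] - covDeriv D (leeForm J) x b ![a]
      + leeForm J x ![D.torsion x a b] := by
  let e := stdOrthonormalBasis ℝ (TangentSpace 𝓘(ℝ, E) x)
  have h1 := D.torsion_apply (smoothNear_extend a).mdiffAt (smoothNear_extend b).mdiffAt
  simp only [extend_apply_self] at h1
  rw [extD_one, mvfderiv_leeForm h (smoothNear_extend b) a e,
    mvfderiv_leeForm h (smoothNear_extend a) b e, covDeriv_leeForm h _ _ e,
    covDeriv_leeForm h _ _ e, h1, leeForm_sub h, leeForm_sub h]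
  simp only [extend_apply_self]
  ring

/-- The Nijenhuis tensor in terms of the torsion, as `DJ = 0`. -/
lemma nijenhuisForm_eq (h : IsACYT J Ψ D) (u v w : TangentSpace 𝓘(ℝ, E) x) :
    nijenhuisForm J x ![u, v, w] = inner ℝ (D.torsion x u v) w
      - inner ℝ (D.torsion x (J x u) (J x v)) w - inner ℝ (D.torsion x (J x u) v) (J x w)
      - inner ℝ (D.torsion x u (J x v)) (J x w) := by
  have hs (u : TangentSpace 𝓘(ℝ, E) x) : MDiffAt (T% (extend E u)) x := mdifferentiableAt_extend ..
  have hJs (u : TangentSpace 𝓘(ℝ, E) x) : MDiffAt (T% fun y ↦ J y (extend E u y)) x :=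
    ((smoothNear_extend u).clm_apply h.smooth).mdiffAt
  have h2 {A B : Π x : M, TangentSpace 𝓘(ℝ, E) x} (hA : MDiffAt (T% A) x)
      (hB : MDiffAt (T% B) x) : mlieBracket 𝓘(ℝ, E) A B x =
        D B x (A x) - D A x (B x) - D.torsion x (A x) (B x) := by
    rw [D.torsion_apply hA hB]
    abel
  have hJ := h.toIsAlmostHermitian
  have hDJ (u z : TangentSpace 𝓘(ℝ, E) x) :
      D (fun y ↦ J y (extend E u y)) x z = J x (D (extend E u) x z) := h.parallel_J x _ (hs u) z
  simp only [nijenhuisForm, nijenhuis, Matrix.cons_val]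
  rw [h2 (hJs u) (hJs v), h2 (hs u) (hs v), h2 (hJs u) (hs v), h2 (hs u) (hJs v)]
  simp only [hDJ, extend_apply_self, map_sub, hJ.sq_eq_neg, inner_sub_left, inner_neg_left,
    hJ.inner_map_left (D.torsion x _ _)]
  ring

lemma covDeriv_nijenhuisForm (h : IsACYT J Ψ D) (v a b c : TangentSpace 𝓘(ℝ, E) x) :
    covDeriv D (nijenhuisForm J) x v ![a, b, c] =
      nablaT D x v a b c - nablaT D x v (J x a) (J x b) c - nablaT D x v (J x a) b (J x c)
        - nablaT D x v a (J x b) (J x c) := by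
  have hD := h.smooth_connection
  have hs (u : TangentSpace 𝓘(ℝ, E) x) : SmoothNear (extend E u) x := smoothNear_extend u
  have hJs (u : TangentSpace 𝓘(ℝ, E) x) : SmoothNear (fun y ↦ J y (extend E u y)) x :=
    (smoothNear_extend u).clm_apply h.smooth
  have hw (y : M) : (fun k ↦ extend E ((![a, b, c] : Fin 3 → TangentSpace 𝓘(ℝ, E) x) k) y)
      = ![extend E a y, extend E b y, extend E c y] := by
    ext k; fin_cases k <;> rfl
  have e0 (p : TangentSpace 𝓘(ℝ, E) x) : Function.update ![a, b, c] 0 p = ![p, b, c] := by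
    ext i; fin_cases i <;> rfl
  have e1 (p : TangentSpace 𝓘(ℝ, E) x) : Function.update ![a, b, c] 1 p = ![a, p, c] := by
    ext i; fin_cases i <;> rfl
  have e2 (p : TangentSpace 𝓘(ℝ, E) x) : Function.update ![a, b, c] 2 p = ![a, b, p] := by
    ext i; fin_cases i <;> rfl
  have hd {A B C : Π x : M, TangentSpace 𝓘(ℝ, E) x} (hA : SmoothNear A x) (hB : SmoothNear B x)
      (hC : SmoothNear C x) : MDiffAt (fun y ↦ inner ℝ (D.torsion y (A y) (B y)) (C y)) x :=
    mdifferentiableAt_inner (hA.torsion hD hB).mdiffAt hC.mdiffAt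
  have hm {A B C : Π x : M, TangentSpace 𝓘(ℝ, E) x} (hA : SmoothNear A x) (hB : SmoothNear B x)
      (hC : SmoothNear C x) := mvfderiv_torsion hD hA.mdiffAt hB.mdiffAt hC.mdiffAt v
  have hsub {f₁ f₂ f₃ f₄ : M → ℝ} (h₁ : MDiffAt f₁ x) (h₂ : MDiffAt f₂ x) (h₃ : MDiffAt f₃ x)
      (h₄ : MDiffAt f₄ x) : mvfderiv 𝓘(ℝ, E) (fun y ↦ f₁ y - f₂ y - f₃ y - f₄ y) x v =
        mvfderiv 𝓘(ℝ, E) f₁ x v - mvfderiv 𝓘(ℝ, E) f₂ x v - mvfderiv 𝓘(ℝ, E) f₃ x v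
          - mvfderiv 𝓘(ℝ, E) f₄ x v := by
    have := mvfderiv_sub ((h₁.sub h₂).sub h₃) h₄
    rw [mvfderiv_sub (h₁.sub h₂) h₃, mvfderiv_sub h₁ h₂] at this
    exact congrArg (fun L ↦ L v) this
  have d1 := hd (hs a) (hs b) (hs c)
  have d2 := hd (hJs a) (hJs b) (hs c)
  have d3 := hd (hJs a) (hs b) (hJs c)
  have d4 := hd (hs a) (hJs b) (hJs c)
  rw [covDeriv, Fin.sum_univ_three, e0, e1, e2]
  simp only [hw, nijenhuisForm_eq h, Matrix.cons_val]
  rw [hsub d1 d2 d3 d4, hm (hs a) (hs b) (hs c), hm (hJs a) (hJs b) (hs c),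
    hm (hJs a) (hs b) (hJs c), hm (hs a) (hJs b) (hJs c), h.parallel_J x _ (hs a).mdiffAt,
    h.parallel_J x _ (hs b).mdiffAt, h.parallel_J x _ (hs c).mdiffAt]
  simp only [extend_apply_self]
  ring

end TorsionConnection

section Pointwise

variable {E : Type*} [NormedAddCommGroup E] [NormedSpace ℝ E] [FiniteDimensional ℝ E]
  {M : Type*} [TopologicalSpace M] [T2Space M] [ChartedSpace E M] [IsManifold 𝓘(ℝ, E) ∞ M]
  [RiemannianBundle (fun x : M ↦ TangentSpace 𝓘(ℝ, E) x)]
  [IsContMDiffRiemannianBundle 𝓘(ℝ, E) ∞ E (fun x : M ↦ TangentSpace 𝓘(ℝ, E) x)]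
  {J : Π x : M, TangentSpace 𝓘(ℝ, E) x →L[ℝ] TangentSpace 𝓘(ℝ, E) x}
  {Ψ : Π x : M, (TangentSpace 𝓘(ℝ, E) x) [⋀^Fin 3]→ₗ[ℝ] ℂ}
  {D : CovariantDerivative 𝓘(ℝ, E) E (fun x : M ↦ TangentSpace 𝓘(ℝ, E) x)} {x : M}

/-! ### Consequences of the Bianchi identity -/

/-- The 4-form `Q` in terms of inner products. -/
lemma torsionSq_eq_inner (h : IsACYT J Ψ D) (a b c d : TangentSpace 𝓘(ℝ, E) x) :
    torsionSq D x a b c d = inner ℝ (D.torsion x a b) (D.torsion x c d)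
      + inner ℝ (D.torsion x b c) (D.torsion x a d)
      + inner ℝ (D.torsion x c a) (D.torsion x b d) := by
  have hr (p q r : TangentSpace 𝓘(ℝ, E) x) :
      inner ℝ (D.torsion x p q) r = inner ℝ p (D.torsion x q r) := by
    rw [inner_torsion_swap₂₃ h.skew_torsion, D.torsion_antisymm, inner_neg_left, neg_neg,
      inner_torsion_swap₂₃ h.skew_torsion, D.torsion_antisymm, inner_neg_left, neg_neg,
      real_inner_comm]
  simp only [torsionSq, hr _ _ d]

lemma torsionSq_swap₁₂ (h : IsACYT J Ψ D) (a b c d : TangentSpace 𝓘(ℝ, E) x) :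
    torsionSq D x a b c d = -torsionSq D x b a c d := by
  rw [torsionSq_eq_inner h, torsionSq_eq_inner h, D.torsion_antisymm b a, D.torsion_antisymm a c,
    D.torsion_antisymm c b]
  simp only [inner_neg_left]
  ring

lemma torsionSq_swap₂₃ (h : IsACYT J Ψ D) (a b c d : TangentSpace 𝓘(ℝ, E) x) :
    torsionSq D x a b c d = -torsionSq D x a c b d := by
  rw [torsionSq_eq_inner h, torsionSq_eq_inner h, D.torsion_antisymm a c, D.torsion_antisymm c b,
    D.torsion_antisymm b a]
  simp only [inner_neg_left]
  ring

lemma torsionSq_swap₃₄ (h : IsACYT J Ψ D) (a b c d : TangentSpace 𝓘(ℝ, E) x) :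
    torsionSq D x a b c d = -torsionSq D x a b d c := by
  rw [torsionSq_eq_inner h, torsionSq_eq_inner h, D.torsion_antisymm d c, D.torsion_antisymm c a,
    D.torsion_antisymm d a, real_inner_comm (D.torsion x b d), real_inner_comm (D.torsion x a d)]
  simp only [inner_neg_left, inner_neg_right]
  ring

variable (D x) in
/-- The curvature as a `(0,4)`-tensor, `R(a, b, c, d) = g(R(a, b)c, d)`. -/
noncomputable def curvatureForm (a b c d : TangentSpace 𝓘(ℝ, E) x) : ℝ :=
  inner ℝ (curvature D x a b c) d

lemma curvatureForm_swap₁₂ (a b c d : TangentSpace 𝓘(ℝ, E) x) :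
    curvatureForm D x a b c d = -curvatureForm D x b a c d := by
  rw [curvatureForm, curvature_swap, inner_neg_left]
  rfl

lemma curvatureForm_swap₃₄ (h : IsACYT J Ψ D) (a b c d : TangentSpace 𝓘(ℝ, E) x) :
    curvatureForm D x a b c d = -curvatureForm D x a b d c :=
  inner_curvature_swap h.smooth_connection h.metric a b c d

lemma curvatureForm_J (h : IsACYT J Ψ D) (a b c d : TangentSpace 𝓘(ℝ, E) x) :
    curvatureForm D x a b (J x c) d = -curvatureForm D x a b c (J x d) :=
  inner_curvature_J h.toIsAlmostHermitian h.smooth_connection h.metric h.parallel_J a b c d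

variable (D x) in
/-- The exterior derivative of the torsion form. -/
noncomputable def torsionD (a b c d : TangentSpace 𝓘(ℝ, E) x) : ℝ :=
  extD (torsionForm D) x ![a, b, c, d]

lemma torsionD_eq (h : IsACYT J Ψ D) (a b c d : TangentSpace 𝓘(ℝ, E) x) :
    torsionD D x a b c d =
      nablaT D x a b c d + nablaT D x b c a d + nablaT D x c a b d - nablaT D x d a b c
        + 2 * torsionSq D x a b c d :=
  extD_torsionForm h.smooth_connection h.skew_torsion a b c d

lemma bianchi_torsionD (h : IsACYT J Ψ D) (a b c d : TangentSpace 𝓘(ℝ, E) x) :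
    curvatureForm D x a b c d + curvatureForm D x b c a d + curvatureForm D x c a b d =
      torsionD D x a b c d + nablaT D x d a b c - torsionSq D x a b c d := by
  have := bianchi h.smooth_connection h.metric a b c d
  rw [torsionD_eq h]
  simp only [curvatureForm]
  linarith

lemma nablaT_swap₁₃ (h : IsACYT J Ψ D) (v a b c : TangentSpace 𝓘(ℝ, E) x) :
    nablaT D x v a b c = -nablaT D x v c b a := by
  rw [nablaT_swap₁₂ h.smooth_connection, nablaT_swap₂₃ h.smooth_connection h.skew_torsion,
    nablaT_swap₁₂ h.smooth_connection, neg_neg]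

lemma torsionD_swap₁₂ (h : IsACYT J Ψ D) (a b c d : TangentSpace 𝓘(ℝ, E) x) :
    torsionD D x a b c d = -torsionD D x b a c d := by
  have hD := h.smooth_connection
  rw [torsionD_eq h, torsionD_eq h, torsionSq_swap₁₂ h, nablaT_swap₁₂ hD b c, nablaT_swap₁₂ hD a c,
    nablaT_swap₁₂ hD c b, nablaT_swap₁₂ hD d b]
  ring

lemma torsionD_swap₂₃ (h : IsACYT J Ψ D) (a b c d : TangentSpace 𝓘(ℝ, E) x) :
    torsionD D x a b c d = -torsionD D x a c b d := by
  have hD := h.smooth_connection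
  rw [torsionD_eq h, torsionD_eq h, torsionSq_swap₂₃ h, nablaT_swap₁₂ hD a c,
    nablaT_swap₁₂ hD c b a, nablaT_swap₁₂ hD b a, nablaT_swap₂₃ hD h.skew_torsion d a c]
  ring

lemma torsionD_swap₃₄ (h : IsACYT J Ψ D) (a b c d : TangentSpace 𝓘(ℝ, E) x) :
    torsionD D x a b c d = -torsionD D x a b d c := by
  have hD := h.smooth_connection
  have hT := h.skew_torsion
  rw [torsionD_eq h, torsionD_eq h, torsionSq_swap₃₄ h, nablaT_swap₂₃ hD hT a b d,
    nablaT_swap₁₃ h b d a c]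
  ring

/-- A metric connection with skew-symmetric torsion satisfies
`R(v, a, b, c) + R(v, b, c, a) + R(v, c, a, b) = (∇_v T)(a, b, c) - ½ dT(a, b, c, v)`. -/
lemma curvatureForm_cyclic (h : IsACYT J Ψ D) (v a b c : TangentSpace 𝓘(ℝ, E) x) :
    curvatureForm D x v a b c + curvatureForm D x v b c a + curvatureForm D x v c a b =
      nablaT D x v a b c - (1 / 2) * torsionD D x a b c v := by
  have b1 := bianchi_torsionD h a b c v
  have b2 := bianchi_torsionD h b c v a
  have b3 := bianchi_torsionD h a c v b
  have b4 := bianchi_torsionD h a b v c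
  have q2 : torsionSq D x b c v a = -torsionSq D x a b c v := by
    rw [torsionSq_swap₃₄ h, torsionSq_swap₂₃ h, torsionSq_swap₁₂ h, neg_neg]
  have q3 : torsionSq D x a c v b = torsionSq D x a b c v := by
    rw [torsionSq_swap₃₄ h, torsionSq_swap₂₃ h, neg_neg]
  have q4 := torsionSq_swap₃₄ h a b v c
  have d2 : torsionD D x b c v a = -torsionD D x a b c v := by
    rw [torsionD_swap₃₄ h, torsionD_swap₂₃ h, torsionD_swap₁₂ h, neg_neg]
  have d3 : torsionD D x a c v b = torsionD D x a b c v := by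
    rw [torsionD_swap₃₄ h, torsionD_swap₂₃ h, neg_neg]
  have d4 := torsionD_swap₃₄ h a b v c
  have hd := torsionD_eq h a b c v
  have p1 := nablaT_swap₁₂ h.smooth_connection b c a v
  have r1 := curvatureForm_swap₃₄ h b c v a
  have r2 := curvatureForm_swap₃₄ h a b v c
  have r3 := curvatureForm_swap₃₄ h a c v b
  have r4 := curvatureForm_swap₁₂ (D := D) c a b v
  have r5 := curvatureForm_swap₃₄ h c v b a
  have r6 := curvatureForm_swap₁₂ (D := D) c v a b
  have r7 := curvatureForm_swap₁₂ (D := D) b v a c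
  have r8 := curvatureForm_swap₃₄ h v b a c
  have r9 := curvatureForm_swap₃₄ h v a c b
  linarith

end Pointwise

/-! ### Linear algebra in an orthonormal basis -/

section LinearAlgebra

/-- The metric trace of a bilinear form does not depend on the orthonormal basis. -/
lemma sum_bilinear_orthonormalBasis {V : Type*} [NormedAddCommGroup V] [InnerProductSpace ℝ V]
    {ι κ : Type*} [Fintype ι] [Fintype κ] (B : V →ₗ[ℝ] V →ₗ[ℝ] ℝ) (e : OrthonormalBasis ι ℝ V)
    (f : OrthonormalBasis κ ℝ V) : ∑ i, B (e i) (e i) = ∑ j, B (f j) (f j) := by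
  classical
  have h1 (i) : B (e i) (e i) =
      ∑ j, ∑ k, inner ℝ (f j) (e i) * inner ℝ (e i) (f k) * B (f j) (f k) := by
    have h2 : B (e i) (e i) =
        B (∑ j, inner ℝ (f j) (e i) • f j) (∑ j, inner ℝ (f j) (e i) • f j) := by
      rw [f.sum_repr']
    rw [h2]
    simp only [map_sum, map_smul, LinearMap.sum_apply, LinearMap.smul_apply, smul_eq_mul,
      Finset.mul_sum]
    rw [Finset.sum_comm]
    refine Finset.sum_congr rfl fun j _ ↦ Finset.sum_congr rfl fun k _ ↦ ?_
    rw [real_inner_comm (f k)]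
    ring
  simp only [h1]
  rw [Finset.sum_comm]
  refine Finset.sum_congr rfl fun j _ ↦ ?_
  rw [Finset.sum_comm]
  simp only [← Finset.sum_mul, e.sum_inner_mul_inner, f.inner_eq_ite]
  simp

set_option maxHeartbeats 1000000 in
/-- The quadratic identity satisfied by the components `c i j k` of a 3-form on `ℝ⁶` with its
standard complex structure. It says that the component of type `(2,0) + (0,2)` of the 2-form
`X, Y ↦ Q(X, Y, e₀, e₁) + Q(X, Y, e₂, e₃) + Q(X, Y, e₄, e₅)` is determined by the contraction `t` of
the 3-form with the Kähler form. -/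
lemma quadratic_identity_components (c : Fin 6 → Fin 6 → Fin 6 → ℝ)
    (h₁₂ : ∀ i j k, c i j k = -c j i k) (h₂₃ : ∀ i j k, c i j k = -c i k j)
    {q : Fin 6 → Fin 6 → ℝ} (hq : ∀ i j, q i j = ∑ m, (c i j m * (c 0 1 m + c 2 3 m + c 4 5 m)
      + (c j 0 m * c i 1 m + c j 2 m * c i 3 m + c j 4 m * c i 5 m)
      + (c 0 i m * c j 1 m + c 2 i m * c j 3 m + c 4 i m * c j 5 m)))
    {t : Fin 6 → ℝ} (ht : ∀ m, t m = c 0 1 m + c 2 3 m + c 4 5 m)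
    {s : Fin 6 → ℝ} (hs : s = ![1, -1, 1, -1, 1, -1])
    {p : Fin 6 → Fin 6} (hp : p = ![1, 0, 3, 2, 5, 4]) (i j : Fin 6) :
    s j * q i (p j) + s i * q (p i) j =
      ∑ m, s m * t (p m) * (c i j m - s i * s j * c (p i) (p j) m) := by
  -- The conditional rewrite rules sort the indices of every component.
  have h1 (i j k) (_ : j < i) : c i j k = -c j i k := h₁₂ i j k
  have h2 (i j k) (_ : k < j) : c i j k = -c i k j := h₂₃ i j k
  have h3 (i k) : c i i k = 0 := by linarith [h₁₂ i i k]
  have h4 (i k) : c i k k = 0 := by linarith [h₂₃ i k k]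
  simp only [hq, ht, Fin.sum_univ_six]
  fin_cases i <;> fin_cases j <;>
  · simp only [hs, hp, Fin.zero_eta, Fin.mk_one, Fin.reduceFinMk, Matrix.cons_val]
    simp (disch := decide) only [h1, h2, h3, h4]
    ring

/-- A 4-form `c` on `ℝ⁶` whose contraction with the standard Kähler form vanishes is zero. Among
four basis vectors two lie in a common complex line, so it suffices to consider the components
`c k k' i j` for a complex line `(k, k')`; each of these is a combination of contractions. -/
lemma four_form_components_eq_zero (c : Fin 6 → Fin 6 → Fin 6 → Fin 6 → ℝ)
    (h₁₂ : ∀ i j k l, c i j k l = -c j i k l) (h₂₃ : ∀ i j k l, c i j k l = -c i k j l)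
    (h₃₄ : ∀ i j k l, c i j k l = -c i j l k)
    (hc : ∀ i j, c i j 0 1 + c i j 2 3 + c i j 4 5 = 0) (i j k l : Fin 6) : c i j k l = 0 := by
  have h1 (i j k l) (_ : j < i) : c i j k l = -c j i k l := h₁₂ i j k l
  have h2 (i j k l) (_ : k < j) : c i j k l = -c i k j l := h₂₃ i j k l
  have h3 (i j k l) (_ : l < k) : c i j k l = -c i j l k := h₃₄ i j k l
  have h4 (i k l) : c i i k l = 0 := by linarith [h₁₂ i i k l]
  have h5 (i k l) : c i k k l = 0 := by linarith [h₂₃ i k k l]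
  have h6 (i j k) : c i j k k = 0 := by linarith [h₃₄ i j k k]
  have hsort : ∀ i j : Fin 6, c 0 1 i j = 0 ∧ c 2 3 i j = 0 ∧ c 4 5 i j = 0 := by
    have a1 := hc 0 1
    have a2 := hc 2 3
    have a3 := hc 4 5
    have b1 := hc 0 2
    have b2 := hc 0 3
    have b3 := hc 1 2
    have b4 := hc 1 3
    have b5 := hc 0 4
    have b6 := hc 0 5
    have b7 := hc 1 4
    have b8 := hc 1 5
    have b9 := hc 2 4
    have b10 := hc 2 5
    have b11 := hc 3 4
    have b12 := hc 3 5
    simp (disch := decide) only [h1, h2, h3, h4, h5, h6, neg_zero, neg_neg, zero_add,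
      add_zero] at a1 a2 a3 b1 b2 b3 b4 b5 b6 b7 b8 b9 b10 b11 b12
    have d1 : c 0 1 2 3 = 0 := by linarith
    have d2 : c 0 1 4 5 = 0 := by linarith
    have d3 : c 2 3 4 5 = 0 := by linarith
    intro i j
    fin_cases i <;> fin_cases j <;>
    · simp only [Fin.zero_eta, Fin.mk_one, Fin.reduceFinMk]
      simp (disch := decide) only [h1, h2, h3, h4, h5, h6, neg_zero, d1, d2, d3, b1, b2,
        b3, b4, b5, b6, b7, b8, b9, b10, b11, b12, and_self]
  have hline : ∀ i j : Fin 6, (i : ℕ) / 2 = j / 2 → ∀ k l, c i j k l = 0 := by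
    intro i j hij k l
    obtain ⟨h01, h23, h45⟩ := hsort k l
    fin_cases i <;> fin_cases j <;> simp at hij <;>
      first
      | exact h4 _ _ _
      | assumption
      | (rw [h₁₂]; simpa)
  -- Four indices meet three lines, so two of them span the same complex line.
  have hpig : ∀ i j k l : Fin 6, (i : ℕ) / 2 = j / 2 ∨ (i : ℕ) / 2 = k / 2 ∨ (i : ℕ) / 2 = l / 2 ∨
      (j : ℕ) / 2 = k / 2 ∨ (j : ℕ) / 2 = l / 2 ∨ (k : ℕ) / 2 = l / 2 := by
    omega
  rcases hpig i j k l with h | h | h | h | h | h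
  · exact hline i j h k l
  · rw [h₂₃, hline i k h, neg_zero]
  · rw [h₃₄, h₂₃, hline i l h, neg_zero, neg_zero]
  · rw [h₁₂, h₂₃, hline j k h, neg_zero, neg_zero]
  · rw [h₁₂, h₃₄, h₂₃, hline j l h, neg_zero, neg_zero, neg_zero]
  · rw [h₂₃ i j k l, h₁₂ i k j l, h₃₄ k i j l, h₂₃ k i l j, hline k l h, neg_zero, neg_zero,
      neg_zero, neg_zero]

end LinearAlgebra

section Adapted

variable {E : Type*} [NormedAddCommGroup E] [NormedSpace ℝ E] [FiniteDimensional ℝ E]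
  {M : Type*} [TopologicalSpace M] [T2Space M] [ChartedSpace E M] [IsManifold 𝓘(ℝ, E) ∞ M]
  [RiemannianBundle (fun x : M ↦ TangentSpace 𝓘(ℝ, E) x)]
  [IsContMDiffRiemannianBundle 𝓘(ℝ, E) ∞ E (fun x : M ↦ TangentSpace 𝓘(ℝ, E) x)]
  {J : Π x : M, TangentSpace 𝓘(ℝ, E) x →L[ℝ] TangentSpace 𝓘(ℝ, E) x}
  {Ψ : Π x : M, (TangentSpace 𝓘(ℝ, E) x) [⋀^Fin 3]→ₗ[ℝ] ℂ}
  {D : CovariantDerivative 𝓘(ℝ, E) E (fun x : M ↦ TangentSpace 𝓘(ℝ, E) x)} {x : M}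
  {e : OrthonormalBasis (Fin 6) ℝ (TangentSpace 𝓘(ℝ, E) x)}

/-! ### Contractions in an adapted frame -/

variable (J Ψ) in
/-- The orthonormal basis `e` of the tangent space at `x` is adapted to the `SU(3)`-structure: it
consists of the pairs `(e₀, e₁)`, `(e₂, e₃)`, `(e₄, e₅)` of the form `(f, Jf)`, and `Ψ` has the
standard form. -/
structure IsAdapted (e : OrthonormalBasis (Fin 6) ℝ (TangentSpace 𝓘(ℝ, E) x)) : Prop where
  map_zero : J x (e 0) = e 1
  map_two : J x (e 2) = e 3
  map_four : J x (e 4) = e 5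
  form : ∀ w : Fin 3 → TangentSpace 𝓘(ℝ, E) x,
      Ψ x w = -Matrix.det (Matrix.of fun a b : Fin 3 ↦
        ((inner ℝ (![e 0, e 2, e 4] a) (w b) : ℝ) : ℂ)
          + Complex.I * ((inner ℝ (![e 1, e 3, e 5] a) (w b) : ℝ) : ℂ))

variable (x) in
lemma exists_isAdapted (h : IsACYT J Ψ D) :
    ∃ e : OrthonormalBasis (Fin 6) ℝ (TangentSpace 𝓘(ℝ, E) x), IsAdapted J Ψ e := by
  obtain ⟨e, h0, h2, h4, hΨ⟩ := h.exists_adapted x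
  exact ⟨e, h0, h2, h4, hΨ⟩

namespace IsAdapted

lemma map_one (he : IsAdapted J Ψ e) (h : IsACYT J Ψ D) : J x (e 1) = -e 0 := by
  rw [← he.map_zero, h.sq_eq_neg]

lemma map_three (he : IsAdapted J Ψ e) (h : IsACYT J Ψ D) : J x (e 3) = -e 2 := by
  rw [← he.map_two, h.sq_eq_neg]

lemma map_five (he : IsAdapted J Ψ e) (h : IsACYT J Ψ D) : J x (e 5) = -e 4 := by
  rw [← he.map_four, h.sq_eq_neg]

/-- A sum `∑ᵢ B(eᵢ, J eᵢ)` in an adapted frame. -/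
lemma sum_J (he : IsAdapted J Ψ e) (h : IsACYT J Ψ D)
    (B : TangentSpace 𝓘(ℝ, E) x → TangentSpace 𝓘(ℝ, E) x → ℝ)
    (hB : ∀ a b, B a (-b) = -B a b) :
    ∑ i, B (e i) (J x (e i)) =
      B (e 0) (e 1) - B (e 1) (e 0) + B (e 2) (e 3) - B (e 3) (e 2) + B (e 4) (e 5)
        - B (e 5) (e 4) := by
  rw [Fin.sum_univ_six, he.map_zero, he.map_one h, he.map_two, he.map_three h, he.map_four,
    he.map_five h, hB, hB, hB]
  ring

/-- `∑ᵢ B(J eᵢ, eᵢ) = -∑ᵢ B(eᵢ, J eᵢ)`, as `J eᵢ` is again an orthonormal basis. -/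
lemma sum_J_left (he : IsAdapted J Ψ e) (h : IsACYT J Ψ D)
    (B : TangentSpace 𝓘(ℝ, E) x → TangentSpace 𝓘(ℝ, E) x → ℝ)
    (hB : ∀ a b, B (-a) b = -B a b) (hB' : ∀ a b, B a (-b) = -B a b) :
    ∑ i, B (J x (e i)) (e i) = -∑ i, B (e i) (J x (e i)) := by
  rw [he.sum_J h B hB', Fin.sum_univ_six, he.map_zero, he.map_one h, he.map_two, he.map_three h,
    he.map_four, he.map_five h, hB, hB, hB]
  ring

end IsAdapted

lemma curvatureForm_neg₄ (a b c d : TangentSpace 𝓘(ℝ, E) x) :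
    curvatureForm D x a b c (-d) = -curvatureForm D x a b c d := inner_neg_right ..

lemma nablaT_neg₀ (v a b c : TangentSpace 𝓘(ℝ, E) x) :
    nablaT D x (-v) a b c = -nablaT D x v a b c := by
  simpa using nablaT_smul₀ (-1) v a b c

lemma nablaT_neg₃ (h : IsACYT J Ψ D) (v a b c : TangentSpace 𝓘(ℝ, E) x) :
    nablaT D x v a b (-c) = -nablaT D x v a b c := by
  simpa using nablaT_smul₃ h.smooth_connection (-1) v a b c

lemma nablaT_neg₂ (h : IsACYT J Ψ D) (v a b c : TangentSpace 𝓘(ℝ, E) x) :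
    nablaT D x v a (-b) c = -nablaT D x v a b c := by
  rw [nablaT_swap₂₃ h.smooth_connection h.skew_torsion, nablaT_neg₃ h,
    nablaT_swap₂₃ h.smooth_connection h.skew_torsion v a b c]

lemma nablaT_neg₁ (h : IsACYT J Ψ D) (v a b c : TangentSpace 𝓘(ℝ, E) x) :
    nablaT D x v (-a) b c = -nablaT D x v a b c := by
  rw [nablaT_swap₁₂ h.smooth_connection, nablaT_neg₂ h, nablaT_swap₁₂ h.smooth_connection v a]

/-- The Ricci tensor may be computed in any orthonormal basis. -/
lemma ricci_eq_sum (h : IsACYT J Ψ D) {ι : Type*} [Fintype ι]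
    (e : OrthonormalBasis ι ℝ (TangentSpace 𝓘(ℝ, E) x)) (u v : TangentSpace 𝓘(ℝ, E) x) :
    ricci D x u v = ∑ i, curvatureForm D x (e i) u v (e i) :=
  sum_bilinear_orthonormalBasis (LinearMap.mk₂ ℝ (fun a b ↦ curvatureForm D x a u v b)
    (fun a a' b ↦ by
      simp only [curvatureForm, curvature_add₁ h.smooth_connection, inner_add_left])
    (fun r a b ↦ by
      simp only [curvatureForm, curvature_smul₁ h.smooth_connection, real_inner_smul_left,
        smul_eq_mul])
    (fun a b b' ↦ inner_add_right ..) (fun r a b ↦ real_inner_smul_right ..)) _ e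

lemma curvatureForm_trace (he : IsAdapted J Ψ e) (h : IsACYT J Ψ D)
    (u v : TangentSpace 𝓘(ℝ, E) x) :
    curvatureForm D x u v (e 0) (e 1) + curvatureForm D x u v (e 2) (e 3)
      + curvatureForm D x u v (e 4) (e 5) = 0 :=
  sum_inner_curvature_J h he.form u v

lemma sum_curvatureForm_J (he : IsAdapted J Ψ e) (h : IsACYT J Ψ D)
    (u v : TangentSpace 𝓘(ℝ, E) x) : ∑ i, curvatureForm D x u v (e i) (J x (e i)) = 0 := by
  rw [he.sum_J h _ fun a b ↦ curvatureForm_neg₄ u v a b, curvatureForm_swap₃₄ h u v (e 1),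
    curvatureForm_swap₃₄ h u v (e 3), curvatureForm_swap₃₄ h u v (e 5)]
  linarith [curvatureForm_trace he h u v]

/-- `Ric(X, JY) + (∇_X θ)(JY) = -½ (dT ⌟ F)(X, Y)`. -/
lemma ricci_add_covDeriv_leeForm (he : IsAdapted J Ψ e) (h : IsACYT J Ψ D)
    (u v : TangentSpace 𝓘(ℝ, E) x) :
    ricci D x u (J x v) + covDeriv D (leeForm J) x u ![J x v] =
      -(1 / 2) * (torsionD D x u v (e 0) (e 1) + torsionD D x u v (e 2) (e 3)
        + torsionD D x u v (e 4) (e 5)) := by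
  have hD := h.smooth_connection
  have key (f g : TangentSpace 𝓘(ℝ, E) x) :
      -curvatureForm D x f u v g + curvatureForm D x g u v f =
        curvatureForm D x u v f g - nablaT D x u v f g - (1 / 2) * torsionD D x u v f g := by
    have h1 := curvatureForm_cyclic h u v f g
    have h2 : torsionD D x v f g u = -torsionD D x u v f g := by
      rw [torsionD_swap₃₄ h, torsionD_swap₂₃ h, torsionD_swap₁₂ h, neg_neg]
    have h3 := curvatureForm_swap₁₂ (D := D) f u v g
    have h4 := curvatureForm_swap₃₄ h u f v g
    have h5 := curvatureForm_swap₁₂ (D := D) g u v f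
    linarith
  rw [ricci_eq_sum h e, covDeriv_leeForm h u _ e, h.sq_eq_neg, he.sum_J_left h
    (fun a b ↦ nablaT D x u a (-v) b) (fun a b ↦ nablaT_neg₁ h ..) (fun a b ↦ nablaT_neg₃ h ..)]
  simp only [curvatureForm_J h, nablaT_neg₂ h, Finset.sum_neg_distrib]
  rw [he.sum_J h (fun a b ↦ curvatureForm D x a u v b) fun a b ↦ curvatureForm_neg₄ ..,
    he.sum_J h (fun a b ↦ nablaT D x u a v b) fun a b ↦ nablaT_neg₃ h ..,
    nablaT_swap₁₃ h u (e 1), nablaT_swap₁₃ h u (e 3), nablaT_swap₁₃ h u (e 5),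
    nablaT_swap₁₂ hD u (e 0), nablaT_swap₁₂ hD u (e 2), nablaT_swap₁₂ hD u (e 4)]
  linarith [key (e 0) (e 1), key (e 2) (e 3), key (e 4) (e 5), curvatureForm_trace he h u v]

/-- A closed torsion form makes the Nijenhuis tensor parallel. -/
lemma covDeriv_nijenhuisForm_eq_zero (h : IsACYT J Ψ D)
    (hdT : ∀ a b c d : TangentSpace 𝓘(ℝ, E) x, torsionD D x a b c d = 0)
    (v a b c : TangentSpace 𝓘(ℝ, E) x) : covDeriv D (nijenhuisForm J) x v ![a, b, c] = 0 := by
  have h1 (a b c : TangentSpace 𝓘(ℝ, E) x) := curvatureForm_cyclic h v a b c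
  simp only [hdT, mul_zero, sub_zero] at h1
  have hJJ (c d : TangentSpace 𝓘(ℝ, E) x) (u w : TangentSpace 𝓘(ℝ, E) x) :
      curvatureForm D x u w (J x c) (J x d) = curvatureForm D x u w c d := by
    rw [curvatureForm_J h, h.sq_eq_neg, curvatureForm_neg₄, neg_neg]
  rw [covDeriv_nijenhuisForm h, ← h1, ← h1, ← h1, ← h1]
  simp only [hJJ]
  simp only [curvatureForm_J h]
  ring

end Adapted

section Closed

variable {E : Type*} [NormedAddCommGroup E] [NormedSpace ℝ E] [FiniteDimensional ℝ E]
  {M : Type*} [TopologicalSpace M] [T2Space M] [ChartedSpace E M] [IsManifold 𝓘(ℝ, E) ∞ M]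
  [RiemannianBundle (fun x : M ↦ TangentSpace 𝓘(ℝ, E) x)]
  [IsContMDiffRiemannianBundle 𝓘(ℝ, E) ∞ E (fun x : M ↦ TangentSpace 𝓘(ℝ, E) x)]
  {J : Π x : M, TangentSpace 𝓘(ℝ, E) x →L[ℝ] TangentSpace 𝓘(ℝ, E) x}
  {Ψ : Π x : M, (TangentSpace 𝓘(ℝ, E) x) [⋀^Fin 3]→ₗ[ℝ] ℂ}
  {D : CovariantDerivative 𝓘(ℝ, E) E (fun x : M ↦ TangentSpace 𝓘(ℝ, E) x)} {x : M}
  {e : OrthonormalBasis (Fin 6) ℝ (TangentSpace 𝓘(ℝ, E) x)}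

/-! ### Vanishing of `dT` from its contraction -/

lemma nablaT_add₂ (h : IsACYT J Ψ D) (v a b b' c : TangentSpace 𝓘(ℝ, E) x) :
    nablaT D x v a (b + b') c = nablaT D x v a b c + nablaT D x v a b' c := by
  have hs (b : TangentSpace 𝓘(ℝ, E) x) :=
    nablaT_swap₂₃ h.smooth_connection h.skew_torsion v a b c
  rw [hs, hs b, hs b', nablaT_add₃ h.smooth_connection]
  ring

lemma nablaT_smul₂ (h : IsACYT J Ψ D) (r : ℝ) (v a b c : TangentSpace 𝓘(ℝ, E) x) :
    nablaT D x v a (r • b) c = r * nablaT D x v a b c := by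
  have hs (b : TangentSpace 𝓘(ℝ, E) x) :=
    nablaT_swap₂₃ h.smooth_connection h.skew_torsion v a b c
  rw [hs, hs b, nablaT_smul₃ h.smooth_connection]
  ring

lemma nablaT_add₁ (h : IsACYT J Ψ D) (v a a' b c : TangentSpace 𝓘(ℝ, E) x) :
    nablaT D x v (a + a') b c = nablaT D x v a b c + nablaT D x v a' b c := by
  have hs (a : TangentSpace 𝓘(ℝ, E) x) := nablaT_swap₁₂ h.smooth_connection v a b c
  rw [hs, hs a, hs a', nablaT_add₂ h]
  ring

lemma nablaT_smul₁ (h : IsACYT J Ψ D) (r : ℝ) (v a b c : TangentSpace 𝓘(ℝ, E) x) :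
    nablaT D x v (r • a) b c = r * nablaT D x v a b c := by
  have hs (a : TangentSpace 𝓘(ℝ, E) x) := nablaT_swap₁₂ h.smooth_connection v a b c
  rw [hs, hs a, nablaT_smul₂ h]
  ring

lemma torsionD_add₁ (h : IsACYT J Ψ D) (a a' b c d : TangentSpace 𝓘(ℝ, E) x) :
    torsionD D x (a + a') b c d = torsionD D x a b c d + torsionD D x a' b c d := by
  simp only [torsionD_eq h, nablaT_add₀, nablaT_add₁ h, nablaT_add₂ h, torsionSq, map_add,
    add_apply, inner_add_left]
  ring

lemma torsionD_smul₁ (h : IsACYT J Ψ D) (r : ℝ) (a b c d : TangentSpace 𝓘(ℝ, E) x) :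
    torsionD D x (r • a) b c d = r * torsionD D x a b c d := by
  simp only [torsionD_eq h, nablaT_smul₀, nablaT_smul₁ h, nablaT_smul₂ h, torsionSq, map_smul,
    smul_apply, real_inner_smul_left]
  ring

/-- In dimension six `dT` is determined by its contraction with the Kähler form. -/
lemma torsionD_eq_zero (h : IsACYT J Ψ D)
    (hc : ∀ u v : TangentSpace 𝓘(ℝ, E) x, torsionD D x u v (e 0) (e 1)
      + torsionD D x u v (e 2) (e 3) + torsionD D x u v (e 4) (e 5) = 0)
    (a b c d : TangentSpace 𝓘(ℝ, E) x) : torsionD D x a b c d = 0 := by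
  have h0 := four_form_components_eq_zero
    (fun i j k l ↦ torsionD D x (e i) (e j) (e k) (e l))
    (fun i j k l ↦ torsionD_swap₁₂ h ..) (fun i j k l ↦ torsionD_swap₂₃ h ..)
    (fun i j k l ↦ torsionD_swap₃₄ h ..) (fun i j ↦ hc (e i) (e j))
  -- The first argument is linear, so it may be a basis vector; rotate the arguments to repeat.
  have hext {b c d : TangentSpace 𝓘(ℝ, E) x} (hb : ∀ i, torsionD D x (e i) b c d = 0)
      (a : TangentSpace 𝓘(ℝ, E) x) : torsionD D x a b c d = 0 := by
    let φ : TangentSpace 𝓘(ℝ, E) x →ₗ[ℝ] ℝ :=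
      { toFun := fun a ↦ torsionD D x a b c d
        map_add' := fun a a' ↦ torsionD_add₁ h ..
        map_smul' := fun r a ↦ torsionD_smul₁ h .. }
    have hφ : φ = 0 := e.toBasis.ext fun i ↦ by
      rw [e.coe_toBasis]
      exact hb i
    exact congrArg (fun f ↦ f a) hφ
  have hrot (a b c d : TangentSpace 𝓘(ℝ, E) x) : torsionD D x a b c d = -torsionD D x b c d a := by
    rw [torsionD_swap₁₂ h, torsionD_swap₂₃ h, torsionD_swap₃₄ h, neg_neg]
  refine hext (fun i ↦ ?_) a
  rw [hrot, hext (fun j ↦ ?_) b, neg_zero]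
  rw [hrot, hext (fun k ↦ ?_) c, neg_zero]
  rw [hrot, hext (fun l ↦ ?_) d, neg_zero]
  exact h0 l i j k

/-! ### The exterior derivative of the Lee form -/

variable (D e) in
/-- The contraction `T(e₀, e₁) + T(e₂, e₃) + T(e₄, e₅)` of the torsion with the Kähler form. -/
noncomputable def torsionContraction : TangentSpace 𝓘(ℝ, E) x :=
  D.torsion x (e 0) (e 1) + D.torsion x (e 2) (e 3) + D.torsion x (e 4) (e 5)

lemma inner_torsion_rotate (h : IsACYT J Ψ D) (p q r : TangentSpace 𝓘(ℝ, E) x) :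
    inner ℝ (D.torsion x p q) r = inner ℝ (D.torsion x q r) p := by
  rw [inner_torsion_swap₂₃ h.skew_torsion q r p, D.torsion_antisymm, inner_neg_left]

/-- `θ(w) = -g(t, Jw)`, where `t` is the contraction of the torsion with the Kähler form. -/
lemma leeForm_eq_inner (he : IsAdapted J Ψ e) (h : IsACYT J Ψ D) (w : TangentSpace 𝓘(ℝ, E) x) :
    leeForm J x ![w] = -inner ℝ (torsionContraction D e) (J x w) := by
  rw [leeForm_eq_trace h.toIsAlmostHermitian h.metric h.parallel_J h.skew_torsion,
    LinearMap.trace_eq_sum_inner _ e]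
  have h1 (z : TangentSpace 𝓘(ℝ, E) x) : inner ℝ z (leeEndo J D x w z) =
      inner ℝ (D.torsion x z (J x z)) (J x w) := by
    rw [leeEndo_apply, real_inner_comm, inner_torsion_rotate h z]
  simp only [h1]
  rw [he.sum_J h (fun a b ↦ inner ℝ (D.torsion x a b) (J x w)) fun a b ↦ by
    rw [map_neg, inner_neg_left], D.torsion_antisymm (e 1), D.torsion_antisymm (e 3),
    D.torsion_antisymm (e 5)]
  simp only [torsionContraction, inner_add_left, inner_neg_left]
  ring

variable (D e) in
/-- Half the contraction of the 4-form `Q` with the Kähler form. -/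
noncomputable def torsionSqContraction (u v : TangentSpace 𝓘(ℝ, E) x) : ℝ :=
  torsionSq D x u v (e 0) (e 1) + torsionSq D x u v (e 2) (e 3) + torsionSq D x u v (e 4) (e 5)

/-- `ACYT.torsionSqContraction_add` on the vectors of an adapted frame, where `J eᵢ = sᵢ e_{p(i)}`
with a sign `sᵢ` and an involution `p`. -/
lemma torsionSqContraction_add_basis (he : IsAdapted J Ψ e) (h : IsACYT J Ψ D) (i j : Fin 6) :
    torsionSqContraction D e (e i) (J x (e j)) + torsionSqContraction D e (J x (e i)) (e j) =
      inner ℝ (torsionContraction D e)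
        (J x (D.torsion x (e i) (e j) - D.torsion x (J x (e i)) (J x (e j)))) := by
  obtain ⟨s, hs⟩ : ∃ s : Fin 6 → ℝ, s = ![1, -1, 1, -1, 1, -1] := ⟨_, rfl⟩
  obtain ⟨p, hp⟩ : ∃ p : Fin 6 → Fin 6, p = ![1, 0, 3, 2, 5, 4] := ⟨_, rfl⟩
  have hJe (i : Fin 6) : J x (e i) = s i • e (p i) := by
    fin_cases i <;>
      simp [hs, hp, he.map_zero, he.map_one h, he.map_two, he.map_three h, he.map_four,
        he.map_five h]
  obtain ⟨c, hc⟩ : ∃ c : Fin 6 → Fin 6 → Fin 6 → ℝ,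
    ∀ i j k, inner ℝ (D.torsion x (e i) (e j)) (e k) = c i j k := ⟨_, fun i j k ↦ rfl⟩
  have hcc (a b i j : Fin 6) : inner ℝ (D.torsion x (e a) (e b)) (D.torsion x (e i) (e j)) =
      ∑ m, c a b m * c i j m := by
    rw [← e.sum_inner_mul_inner]
    simp only [← hc, real_inner_comm (e _)]
  have key := quadratic_identity_components c
    (fun i j k ↦ by rw [← hc, ← hc, D.torsion_antisymm, inner_neg_left])
    (fun i j k ↦ by rw [← hc, ← hc]; exact inner_torsion_swap₂₃ h.skew_torsion ..)
    (q := fun i j ↦ torsionSqContraction D e (e i) (e j))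
    (fun i j ↦ by
      simp only [torsionSqContraction, torsionSq_eq_inner h, hcc, ← Finset.sum_add_distrib]
      refine Finset.sum_congr rfl fun m _ ↦ ?_
      ring)
    (t := fun m ↦ inner ℝ (torsionContraction D e) (e m))
    (fun m ↦ by simp only [torsionContraction, inner_add_left, hc]) hs hp i j
  have hq₁ (r : ℝ) (u v : TangentSpace 𝓘(ℝ, E) x) :
      torsionSqContraction D e (r • u) v = r * torsionSqContraction D e u v := by
    simp only [torsionSqContraction, torsionSq, map_smul, smul_apply, real_inner_smul_left]
    ring
  have hq₂ (r : ℝ) (u v : TangentSpace 𝓘(ℝ, E) x) :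
      torsionSqContraction D e u (r • v) = r * torsionSqContraction D e u v := by
    simp only [torsionSqContraction, torsionSq, map_smul, smul_apply, real_inner_smul_left]
    ring
  have hm (w : TangentSpace 𝓘(ℝ, E) x) : inner ℝ (torsionContraction D e) (J x w) =
      ∑ m, s m * inner ℝ (torsionContraction D e) (e (p m)) * inner ℝ w (e m) := by
    conv_lhs => rw [← e.sum_repr' w]
    simp only [map_sum, map_smul, hJe, inner_sum, real_inner_smul_right, real_inner_comm (e _)]
    refine Finset.sum_congr rfl fun m _ ↦ ?_
    ring
  rw [hJe, hJe, hq₁, hq₂, key, hm]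
  refine Finset.sum_congr rfl fun m _ ↦ ?_
  simp only [map_smul, smul_apply, inner_sub_left, real_inner_smul_left, hc]
  ring

/-- The part of the contraction of `Q` of type `(2,0) + (0,2)`, in terms of the Lee form. -/
lemma torsionSqContraction_add (he : IsAdapted J Ψ e) (h : IsACYT J Ψ D)
    (u v : TangentSpace 𝓘(ℝ, E) x) :
    torsionSqContraction D e u (J x v) + torsionSqContraction D e (J x u) v =
      -leeForm J x ![D.torsion x u v - D.torsion x (J x u) (J x v)] := by
  rw [leeForm_eq_inner he h, neg_neg]
  let Φ : TangentSpace 𝓘(ℝ, E) x →ₗ[ℝ] TangentSpace 𝓘(ℝ, E) x →ₗ[ℝ] ℝ :=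
    LinearMap.mk₂ ℝ (fun u v ↦ torsionSqContraction D e u (J x v)
      + torsionSqContraction D e (J x u) v
      - inner ℝ (torsionContraction D e) (J x (D.torsion x u v - D.torsion x (J x u) (J x v))))
      (fun u u' v ↦ by
        simp only [torsionSqContraction, torsionSq, map_add, add_apply, map_sub, inner_add_left,
          inner_add_right, inner_sub_right]
        ring)
      (fun r u v ↦ by
        simp only [torsionSqContraction, torsionSq, map_smul, smul_apply, map_sub,
          real_inner_smul_left, real_inner_smul_right, inner_sub_right, smul_eq_mul]
        ring)
      (fun u v v' ↦ by
        simp only [torsionSqContraction, torsionSq, map_add, add_apply, map_sub, inner_add_left,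
          inner_add_right, inner_sub_right]
        ring)
      (fun r u v ↦ by
        simp only [torsionSqContraction, torsionSq, map_smul, smul_apply, map_sub,
          real_inner_smul_left, real_inner_smul_right, inner_sub_right, smul_eq_mul]
        ring)
  have hΦ : Φ = 0 := LinearMap.ext_basis e.toBasis e.toBasis fun i j ↦ by
    rw [e.coe_toBasis]
    exact sub_eq_zero.2 (torsionSqContraction_add_basis he h i j)
  exact sub_eq_zero.1 (congrArg (fun f ↦ f u v) hΦ)

/-- If `dT = 0`, the skew-symmetric part of the Ricci tensor is a divergence of the torsion. -/
lemma ricci_sub_ricci (h : IsACYT J Ψ D)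
    (hdT : ∀ a b c d : TangentSpace 𝓘(ℝ, E) x, torsionD D x a b c d = 0)
    (e : OrthonormalBasis (Fin 6) ℝ (TangentSpace 𝓘(ℝ, E) x)) (u v : TangentSpace 𝓘(ℝ, E) x) :
    ricci D x u v - ricci D x v u = ∑ i, nablaT D x (e i) u v (e i) := by
  rw [ricci_eq_sum h e, ricci_eq_sum h e, ← Finset.sum_sub_distrib]
  refine Finset.sum_congr rfl fun i _ ↦ ?_
  have h1 := curvatureForm_cyclic h (e i) u v (e i)
  rw [hdT] at h1
  have h2 := curvatureForm_swap₁₂ (D := D) (e i) (e i) u v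
  have h3 := curvatureForm_swap₃₄ h (e i) v (e i) u
  linarith

/-- If `dT = 0`, the contraction of the Bianchi identity with the Kähler form, in which
`∑ᵢ R(u, v, eᵢ, J eᵢ)` vanishes. -/
lemma ricci_J_sub_ricci_J (he : IsAdapted J Ψ e) (h : IsACYT J Ψ D)
    (hdT : ∀ a b c d : TangentSpace 𝓘(ℝ, E) x, torsionD D x a b c d = 0)
    (u v : TangentSpace 𝓘(ℝ, E) x) :
    ricci D x v (J x u) - ricci D x u (J x v) =
      ∑ i, nablaT D x (J x (e i)) u v (e i) - 2 * torsionSqContraction D e u v := by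
  have h1 : 2 * torsionSqContraction D e u v = ∑ i, torsionSq D x u v (e i) (J x (e i)) := by
    rw [he.sum_J h (fun a b ↦ torsionSq D x u v a b) fun a b ↦ by
      simp only [torsionSq, inner_neg_right]; ring, torsionSq_swap₃₄ h u v (e 1),
      torsionSq_swap₃₄ h u v (e 3), torsionSq_swap₃₄ h u v (e 5), torsionSqContraction]
    ring
  have h2 := sum_curvatureForm_J he h u v
  have h3 (i : Fin 6) : curvatureForm D x (e i) v (J x u) (e i)
      - curvatureForm D x (e i) u (J x v) (e i) = nablaT D x (J x (e i)) u v (e i)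
        - torsionSq D x u v (e i) (J x (e i)) - curvatureForm D x u v (e i) (J x (e i)) := by
    have h4 := bianchi_torsionD h u v (e i) (J x (e i))
    rw [hdT, curvatureForm_swap₁₂ v (e i)] at h4
    rw [curvatureForm_J h, curvatureForm_J h]
    linarith
  rw [ricci_eq_sum h e, ricci_eq_sum h e, ← Finset.sum_sub_distrib, h1]
  simp only [h3, Finset.sum_sub_distrib, h2, sub_zero]

/-- `Ric = -∇θ` when `dT = 0`. -/
lemma ricci_eq_neg_covDeriv_leeForm (he : IsAdapted J Ψ e) (h : IsACYT J Ψ D)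
    (hdT : ∀ a b c d : TangentSpace 𝓘(ℝ, E) x, torsionD D x a b c d = 0)
    (u v : TangentSpace 𝓘(ℝ, E) x) : ricci D x u v = -covDeriv D (leeForm J) x u ![v] := by
  have h1 := ricci_add_covDeriv_leeForm he h u (-J x v)
  rw [map_neg, h.sq_eq_neg, neg_neg, hdT, hdT, hdT] at h1
  linarith

/-- If `dT = 0` then `dθ` is `J`-invariant. -/
lemma extD_leeForm_J (he : IsAdapted J Ψ e) (h : IsACYT J Ψ D)
    (hdT : ∀ a b c d : TangentSpace 𝓘(ℝ, E) x, torsionD D x a b c d = 0)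
    (u v : TangentSpace 𝓘(ℝ, E) x) :
    extD (leeForm J) x ![u, v] = extD (leeForm J) x ![J x u, J x v] := by
  have hR := ricci_eq_neg_covDeriv_leeForm he h hdT
  have hQ := torsionSqContraction_add he h u v
  rw [leeForm_sub h] at hQ
  have b1 := ricci_J_sub_ricci_J he h hdT u (J x v)
  have b2 := ricci_J_sub_ricci_J he h hdT (J x u) v
  have a1 := ricci_sub_ricci h hdT e u v
  have a2 := ricci_sub_ricci h hdT e (J x u) (J x v)
  have hneg (a b : TangentSpace 𝓘(ℝ, E) x) : ricci D x a (-b) = -ricci D x a b := by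
    rw [hR, hR, covDeriv_leeForm h _ _ e, covDeriv_leeForm h _ _ e]
    simp only [map_neg, nablaT_neg₂ h, Finset.sum_neg_distrib]
    ring
  have hs (a b : TangentSpace 𝓘(ℝ, E) x) : ∑ i, nablaT D x (J x (e i)) a b (e i) =
      -∑ i, nablaT D x (e i) a b (J x (e i)) :=
    he.sum_J_left h (fun p q ↦ nablaT D x p a b q) (fun p q ↦ nablaT_neg₀ ..)
      (fun p q ↦ nablaT_neg₃ h ..)
  -- Contract `∇N = 0`.
  have hN : ∑ i, nablaT D x (e i) u v (e i) - ∑ i, nablaT D x (e i) (J x u) (J x v) (e i) =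
      ∑ i, nablaT D x (e i) (J x u) v (J x (e i))
        + ∑ i, nablaT D x (e i) u (J x v) (J x (e i)) := by
    rw [← Finset.sum_sub_distrib, ← Finset.sum_add_distrib]
    refine Finset.sum_congr rfl fun i _ ↦ ?_
    have := covDeriv_nijenhuisForm_eq_zero h hdT (e i) u v (e i)
    rw [covDeriv_nijenhuisForm h] at this
    linarith
  rw [h.sq_eq_neg, hneg, hs] at b1 b2
  rw [extD_leeForm h, extD_leeForm h]
  linarith [hR u v, hR v u, hR (J x u) (J x v), hR (J x v) (J x u)]

lemma sum_sum_mul_kahlerForm {ι : Type*} [Fintype ι]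
    (b : OrthonormalBasis ι ℝ (TangentSpace 𝓘(ℝ, E) x))
    (B : TangentSpace 𝓘(ℝ, E) x →ₗ[ℝ] TangentSpace 𝓘(ℝ, E) x →ₗ[ℝ] ℝ) :
    ∑ i, ∑ j, B (b i) (b j) * kahlerForm J x ![b i, b j] = ∑ j, B (J x (b j)) (b j) := by
  rw [Finset.sum_comm]
  refine Finset.sum_congr rfl fun j _ ↦ ?_
  conv_rhs => rw [← b.sum_repr' (J x (b j))]
  simp [kahlerForm, mul_comm]

/-- If `dT = 0` then `dθ` is trace-free. -/
lemma extD_leeForm_trace (he : IsAdapted J Ψ e) (h : IsACYT J Ψ D)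
    (hdT : ∀ a b c d : TangentSpace 𝓘(ℝ, E) x, torsionD D x a b c d = 0) {ι : Type*} [Fintype ι]
    (b : OrthonormalBasis ι ℝ (TangentSpace 𝓘(ℝ, E) x)) :
    ∑ i, ∑ j, extD (leeForm J) x ![b i, b j] * kahlerForm J x ![b i, b j] = 0 := by
  have hR := ricci_eq_neg_covDeriv_leeForm he h hdT
  have hd (u v : TangentSpace 𝓘(ℝ, E) x) : extD (leeForm J) x ![u, v] =
      -(1 / 2) * ∑ i, nablaT D x u (J x (e i)) (J x v) (e i)
        - -(1 / 2) * ∑ i, nablaT D x v (J x (e i)) (J x u) (e i)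
        + -inner ℝ (torsionContraction D e) (J x (D.torsion x u v)) := by
    rw [extD_leeForm h, covDeriv_leeForm h _ _ e, covDeriv_leeForm h _ _ e, leeForm_eq_inner he h]
  let B : TangentSpace 𝓘(ℝ, E) x →ₗ[ℝ] TangentSpace 𝓘(ℝ, E) x →ₗ[ℝ] ℝ :=
    LinearMap.mk₂ ℝ (fun u v ↦ extD (leeForm J) x ![u, v])
      (fun u u' v ↦ by
        simp only [hd, map_add, add_apply, inner_add_right, nablaT_add₀, nablaT_add₂ h,
          Finset.sum_add_distrib]
        ring)
      (fun r u v ↦ by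
        simp only [hd, map_smul, smul_apply, real_inner_smul_right, nablaT_smul₀, nablaT_smul₂ h,
          ← Finset.mul_sum, smul_eq_mul]
        ring)
      (fun u v v' ↦ by
        simp only [hd, map_add, inner_add_right, nablaT_add₀, nablaT_add₂ h, Finset.sum_add_distrib]
        ring)
      (fun r u v ↦ by
        simp only [hd, map_smul, real_inner_smul_right, nablaT_smul₀, nablaT_smul₂ h,
          ← Finset.mul_sum, smul_eq_mul]
        ring)
  have hB (u v : TangentSpace 𝓘(ℝ, E) x) : B u v = ricci D x v u - ricci D x u v
      + -inner ℝ (torsionContraction D e) (J x (D.torsion x u v)) := by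
    change extD (leeForm J) x ![u, v] = _
    rw [extD_leeForm h, leeForm_eq_inner he h, hR, hR]
    ring
  have h1 := sum_sum_mul_kahlerForm (J := J) b B
  have h2 := sum_bilinear_orthonormalBasis (B ∘ₗ (J x).toLinearMap) b e
  have h3 : ∑ i, B (J x (e i)) (e i) = -∑ i, B (e i) (J x (e i)) :=
    he.sum_J_left h (fun u v ↦ B u v) (by simp) (by simp)
  have hneg₁ (a c : TangentSpace 𝓘(ℝ, E) x) : ricci D x (-a) c = -ricci D x a c := by
    rw [hR, hR, covDeriv_leeForm h _ _ e, covDeriv_leeForm h _ _ e]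
    simp only [nablaT_neg₀, Finset.sum_neg_distrib]
    ring
  have hneg₂ (a c : TangentSpace 𝓘(ℝ, E) x) : ricci D x a (-c) = -ricci D x a c := by
    rw [hR, hR, covDeriv_leeForm h _ _ e, covDeriv_leeForm h _ _ e]
    simp only [map_neg, nablaT_neg₂ h, Finset.sum_neg_distrib]
    ring
  have h4 : ∑ i, ricci D x (J x (e i)) (e i) = -∑ i, ricci D x (e i) (J x (e i)) :=
    he.sum_J_left h (fun u v ↦ ricci D x u v) hneg₁ hneg₂
  -- `R(eₖ, eᵢ, J eᵢ, eₖ)` is skew-symmetric in `i` and `k`.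
  have h5 : ∑ i, ricci D x (e i) (J x (e i)) = 0 := by
    have hskew (i k : Fin 6) : curvatureForm D x (e k) (e i) (J x (e i)) (e k) =
        -curvatureForm D x (e i) (e k) (J x (e k)) (e i) := by
      rw [curvatureForm_swap₁₂, curvatureForm_J h, curvatureForm_swap₃₄ h]
      ring
    have h6 : ∑ i, ∑ k, curvatureForm D x (e k) (e i) (J x (e i)) (e k) =
        -∑ i, ∑ k, curvatureForm D x (e k) (e i) (J x (e i)) (e k) := by
      conv_lhs => rw [Finset.sum_comm]
      simp only [← Finset.sum_neg_distrib]
      exact Finset.sum_congr rfl fun i _ ↦ Finset.sum_congr rfl fun k _ ↦ by rw [hskew]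
    simp only [ricci_eq_sum h e]
    linarith
  have h6 : inner ℝ (torsionContraction D e) (J x (torsionContraction D e)) = (0 : ℝ) := by
    have := h.inner_map_left (torsionContraction D e) (torsionContraction D e)
    rw [real_inner_comm] at this
    linarith
  have h7 : ∑ i, inner ℝ (torsionContraction D e) (J x (D.torsion x (e i) (J x (e i)))) =
      (0 : ℝ) := by
    rw [he.sum_J h (fun a c ↦ inner ℝ (torsionContraction D e) (J x (D.torsion x a c)))
      (fun a c ↦ by simp only [map_neg, inner_neg_right]), D.torsion_antisymm (e 1),
      D.torsion_antisymm (e 3), D.torsion_antisymm (e 5)]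
    have h8 : inner ℝ (torsionContraction D e) (J x (D.torsion x (e 0) (e 1)))
        + inner ℝ (torsionContraction D e) (J x (D.torsion x (e 2) (e 3)))
        + inner ℝ (torsionContraction D e) (J x (D.torsion x (e 4) (e 5))) = (0 : ℝ) := by
      rw [← inner_add_right, ← inner_add_right, ← map_add, ← map_add]
      exact h6
    simp only [map_neg, inner_neg_right]
    linarith
  have h8 : ∑ i, B (e i) (J x (e i)) = 0 := by
    simp only [hB, Finset.sum_add_distrib, Finset.sum_sub_distrib, Finset.sum_neg_distrib, h4, h5,
      h7]
    simp
  rw [h8, neg_zero] at h3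
  exact h1.trans (h2.trans h3)

end Closed

section Equivalence

variable {E : Type*} [NormedAddCommGroup E] [NormedSpace ℝ E] [FiniteDimensional ℝ E]
  {M : Type*} [TopologicalSpace M] [T2Space M] [ChartedSpace E M] [IsManifold 𝓘(ℝ, E) ∞ M]
  [RiemannianBundle (fun x : M ↦ TangentSpace 𝓘(ℝ, E) x)]
  [IsContMDiffRiemannianBundle 𝓘(ℝ, E) ∞ E (fun x : M ↦ TangentSpace 𝓘(ℝ, E) x)]
  {J : Π x : M, TangentSpace 𝓘(ℝ, E) x →L[ℝ] TangentSpace 𝓘(ℝ, E) x}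
  {Ψ : Π x : M, (TangentSpace 𝓘(ℝ, E) x) [⋀^Fin 3]→ₗ[ℝ] ℂ}
  {D : CovariantDerivative 𝓘(ℝ, E) E (fun x : M ↦ TangentSpace 𝓘(ℝ, E) x)}

/-! ### The equivalence -/

/-- The torsion is closed if `Ric = -∇θ`. -/
lemma extD_torsionForm_eq_zero_of_ricci (h : IsACYT J Ψ D)
    (hR : ∀ (x : M) (u v : TangentSpace 𝓘(ℝ, E) x),
      ricci D x u v = -covDeriv D (leeForm J) x u ![v])
    (x : M) (w : Fin 4 → TangentSpace 𝓘(ℝ, E) x) : extD (torsionForm D) x w = 0 := by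
  obtain ⟨e, he⟩ := exists_isAdapted x h
  have hw : w = ![w 0, w 1, w 2, w 3] := by
    ext i; fin_cases i <;> rfl
  rw [hw]
  refine torsionD_eq_zero (e := e) h (fun u v ↦ ?_) _ _ _ _
  have h1 := ricci_add_covDeriv_leeForm he h u v
  rw [hR] at h1
  linarith

end Equivalence

end ACYT

theorem mainTheorem6 {M : Type*} [TopologicalSpace M] [T2Space M] [SecondCountableTopology M]
    [ChartedSpace (EuclideanSpace ℝ (Fin 6)) M]
    [IsManifold (𝓡 6) ∞ M]
    [RiemannianBundle (fun x : M ↦ TangentSpace (𝓡 6) x)]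
    [IsContMDiffRiemannianBundle (𝓡 6) ∞ (EuclideanSpace ℝ (Fin 6))
      (fun x : M ↦ TangentSpace (𝓡 6) x)]
    (J : Π x : M, TangentSpace (𝓡 6) x →L[ℝ] TangentSpace (𝓡 6) x)
    (Ψ : Π x : M, (TangentSpace (𝓡 6) x) [⋀^Fin 3]→ₗ[ℝ] ℂ)
    (D : CovariantDerivative (𝓡 6) (EuclideanSpace ℝ (Fin 6))
      (fun x : M ↦ TangentSpace (𝓡 6) x))
    (h : ACYT.IsACYT J Ψ D) :
    List.TFAE [
      ∀ x w, ACYT.extD (ACYT.torsionForm D) x w = 0,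
      ACYT.IsInLambda28 J (ACYT.extD (ACYT.leeForm J)) ∧
        ∀ x u v, ACYT.ricci D x u v = -ACYT.covDeriv D (ACYT.leeForm J) x u ![v],
      (∀ x v w, ACYT.covDeriv D (ACYT.nijenhuisForm J) x v w = 0) ∧
        ∀ x u v, ACYT.ricci D x u v = -ACYT.covDeriv D (ACYT.leeForm J) x u ![v]] := by
  have hR (hdT : ∀ x w, ACYT.extD (ACYT.torsionForm D) x w = 0) :
      ∀ x u v, ACYT.ricci D x u v = -ACYT.covDeriv D (ACYT.leeForm J) x u ![v] := by
    intro x u v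
    obtain ⟨e, he⟩ := ACYT.exists_isAdapted x h
    exact ACYT.ricci_eq_neg_covDeriv_leeForm he h (fun a b c d ↦ hdT x ![a, b, c, d]) u v
  tfae_have 1 → 2 := by
    refine fun hdT ↦ ⟨fun x ↦ ?_, hR hdT⟩
    obtain ⟨e, he⟩ := ACYT.exists_isAdapted x h
    have hdTx (a b c d : TangentSpace (𝓡 6) x) : ACYT.torsionD D x a b c d = 0 :=
      hdT x ![a, b, c, d]
    exact ⟨ACYT.extD_leeForm_J he h hdTx, ACYT.extD_leeForm_trace he h hdTx _⟩
  tfae_have 1 → 3 := by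
    refine fun hdT ↦ ⟨fun x v w ↦ ?_, hR hdT⟩
    have hw : w = ![w 0, w 1, w 2] := by
      ext1 i; fin_cases i <;> rfl
    rw [hw]
    exact ACYT.covDeriv_nijenhuisForm_eq_zero h (fun a b c d ↦ hdT x ![a, b, c, d]) v _ _ _
  tfae_have 2 → 1 := fun h2 ↦ ACYT.extD_torsionForm_eq_zero_of_ricci h h2.2
  tfae_have 3 → 1 := fun h3 ↦ ACYT.extD_torsionForm_eq_zero_of_ricci h h3.2
  tfae_finish
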